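/- Let $M$ be an oriented smooth $3$-manifold, possibly with boundary (Hausdorff and second countable), and let $\iota:\partial M\to M$ be the inclusion of its boundary, which carries the induced orientation (outward normal first), a Lorentzian metric $g$ of signature $(-,+)$ and a time-orientation. Fix a sign $\pm$. A $+$-chiral (respectively $-$-chiral) flow on $\partial M$ is the global flow of a complete smooth vector field of nonzero null vectors $v$ with $g(\tau,v)<0$ and with $(\tau,v)$ positively (respectively negatively) oriented, where $\tau$ is a timelike vector field representing the time-orientation. Let $\Theta_\pm$ be a $\pm$-chiral flow on $\partial M$ and let $\widehat\Theta_\pm:\mathbb R\times M\to M$ be a proper smooth $\mathbb R$-action which extends it, i.e. $\widehat\Theta_\pm(s,\iota(p))=\iota(\Theta_\pm(s,p))$. For an open set $U\subseteq M$ let $\Omega^k_{\mathfrak L^\pm,\mathrm c}(U)$ be the space of smooth $k$-forms $\varphi$ with compact support in $U$ that satisfy the (anti-)self-dual boundary condition: $\iota^*\varphi=0$ if $k=0$, and $\ast\,\iota^*\varphi=\pm\iota^*\varphi$ if $k=1$ (no condition if $k\ge 2$), where $\ast$ is the Hodge operator of $\partial M$, with $\beta\wedge\ast\alpha=g^{-1}(\beta,\alpha)\,\mathrm{vol}_g$.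 With the de Rham differential these spaces form a cochain complex, and the complex of linear observables on $U$ is $\mathfrak F_{\mathfrak L^\pm,\mathrm c}(U)[1]=\Omega^\bullet_{\mathfrak L^\pm,\mathrm c}(U)[2]$. (Conventions: $C[p]^i=C^{i+p}$ with differential $(-1)^p\mathrm d$.) Then the orbit space $B_\pm=M/\widehat\Theta_\pm$, with the quotient topology, carries a structure of smooth $2$-manifold with boundary for which the quotient map $\widehat\pi_\pm:M\to B_\pm$ is a smooth submersion. With respect to any such structure the following holds for every open subset $V\subseteq B_\pm$. Let $\Omega^\bullet_{\partial,\mathrm c}(V)\subseteq\Omega^\bullet_{\mathrm c}(V)$ be the subcomplex of those compactly supported smooth forms on $V$ whose $0$-forms vanish on $\partial V=V\cap\partial B_\pm$. (1) Integration along the fibers of $\widehat\pi_\pm$ (fibers oriented by the $\mathbb R$-action, fiber-first convention), $$\big((\widehat\pi_\pm)_*\varphi\big)(\mathrm d\widehat\pi_\pm w_1,\dots,\mathrm d\widehat\pi_\pm w_k)=\int_{\mathbb R}\varphi\big(\partial_s\widehat\Theta_{\pm,s}(p),\,\mathrm d\widehat\Theta_{\pm,s}w_1,\dots,\mathrm d\widehat\Theta_{\pm,s}w_k\big)\,\mathrm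 ds\qquad(w_i\in T_pM),$$ defines a cochain map $$(\widehat\pi_\pm)_*:\mathfrak F_{\mathfrak L^\pm,\mathrm c}\big(\widehat\pi_\pm^{-1}(V)\big)[1]\longrightarrow\Omega^\bullet_{\partial,\mathrm c}(V)[1],$$ that is, fiber integration of boundary-conditioned observables takes values in $\Omega^\bullet_{\partial,\mathrm c}(V)[1]$. (2) This cochain map is a quasi-isomorphism. (3) There are trivializations of $\widehat\pi_\pm$ over $V$, i.e. smooth functions $t:\widehat\pi_\pm^{-1}(V)\to\mathbb R$ with $t(\widehat\Theta_\pm(s,p))=t(p)+s$. For every such $t$ and every $\omega=\rho\,\mathrm dr\in\Omega^1_{\mathrm c}(\mathbb R)$ with $\int_{\mathbb R}\omega=1$, the assignment $\omega_*:\alpha\mapsto t^*\omega\wedge\widehat\pi_\pm^*\alpha$ (extended by zero) is a cochain map $\Omega^\bullet_{\partial,\mathrm c}(V)[1]\to\mathfrak F_{\mathfrak L^\pm,\mathrm c}(\widehat\pi_\pm^{-1}(V))[1]$ with $(\widehat\pi_\pm)_*\circ\omega_*=\mathrm{id}$, and $\omega_*\circ(\widehat\pi_\pm)_*$ is cochain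 homotopic to the identity. -/

import Mathlib

open Set Filter Topology
open scoped Manifold ContDiff

noncomputable section
section Forms
variable {E : Type} [NormedAddCommGroup E] [NormedSpace ℝ E] {H : Type} [TopologicalSpace H]
  (I : ModelWithCorners ℝ E H) (X : Type*) [TopologicalSpace X] [ChartedSpace H X]

/-- Differential `k`-forms (with no regularity imposed) on a manifold `X`, possibly with boundary:
a family of alternating `k`-linear forms on the tangent spaces. -/
abbrev DForm (k : ℕ) := ∀ x : X, TangentSpace I x [⋀^Fin k]→L[ℝ] ℝ

variable {I X} {k : ℕ}

/-- The expression of a form in the preferred chart at `x₀`: its pullback along the inverse chart. -/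
def DForm.inChart (α : DForm I X k) (x₀ : X) : E → E [⋀^Fin k]→L[ℝ] ℝ := fun y =>
  (α ((extChartAt I x₀).symm y)).compContinuousLinearMap
    (mfderivWithin 𝓘(ℝ, E) I (extChartAt I x₀).symm (range I) y)

/-- A form is smooth if all its chart expressions are smooth (up to the boundary). -/
def DForm.Smooth (α : DForm I X k) : Prop :=
  ∀ x₀ : X, ContDiffOn ℝ ∞ (α.inChart x₀) (extChartAt I x₀).target

/-- The de Rham differential: in the preferred chart at `x` take the exterior derivative of the chart
expression, and pull the result back along the chart. The result `DForm.Smooth.inChart_extD`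
below says that this is the exterior derivative in every chart. -/
def DForm.extD (α : DForm I X k) : DForm I X (k + 1) := fun x =>
  (extDerivWithin (α.inChart x) (range I) (extChartAt I x x)).compContinuousLinearMap
    (mfderiv I 𝓘(ℝ, E) (extChartAt I x) x)

theorem two_le_smooth : (2 : WithTop ℕ∞) ≤ ∞ := by
  exact WithTop.coe_le_coe.2 (le_top : (2 : ℕ∞) ≤ ⊤)

theorem DForm.inChart_change [IsManifold I ∞ X] (α : DForm I X k) (x₀ x₁ : X) {y : E}
    (hy : y ∈ (extChartAt I x₀).target) (hy' : (extChartAt I x₀).symm y ∈ (extChartAt I x₁).source) :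
    α.inChart x₀ y = (α.inChart x₁ (extChartAt I x₁ ((extChartAt I x₀).symm y))).compContinuousLinearMap
      (fderivWithin ℝ (extChartAt I x₁ ∘ (extChartAt I x₀).symm) (range I) y) := by
  have : IsManifold I 1 X := IsManifold.of_le (n := ∞) (by simp)
  have hyr : y ∈ range I := extChartAt_target_subset_range x₀ hy
  have hu : UniqueDiffWithinAt ℝ (range I) y := I.uniqueDiffOn y hyr
  have hmu : UniqueMDiffWithinAt 𝓘(ℝ, E) (range I) y := hu.uniqueMDiffWithinAt
  have e : (extChartAt I x₁).symm (extChartAt I x₁ ((extChartAt I x₀).symm y)) =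
      (extChartAt I x₀).symm y := (extChartAt I x₁).left_inv hy'
  have h1 : mfderivWithin 𝓘(ℝ, E) I ((extChartAt I x₁).symm ∘ (extChartAt I x₁ ∘ (extChartAt I x₀).symm))
      (range I) y = (mfderivWithin 𝓘(ℝ, E) I (extChartAt I x₁).symm (range I)
        ((extChartAt I x₁ ∘ (extChartAt I x₀).symm) y)).comp
        (mfderivWithin 𝓘(ℝ, E) 𝓘(ℝ, E) (extChartAt I x₁ ∘ (extChartAt I x₀).symm) (range I) y) := by
    apply mfderivWithin_comp _ _ _ _ hmu
    · exact mdifferentiableWithinAt_extChartAt_symm ((extChartAt I x₁).map_source hy')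
    · have ha := mdifferentiableAt_extChartAt (I := I) (by simpa using hy' : (extChartAt I x₀).symm y ∈ (chartAt H x₁).source)
      exact ha.comp_mdifferentiableWithinAt _ (mdifferentiableWithinAt_extChartAt_symm hy)
    · intro z _
      exact mem_range_self _
  have h2 : mfderivWithin 𝓘(ℝ, E) I ((extChartAt I x₁).symm ∘ (extChartAt I x₁ ∘ (extChartAt I x₀).symm))
      (range I) y = mfderivWithin 𝓘(ℝ, E) I (extChartAt I x₀).symm (range I) y := by
    apply Filter.EventuallyEq.mfderivWithin_eq
    · have hc : ContinuousWithinAt (extChartAt I x₀).symm (range I) y :=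
        (mdifferentiableWithinAt_extChartAt_symm hy).continuousWithinAt
      filter_upwards [hc.preimage_mem_nhdsWithin ((isOpen_extChartAt_source (I := I) x₁).mem_nhds hy')] with z hz
      exact (extChartAt I x₁).left_inv hz
    · exact e
  let αE : X → E [⋀^Fin k]→L[ℝ] ℝ := α
  change (αE _).compContinuousLinearMap (_ : E →L[ℝ] E) =
    ((αE ((extChartAt I x₁).symm (extChartAt I x₁ ((extChartAt I x₀).symm y)))).compContinuousLinearMap
      (_ : E →L[ℝ] E)).compContinuousLinearMap (_ : E →L[ℝ] E)
  rw [e]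
  rw [h1] at h2
  rw [mfderivWithin_eq_fderivWithin] at h2
  rw [← h2]
  rfl

theorem DForm.Smooth.contDiffWithinAt {α : DForm I X k} (hα : α.Smooth) (x₀ : X) {y : E}
    (hy : y ∈ (extChartAt I x₀).target) : ContDiffWithinAt ℝ ∞ (α.inChart x₀) (range I) y :=
  (hα x₀ y hy).mono_of_mem_nhdsWithin (extChartAt_target_mem_nhdsWithin_of_mem hy)

theorem DForm.Smooth.inChart_extD [IsManifold I ∞ X] {α : DForm I X k} (hα : α.Smooth)
    (x₀ : X) {y : E} (hy : y ∈ (extChartAt I x₀).target) :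
    α.extD.inChart x₀ y = extDerivWithin (α.inChart x₀) (range I) y := by
  have : IsManifold I 1 X := IsManifold.of_le (n := ∞) (by simp)
  have hyr : y ∈ range I := extChartAt_target_subset_range x₀ hy
  have hmu : UniqueMDiffWithinAt 𝓘(ℝ, E) (range I) y := (I.uniqueDiffOn y hyr).uniqueMDiffWithinAt
  set x := (extChartAt I x₀).symm y with hx
  have hy' : (extChartAt I x₀).symm y ∈ (extChartAt I x).source := by
    rw [← hx]; exact mem_extChartAt_source x
  set φ : E → E := extChartAt I x ∘ (extChartAt I x₀).symm with hφ
  have hφy : φ y = extChartAt I x x := rfl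
  have hev : (α.inChart x₀) =ᶠ[𝓝[range I] y]
      fun z => (α.inChart x (φ z)).compContinuousLinearMap (fderivWithin ℝ φ (range I) z) := by
    have hc : ContinuousWithinAt (extChartAt I x₀).symm (range I) y :=
      (mdifferentiableWithinAt_extChartAt_symm hy).continuousWithinAt
    filter_upwards [hc.preimage_mem_nhdsWithin ((isOpen_extChartAt_source (I := I) x).mem_nhds hy'),
      extChartAt_target_mem_nhdsWithin_of_mem hy] with z hz hz'
    exact DForm.inChart_change α x₀ x hz' hz
  rw [hev.extDerivWithin_eq_of_mem hyr]
  have hφs : ContDiffWithinAt ℝ ∞ φ (range I) y := by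
    refine contDiffWithinAt_ext_coord_change (I := I) (n := ∞) x x₀ ?_
    exact ⟨hy, hy'⟩
  rw [extDerivWithin_pullback (t := range I) (r := ∞) _ hφs _ I.uniqueDiffOn
    (I.range_subset_closure_interior hyr) hyr (fun z _ => mem_range_self _)]
  · change (((extDerivWithin (α.inChart x) (range I) (extChartAt I x x)).compContinuousLinearMap
      (mfderiv I 𝓘(ℝ, E) (extChartAt I x) x)).compContinuousLinearMap _) = _
    have h := mfderiv_comp_mfderivWithin (I := 𝓘(ℝ, E)) (I' := I) (I'' := 𝓘(ℝ, E)) y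
      (mdifferentiableAt_extChartAt (I := I) (mem_chart_source H x))
      (mdifferentiableWithinAt_extChartAt_symm hy) hmu
    rw [mfderivWithin_eq_fderivWithin] at h
    rw [hφy]
    change _ = ContinuousAlternatingMap.compContinuousLinearMap _ (fderivWithin ℝ (extChartAt I x ∘ (extChartAt I x₀).symm) (range I) y)
    rw [h]
    rfl
  · refine (hα.contDiffWithinAt x ?_).differentiableWithinAt (by simp)
    exact mem_extChartAt_target x
  · simpa using two_le_smooth

theorem DForm.Smooth.extD [IsManifold I ∞ X] {α : DForm I X k} (hα : α.Smooth) :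
    α.extD.Smooth := by
  intro x₀ y hy
  have hyr : y ∈ range I := extChartAt_target_subset_range x₀ hy
  have h1 : ContDiffWithinAt ℝ ∞ (extDerivWithin (α.inChart x₀) (range I)) (range I) y := by
    have := (hα.contDiffWithinAt x₀ hy).fderivWithin_right (m := ∞) I.uniqueDiffOn (by simp) hyr
    exact (ContinuousAlternatingMap.alternatizeUncurryFinCLM ℝ E ℝ).contDiff.comp_contDiffWithinAt this
  refine (h1.mono (extChartAt_target_subset_range x₀)).congr (fun z hz => ?_) ?_
  · exact hα.inChart_extD x₀ hz
  · exact hα.inChart_extD x₀ hy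

theorem DForm.Smooth.extD_extD [IsManifold I ∞ X] {α : DForm I X k} (hα : α.Smooth) :
    α.extD.extD = 0 := by
  funext x
  have hx := mem_extChartAt_target (I := I) x
  have hxr := extChartAt_target_subset_range x hx
  have h : extDerivWithin (α.extD.inChart x) (range I) (extChartAt I x x) = 0 := by
    have hev : α.extD.inChart x =ᶠ[𝓝[range I] (extChartAt I x x)]
        extDerivWithin (α.inChart x) (range I) := by
      filter_upwards [extChartAt_target_mem_nhdsWithin (I := I) x] with z hz
      exact hα.inChart_extD x hz
    rw [hev.extDerivWithin_eq_of_mem hxr]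
    exact extDerivWithin_extDerivWithin_apply (hα.contDiffWithinAt x hx) (by simpa using two_le_smooth)
      I.uniqueDiffOn (I.range_subset_closure_interior hxr) hxr
  change ContinuousAlternatingMap.compContinuousLinearMap _ _ = _
  rw [h]
  ext v
  rfl

theorem DForm.inChart_add (α η : DForm I X k) (x : X) :
    (α + η).inChart x = α.inChart x + η.inChart x := rfl

theorem DForm.inChart_smul (c : ℝ) (α : DForm I X k) (x : X) :
    (c • α).inChart x = c • α.inChart x := rfl

theorem DForm.inChart_zero (x : X) : DForm.inChart (0 : DForm I X k) x = 0 := rfl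

theorem DForm.Smooth.extD_add {α η : DForm I X k} (hα : α.Smooth) (hη : η.Smooth) :
    (α + η).extD = α.extD + η.extD := by
  funext x
  have hx := mem_extChartAt_target (I := I) x
  have hxr := extChartAt_target_subset_range x hx
  change ContinuousAlternatingMap.compContinuousLinearMap _ _ = _
  rw [DForm.inChart_add, extDerivWithin_add (I.uniqueDiffOn _ hxr)
    ((hα.contDiffWithinAt x hx).differentiableWithinAt (by simp))
    ((hη.contDiffWithinAt x hx).differentiableWithinAt (by simp))]
  rfl

theorem DForm.extD_smul (c : ℝ) (α : DForm I X k) : (c • α).extD = c • α.extD := by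
  funext x
  have hx := mem_extChartAt_target (I := I) x
  have hxr := extChartAt_target_subset_range x hx
  change ContinuousAlternatingMap.compContinuousLinearMap _ _ = _
  rw [DForm.inChart_smul, extDerivWithin_smul c _ (I.uniqueDiffOn _ hxr)]
  rfl

/-- The support of a form. -/
def DForm.supp (α : DForm I X k) : Set X := closure {x | α x ≠ 0}

theorem DForm.supp_extD (α : DForm I X k) : α.extD.supp ⊆ α.supp := by
  refine closure_minimal (fun x hx => ?_) isClosed_closure
  by_contra hxs
  apply hx
  have hev : α.inChart x =ᶠ[𝓝[range I] (extChartAt I x x)] 0 := by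
    have hc : ContinuousAt (extChartAt I x).symm (extChartAt I x x) := continuousAt_extChartAt_symm x
    have hm : (α.supp)ᶜ ∈ 𝓝 ((extChartAt I x).symm (extChartAt I x x)) := by
      rw [extChartAt_to_inv]
      exact isClosed_closure.isOpen_compl.mem_nhds hxs
    filter_upwards [nhdsWithin_le_nhds (hc.preimage_mem_nhds hm)] with z hz
    have h0 : α ((extChartAt I x).symm z) = 0 := by
      by_contra hne
      exact hz (subset_closure hne)
    change ContinuousAlternatingMap.compContinuousLinearMap _ _ = _
    rw [h0]
    rfl
  have h : extDerivWithin (α.inChart x) (range I) (extChartAt I x x) = 0 := by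
    rw [hev.extDerivWithin_eq_of_mem (mem_range_self _)]
    simpa [extDerivWithin] using
      (ContinuousAlternatingMap.alternatizeUncurryFinCLM ℝ E ℝ (n := k)).map_zero
  change ContinuousAlternatingMap.compContinuousLinearMap _ _ = _
  rw [h]
  rfl

theorem DForm.supp_add (α β : DForm I X k) : (α + β).supp ⊆ α.supp ∪ β.supp := by
  rw [DForm.supp, DForm.supp, DForm.supp, ← closure_union]
  refine closure_mono fun x hx => ?_
  by_contra h
  simp only [mem_union, mem_ofPred_eq, not_or, not_not] at h
  exact hx (by simp [h.1, h.2])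

theorem DForm.supp_smul (c : ℝ) (α : DForm I X k) : (c • α).supp ⊆ α.supp := by
  refine closure_mono fun x hx h => hx ?_
  simp [h]

variable (I) in
/-- The space of smooth `k`-forms on an open subset `U` with compact support in `U`. Such forms
are identified with their extensions by zero, i.e. with the smooth forms on `X` whose support is
compact and contained in `U`. -/
def compactForms (U : Set X) (k : ℕ) : Submodule ℝ (DForm I X k) where
  carrier := {α | α.Smooth ∧ IsCompact α.supp ∧ α.supp ⊆ U}
  zero_mem' := by
    have h : DForm.supp (0 : DForm I X k) = ∅ := by simp [DForm.supp]
    refine ⟨fun x₀ => ?_, ?_, ?_⟩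
    · exact contDiffOn_const (c := (0 : E [⋀^Fin k]→L[ℝ] ℝ))
    · rw [h]; exact isCompact_empty
    · rw [h]; exact empty_subset _
  add_mem' := fun {α β} hα hβ =>
    ⟨fun x₀ => (hα.1 x₀).add (hβ.1 x₀),
      (hα.2.1.union hβ.2.1).of_isClosed_subset isClosed_closure (DForm.supp_add α β),
      (DForm.supp_add α β).trans (union_subset hα.2.2 hβ.2.2)⟩
  smul_mem' := fun c α hα =>
    ⟨fun x₀ => (hα.1 x₀).const_smul c,
      hα.2.1.of_isClosed_subset isClosed_closure (DForm.supp_smul c α),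
      (DForm.supp_smul c α).trans hα.2.2⟩

theorem extD_mem_compactForms [IsManifold I ∞ X] {U : Set X} {α : DForm I X k}
    (hα : α ∈ compactForms I U k) : α.extD ∈ compactForms I U (k + 1) :=
  ⟨hα.1.extD, hα.2.1.of_isClosed_subset isClosed_closure α.supp_extD, α.supp_extD.trans hα.2.2⟩

/-- The de Rham differential, as a map from `k`-forms to `l`-forms with `l = k + 1`
(and zero for other pairs of degrees). -/
def DForm.dTo (l : ℕ) (α : DForm I X k) : DForm I X l :=
  if h : k + 1 = l then h ▸ α.extD else 0

variable (I X) in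
/-- A subcomplex of the de Rham complex of smooth forms on `X`. -/
structure SubDeRham where
  carrier : ∀ k : ℕ, Submodule ℝ (DForm I X k)
  smooth : ∀ (k : ℕ) (α : DForm I X k), α ∈ carrier k → α.Smooth
  extD_mem : ∀ (k : ℕ) (α : DForm I X k), α ∈ carrier k → α.extD ∈ carrier (k + 1)

namespace SubDeRham
variable (S : SubDeRham I X)

/-- The component of the subcomplex in an integer degree `m`; it is zero if `m < 0`. -/
def obj (m : ℤ) : Submodule ℝ (DForm I X m.toNat) :=
  if 0 ≤ m then S.carrier m.toNat else ⊥

theorem dTo_mem {m n : ℤ} (hmn : m + 1 = n) {α : DForm I X m.toNat} (hα : α ∈ S.obj m) :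
    α.dTo n.toNat ∈ S.obj n := by
  unfold DForm.dTo
  split_ifs with h
  · unfold obj at hα ⊢
    by_cases hm : 0 ≤ m
    · rw [if_pos hm] at hα
      rw [if_pos (by omega)]
      have := S.extD_mem _ α hα
      generalize n.toNat = l at h
      subst h
      exact this
    · omega
  · exact zero_mem _

def differential (m n : ℤ) (hmn : m + 1 = n) : S.obj m →ₗ[ℝ] S.obj n where
  toFun α := ⟨α.1.dTo n.toNat, S.dTo_mem hmn α.2⟩
  map_add' := by
    rintro ⟨α, hα⟩ ⟨β, hβ⟩
    apply Subtype.ext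
    change DForm.dTo _ (α + β) = DForm.dTo _ α + DForm.dTo _ β
    unfold DForm.dTo
    split_ifs with h
    · have hm : 0 ≤ m := by omega
      unfold obj at hα hβ
      rw [if_pos hm] at hα hβ
      generalize n.toNat = l at h
      subst h
      exact (S.smooth _ _ hα).extD_add (S.smooth _ _ hβ)
    · simp
  map_smul' := by
    rintro c ⟨α, hα⟩
    apply Subtype.ext
    change DForm.dTo _ (c • α) = c • DForm.dTo _ α
    unfold DForm.dTo
    split_ifs with h
    · generalize n.toNat = l at h
      subst h
      exact DForm.extD_smul c α
    · simp

theorem differential_comp [IsManifold I ∞ X] (m n r : ℤ) (hmn : m + 1 = n) (hnr : n + 1 = r)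
    (α : S.obj m) : S.differential n r hnr (S.differential m n hmn α) = 0 := by
  obtain ⟨α, hα⟩ := α
  apply Subtype.ext
  change DForm.dTo _ (DForm.dTo _ α) = 0
  by_cases hm : 0 ≤ m
  · unfold obj at hα
    rw [if_pos hm] at hα
    have h1 : m.toNat + 1 = n.toNat := by omega
    have h2 : n.toNat + 1 = r.toNat := by omega
    have := (S.smooth _ _ hα).extD_extD
    generalize n.toNat = l at h1 h2
    generalize r.toNat = l' at h2
    subst h1
    subst h2
    simpa [DForm.dTo] using this
  · have h1 : ¬ (m.toNat + 1 = n.toNat) := by omega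
    have h3 : α.dTo n.toNat = 0 := dif_neg h1
    rw [h3]
    have := (S.differential n r hnr).map_zero
    exact congrArg Subtype.val this

open CategoryTheory in
/-- The cochain complex of real vector spaces given by a subcomplex of the de Rham complex,
in which forms of degree `k` sit in cohomological degree `k`. -/
def complex [IsManifold I ∞ X] : CochainComplex (ModuleCat ℝ) ℤ where
  X m := ModuleCat.of ℝ (S.obj m)
  d m n := if h : m + 1 = n then ModuleCat.ofHom (S.differential m n h) else 0
  shape m n h := dif_neg h
  d_comp_d' m n r hmn hnr := by
    have hmn' : m + 1 = n := hmn
    have hnr' : n + 1 = r := hnr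
    rw [dif_pos hmn', dif_pos hnr']
    apply ModuleCat.hom_ext
    apply LinearMap.ext
    intro α
    exact S.differential_comp m n r hmn' hnr' α

/-- The differential form underlying an element of the complex. -/
def form [IsManifold I ∞ X] {m : ℤ} (a : S.complex.X m) : DForm I X m.toNat :=
  Subtype.val (p := fun α => α ∈ S.obj m) a
end SubDeRham
end Forms

section Pullback
variable {E E' : Type} [NormedAddCommGroup E] [NormedSpace ℝ E] {H H' : Type} [TopologicalSpace H]
  [NormedAddCommGroup E'] [NormedSpace ℝ E'] [TopologicalSpace H']
  {I : ModelWithCorners ℝ E H} {J : ModelWithCorners ℝ E' H'}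
  {X Y : Type*} [TopologicalSpace X] [ChartedSpace H X] [TopologicalSpace Y] [ChartedSpace H' Y]

variable (I J) in
/-- Pullback of `k`-forms along a map. -/
def pullbackForm (f : Y → X) (k : ℕ) : DForm I X k →ₗ[ℝ] DForm J Y k where
  toFun α := fun y => (α (f y)).compContinuousLinearMap (mfderiv J I f y)
  map_add' _ _ := rfl
  map_smul' _ _ := rfl

theorem pullbackForm_extD_eq_zero [IsManifold I ∞ X] {f : Y → X} {α : DForm I X 0} (hα : α.Smooth)
    (h : pullbackForm I J f 0 α = 0) : pullbackForm I J f 1 α.extD = 0 := by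
  have hv : ∀ y, α (f y) = 0 := fun y => by
    ext v
    have := congrArg (fun β : DForm J Y 0 => β y (fun i => i.elim0)) h
    rw [Subsingleton.elim v (fun i => i.elim0)]
    change α (f y) (fun i => mfderiv J I f y (i.elim0)) = 0 at this
    exact (congrArg (α (f y)) (Subsingleton.elim _ _)).trans this
  funext y
  ext v
  by_cases hf : MDifferentiableAt J I f y
  · have : IsManifold I 1 X := IsManifold.of_le (n := ∞) (by simp)
    set x := f y with hx
    have hxt := mem_extChartAt_target (I := I) x
    have hxr := extChartAt_target_subset_range x hxt
    have hd : DifferentiableWithinAt ℝ (α.inChart x) (range I) (extChartAt I x x) :=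
      (hα.contDiffWithinAt x hxt).differentiableWithinAt (by simp)
    let w : Fin 1 → E := fun i => mfderiv I 𝓘(ℝ, E) (extChartAt I x) x (mfderiv J I f y (v i))
    change extDerivWithin (α.inChart x) (range I) (extChartAt I x x) w = 0
    rw [extDerivWithin_apply hd (I.uniqueDiffOn _ hxr), Fin.sum_univ_one]
    set u : Fin 0 → E := (0 : Fin 1).removeNth w with hu
    have hdu : DifferentiableWithinAt ℝ (fun z => α.inChart x z u) (range I) (extChartAt I x x) :=
      (ContinuousAlternatingMap.apply ℝ E ℝ u).differentiableAt.comp_differentiableWithinAt _ hd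
    have he : MDifferentiableAt I 𝓘(ℝ, E) (extChartAt I x) (f y) :=
      mdifferentiableAt_extChartAt (mem_chart_source H x)
    have hc : HasMFDerivAt J 𝓘(ℝ, E) (extChartAt I x ∘ f) y
        ((mfderiv I 𝓘(ℝ, E) (extChartAt I x) (f y)).comp (mfderiv J I f y)) :=
      he.hasMFDerivAt.comp y hf.hasMFDerivAt
    have hcc : HasMFDerivWithinAt J 𝓘(ℝ, ℝ) ((fun z => α.inChart x z u) ∘ (extChartAt I x ∘ f))
        univ y ((fderivWithin ℝ (fun z => α.inChart x z u) (range I) (extChartAt I x x)).comp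
          ((mfderiv I 𝓘(ℝ, E) (extChartAt I x) (f y)).comp (mfderiv J I f y))) :=
      HasMFDerivWithinAt.comp (u := range I) y hdu.hasFDerivWithinAt.hasMFDerivWithinAt
        hc.hasMFDerivWithinAt (fun z _ => mem_range_self _)
    have hz : ((fun z => α.inChart x z u) ∘ (extChartAt I x ∘ f)) =ᶠ[𝓝 y] fun _ => (0 : ℝ) := by
      filter_upwards [hf.continuousAt.preimage_mem_nhds (extChartAt_source_mem_nhds (I := I) x)]
        with z hz
      have e1 : (extChartAt I x).symm (extChartAt I x (f z)) = f z := (extChartAt I x).left_inv hz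
      have e2 : α ((extChartAt I x).symm (extChartAt I x (f z))) = 0 := by
        rw [e1]; exact hv z
      change α ((extChartAt I x).symm (extChartAt I x (f z))) _ = 0
      rw [e2]
      rfl
    have h0 : HasMFDerivAt J 𝓘(ℝ, ℝ) ((fun z => α.inChart x z u) ∘ (extChartAt I x ∘ f)) y 0 :=
      (hasMFDerivAt_const (0 : ℝ) y).congr_of_eventuallyEq hz
    have hfin := hasMFDerivAt_unique (hasMFDerivWithinAt_univ.1 hcc) h0
    have := congrArg (fun A => A (v 0)) hfin
    have hw : fderivWithin ℝ (fun z => α.inChart x z u) (range I) (extChartAt I x x) (w 0) = 0 :=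
      this
    simp only [hu] at hw
    rw [hw, smul_zero]
  · have h0 : mfderiv J I f y = 0 := mfderiv_zero_of_not_mdifferentiableAt hf
    change α.extD (f y) (fun i => mfderiv J I f y (v i)) = 0
    rw [h0]
    exact (α.extD (f y)).map_zero
end Pullback

section Geometry
open Manifold
variable {M N : Type*} [TopologicalSpace M] [ChartedSpace (EuclideanHalfSpace 3) M]
  [TopologicalSpace N] [ChartedSpace (EuclideanSpace ℝ (Fin 2)) N]

variable (N) in
/-- A smooth Lorentzian metric, of signature `(-,+)`, on a surface. -/
structure LorentzMetric [IsManifold (𝓡 2) ∞ N] where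
  val (p : N) : TangentSpace (𝓡 2) p →L[ℝ] TangentSpace (𝓡 2) p →L[ℝ] ℝ
  symm (p : N) (v w : TangentSpace (𝓡 2) p) : val p v w = val p w v
  signature (p : N) : ∃ e₀ e₁ : TangentSpace (𝓡 2) p,
    val p e₀ e₀ = -1 ∧ val p e₁ e₁ = 1 ∧ val p e₀ e₁ = 0
  contMDiff : ContMDiff (𝓡 2)
    ((𝓡 2).prod 𝓘(ℝ, EuclideanSpace ℝ (Fin 2) →L[ℝ] EuclideanSpace ℝ (Fin 2) →L[ℝ] ℝ)) ∞
    (fun p => Bundle.TotalSpace.mk'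
      (EuclideanSpace ℝ (Fin 2) →L[ℝ] EuclideanSpace ℝ (Fin 2) →L[ℝ] ℝ)
      (E := fun p => TangentSpace (𝓡 2) p →L[ℝ] TangentSpace (𝓡 2) p →L[ℝ] ℝ) p (val p))

/-- The orientation induced on the boundary surface (the outward normal comes first): `vol` is a volume
form representing the orientation of `M`, `ι` is the inclusion of the boundary, and a pair `(v, w)` is
positively oriented if `boundaryOrientation ι vol p v w > 0`. The preferred chart at `ι p` takes values
in the half space `0 ≤ x 0`, so that minus the zeroth basis vector points outward. -/
def boundaryOrientation (ι : N → M) (vol : DForm (𝓡∂ 3) M 3) (p : N)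
    (v w : TangentSpace (𝓡 2) p) : ℝ :=
  let outward : TangentSpace (𝓡∂ 3) (ι p) := -(EuclideanSpace.single (0 : Fin 3) (1 : ℝ))
  vol (ι p) ![outward, mfderiv (𝓡 2) (𝓡∂ 3) ι p v, mfderiv (𝓡 2) (𝓡∂ 3) ι p w]

variable [IsManifold (𝓡 2) ∞ N]

/-- `(e₀, e₁)` is a positively oriented orthonormal frame at `p`, with `e₀` timelike; the sign of
`o p v w` is the orientation of the pair `(v, w)`. -/
def IsOrientedFrame (g : LorentzMetric N)
    (o : ∀ p : N, TangentSpace (𝓡 2) p → TangentSpace (𝓡 2) p → ℝ) (p : N)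
    (e₀ e₁ : TangentSpace (𝓡 2) p) : Prop :=
  g.val p e₀ e₀ = -1 ∧ g.val p e₁ e₁ = 1 ∧ g.val p e₀ e₁ = 0 ∧ 0 < o p e₀ e₁

/-- `σ` is the Hodge dual of the one-form `α`, i.e. `β ∧ σ = ⟨β, α⟩ vol_g` for all covectors `β`.
Both sides are evaluated on positively oriented orthonormal frames `(e₀, e₁)`, where
`vol_g(e₀, e₁) = 1` and `⟨β, α⟩ = -β(e₀)α(e₀) + β(e₁)α(e₁)`. -/
def IsHodgeStar (g : LorentzMetric N)
    (o : ∀ p : N, TangentSpace (𝓡 2) p → TangentSpace (𝓡 2) p → ℝ)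
    (α σ : DForm (𝓡 2) N 1) : Prop :=
  ∀ (p : N) (e₀ e₁ : TangentSpace (𝓡 2) p), IsOrientedFrame g o p e₀ e₁ →
    ∀ β : TangentSpace (𝓡 2) p [⋀^Fin 1]→L[ℝ] ℝ,
      β ![e₀] * σ p ![e₁] - β ![e₁] * σ p ![e₀] =
        -(β ![e₀] * α p ![e₀]) + β ![e₁] * α p ![e₁]

/-- The one-forms `α` with `∗α = ε α`: self-dual for `ε = 1`, anti-self-dual for `ε = -1`. -/
def selfDualForms (g : LorentzMetric N)
    (o : ∀ p : N, TangentSpace (𝓡 2) p → TangentSpace (𝓡 2) p → ℝ) (ε : ℤˣ) :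
    Submodule ℝ (DForm (𝓡 2) N 1) where
  carrier := {α | IsHodgeStar g o α (((ε : ℤ) : ℝ) • α)}
  zero_mem' := fun p e₀ e₁ _ β => by simp
  add_mem' := fun {α α'} h h' p e₀ e₁ hf β => by
    have h1 := h p e₀ e₁ hf β
    have h2 := h' p e₀ e₁ hf β
    simp only [Pi.smul_apply, Pi.add_apply, ContinuousAlternatingMap.smul_apply,
      ContinuousAlternatingMap.add_apply, smul_eq_mul] at h1 h2 ⊢
    linear_combination h1 + h2
  smul_mem' := fun c α h p e₀ e₁ hf β => by
    have h1 := h p e₀ e₁ hf β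
    simp only [Pi.smul_apply, ContinuousAlternatingMap.smul_apply, smul_eq_mul] at h1 ⊢
    linear_combination c * h1

/-- The (anti-)self-dual boundary condition: in form degree `0` only zero, in degree `1` the
(anti-)self-dual forms, in degree `2` all forms. -/
def boundaryCondition (g : LorentzMetric N)
    (o : ∀ p : N, TangentSpace (𝓡 2) p → TangentSpace (𝓡 2) p → ℝ) (ε : ℤˣ) :
    ∀ k : ℕ, Submodule ℝ (DForm (𝓡 2) N k)
  | 0 => ⊥
  | 1 => selfDualForms g o ε
  | _ + 2 => ⊤

/-- The compactly supported forms on the open subset `U` of `M` whose pullback to the boundary lies in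
the (anti-)self-dual boundary condition. -/
def conditionedFields [IsManifold (𝓡∂ 3) ∞ M] (ι : N → M) (g : LorentzMetric N)
    (o : ∀ p : N, TangentSpace (𝓡 2) p → TangentSpace (𝓡 2) p → ℝ) (ε : ℤˣ) (U : Set M) :
    SubDeRham (𝓡∂ 3) M where
  carrier k := compactForms (𝓡∂ 3) U k ⊓
    (boundaryCondition g o ε k).comap (pullbackForm (𝓡∂ 3) (𝓡 2) ι k)
  smooth _ _ hα := hα.1.1
  extD_mem k α hα := by
    refine ⟨extD_mem_compactForms hα.1, ?_⟩
    match k, α, hα with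
    | 0, α, hα =>
      have h : pullbackForm (𝓡∂ 3) (𝓡 2) ι 1 α.extD = 0 :=
        pullbackForm_extD_eq_zero hα.1.1 hα.2
      change pullbackForm (𝓡∂ 3) (𝓡 2) ι 1 α.extD ∈ boundaryCondition g o ε 1
      rw [h]
      exact zero_mem _
    | k + 1, α, hα => exact Submodule.mem_top

/-- `Θ` is a chiral flow: the global flow of a complete smooth vector field `n` of nonzero null vectors
that are future-pointing and point to the right for `ε = 1` and to the left for `ε = -1`.
Here `τ` is a timelike vector field representing the time-orientation. -/
def IsChiralFlow (g : LorentzMetric N)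
    (o : ∀ p : N, TangentSpace (𝓡 2) p → TangentSpace (𝓡 2) p → ℝ)
    (τ : ∀ p : N, TangentSpace (𝓡 2) p) (ε : ℤˣ) (Θ : ℝ → N → N) : Prop :=
  ∃ n : ∀ p : N, TangentSpace (𝓡 2) p,
    ContMDiff (𝓡 2) (𝓡 2).tangent ∞ (fun p => (⟨p, n p⟩ : TangentBundle (𝓡 2) N)) ∧
    (∀ p, n p ≠ 0 ∧ g.val p (n p) (n p) = 0 ∧ g.val p (τ p) (n p) < 0 ∧
      0 < ((ε : ℤ) : ℝ) * o p (τ p) (n p)) ∧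
    ∀ p, Θ 0 p = p ∧ IsMIntegralCurve (I := 𝓡 2) (fun s => Θ s p) n
end Geometry

section Quotient
variable (M : Type*) [TopologicalSpace M] [ChartedSpace (EuclideanHalfSpace 3) M] [AddAction ℝ M]

/-- The orbit space of an action of the additive group of real numbers, with the quotient topology. -/
abbrev OrbitSpace := AddAction.orbitRel.Quotient ℝ M

variable {M} in
/-- The quotient map. -/
def orbitMk : M → OrbitSpace M := Quotient.mk _

/-- The atlas on the orbit space is the smooth quotient structure: it is a smooth surface with boundary
for which the quotient map is a smooth submersion. (Any two such structures are compatible.) -/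
class IsSmoothQuotient [ChartedSpace (EuclideanHalfSpace 2) (OrbitSpace M)] : Prop
    extends IsManifold (𝓡∂ 2) ∞ (OrbitSpace M) where
  contMDiff_mk : ContMDiff (𝓡∂ 3) (𝓡∂ 2) ∞ (orbitMk : M → OrbitSpace M)
  surjective_mfderiv_mk (p : M) :
    Function.Surjective (mfderiv (𝓡∂ 3) (𝓡∂ 2) (orbitMk : M → OrbitSpace M) p)

/-- The compactly supported forms on the open subset `V` of a surface `B` with boundary, where the
`0`-forms are required to vanish on the boundary. -/
def relativeForms (B : Type*) [TopologicalSpace B] [ChartedSpace (EuclideanHalfSpace 2) B]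
    [IsManifold (𝓡∂ 2) ∞ B] (V : Set B) : SubDeRham (𝓡∂ 2) B where
  carrier k := compactForms (𝓡∂ 2) V k ⊓
    match k with
    | 0 => ⨅ b ∈ (𝓡∂ 2).boundary B, LinearMap.ker (LinearMap.proj b : DForm (𝓡∂ 2) B 0 →ₗ[ℝ] _)
    | _ + 1 => ⊤
  smooth _ _ hα := hα.1.1
  extD_mem _ _ hα := ⟨extD_mem_compactForms hα.1, Submodule.mem_top⟩

variable {M} [ChartedSpace (EuclideanHalfSpace 2) (OrbitSpace M)]

/-- `α` is the fiber integral of `φ` along the quotient map, in the fiber-first convention. The fiber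
through `p` is parametrized by `s ↦ s +ᵥ p`, and the tangent vectors `dπ (w i)` at the base point are
lifted along the fiber by the differentials of the translations `q ↦ s +ᵥ q`, so that
`α (dπ w₁, …, dπ w_k) = ∫ φ (∂ₛ, w₁, …, w_k) ds`. -/
def IsFiberIntegral {k l : ℕ} (h : l = k + 1) (φ : DForm (𝓡∂ 3) M l)
    (α : DForm (𝓡∂ 2) (OrbitSpace M) k) : Prop :=
  ∀ (p : M) (w : Fin k → TangentSpace (𝓡∂ 3) p),
    α (orbitMk p) (fun i => mfderiv (𝓡∂ 3) (𝓡∂ 2) orbitMk p (w i)) =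
      ∫ s : ℝ, φ (s +ᵥ p) (fun j =>
        (Fin.cons (mfderiv 𝓘(ℝ, ℝ) (𝓡∂ 3) (fun r : ℝ => r +ᵥ p) s (1 : ℝ))
          (fun i => mfderiv (𝓡∂ 3) (𝓡∂ 3) (fun q : M => s +ᵥ q) p (w i)) :
            Fin (k + 1) → TangentSpace (𝓡∂ 3) (s +ᵥ p)) (Fin.cast h j))

/-- A trivialization of the principal bundle over `V`: an equivariant smooth fiber coordinate `t`, which
corresponds to the trivialization `p ↦ (t p, orbitMk p)`. -/
structure IsTrivialization (V : Set (OrbitSpace M)) (t : M → ℝ) : Prop where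
  contMDiffOn : ContMDiffOn (𝓡∂ 3) 𝓘(ℝ, ℝ) ∞ t (orbitMk ⁻¹' V)
  equivariant : ∀ p : M, orbitMk p ∈ V → ∀ s : ℝ, t (s +ᵥ p) = t p + s

/-- `η` is the wedge product of `ρ(t) dt` with the pullback of `α` along the quotient map. -/
def IsPoincareLift {k l : ℕ} (h : l = k + 1) (ρ : ℝ → ℝ) (t : M → ℝ)
    (α : DForm (𝓡∂ 2) (OrbitSpace M) k) (η : DForm (𝓡∂ 3) M l) : Prop :=
  ∀ (p : M) (v : Fin (k + 1) → TangentSpace (𝓡∂ 3) p),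
    let dt : TangentSpace (𝓡∂ 3) p →L[ℝ] ℝ := mfderiv (𝓡∂ 3) 𝓘(ℝ, ℝ) t p
    η p (fun j => v (Fin.cast h j)) =
      ∑ j : Fin (k + 1), (-1) ^ (j : ℕ) *
        (ρ (t p) * dt (v j)) *
        pullbackForm (𝓡∂ 2) (𝓡∂ 3) orbitMk k α p (fun i => v (j.succAbove i))
end Quotient

end

open CategoryTheory Manifold

set_option linter.unusedSectionVars false

/-! ### Smoothness, pullback and exterior derivative of forms on manifolds with boundary. -/

noncomputable section FormCalculus
variable {E : Type} [NormedAddCommGroup E] [NormedSpace ℝ E] {H : Type} [TopologicalSpace H]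
  {I : ModelWithCorners ℝ E H} {X : Type*} [TopologicalSpace X] [ChartedSpace H X] {k : ℕ}

/-! The proof is the Poincaré lemma with compact supports along the fibres of a principal
`ℝ`-bundle, together with the observation that the boundary condition only involves the generator of
the action.

Boundary condition. At a boundary point the null vectors form the two lines spanned by `e₀ + e₁` and
`e₀ - e₁`, and the sign selects one of them. A one-form satisfies `∗α = ±α` exactly when it
annihilates the selected line (`mem_selfDualForms_iff`). Since the action extends the chiral flow,
its velocity spans this line. The conditioned complex therefore consists of the compactly supported
forms whose 0-forms vanish on the boundary and whose 1-forms annihilate the velocity there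
(`isChiralFields_conditionedFields`); Lorentzian geometry plays no further role.

Quotient. Properness moves compact sets off compact sets in bounded time. Hence the action is free,
its velocity never vanishes, and nearby orbits have no late returns. A coordinate hyperplane
transverse to an orbit is a slice (`exists_local_slice`); this also works at boundary points, where
the velocity is tangent to the boundary. Slices give charts of the orbit space
(`exists_orbitChart`), which are smooth for every smooth quotient structure
(`OrbitChart.contMDiffOn_chart'`), so boundary points of `M` are exactly those lying over boundary
points (`orbitMk_mem_boundary_iff`). Averaging the times of the slices with a partition of unity
yields a global fibre coordinate (`exists_trivialization`).

Homotopy. Let `A` be integration along full orbits and `I` integration along backward half orbits.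
The homotopy formula on the cylinder `ℝ × M`, pulled back by the action, gives `dA + Ad = 0` and `dI
+ Id = 1`, because the boundary terms at infinity vanish. The form `Aφ` is invariant and horizontal,
so it is the pullback of the fibre integral of `φ`. The operator `I` destroys compact support: far
ahead of the support, `Iφ` equals `Aφ`. If `C` is the primitive of `ρ` that vanishes far to the
left, then `Pφ = Iφ - C(t) Aφ` has compact support, and `dP + Pd` is the identity minus the lift
`ω_*` of the fibre integral (`extD_fiberHomotopy`).

All three operators respect the boundary condition. For a conditioned 1-form the integrand vanishes
along boundary orbits, and in positive degree `Pφ` is annihilated by the velocity. The signs in `dA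
= -Ad` and `dω_* = -ω_*d` are the ones produced by the shifts `[2]` and `[1]`. -/

/-- Smoothness of a form at a point. -/
def DForm.SmoothAt (α : DForm I X k) (x : X) : Prop :=
  ContDiffWithinAt ℝ ∞ (α.inChart x) (range I) (extChartAt I x x)

theorem DForm.Smooth.smoothAt {α : DForm I X k} (hα : α.Smooth) (x : X) : α.SmoothAt x :=
  hα.contDiffWithinAt x (mem_extChartAt_target x)

theorem DForm.inChart_eventuallyEq {α β : DForm I X k} {x₀ : X} {y : E}
    (hy : y ∈ (extChartAt I x₀).target) (h : ∀ᶠ x in 𝓝 ((extChartAt I x₀).symm y), α x = β x) :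
    α.inChart x₀ =ᶠ[𝓝[range I] y] β.inChart x₀ := by
  have hc : ContinuousWithinAt (extChartAt I x₀).symm (range I) y :=
    ((continuousOn_extChartAt_symm x₀) y hy).mono_of_mem_nhdsWithin
      (extChartAt_target_mem_nhdsWithin_of_mem hy)
  filter_upwards [hc.preimage_mem_nhdsWithin h] with z hz
  have hz' : α ((extChartAt I x₀).symm z) = β ((extChartAt I x₀).symm z) := hz
  simp only [DForm.inChart, hz']

theorem DForm.extD_congr {α β : DForm I X k} {x : X} (h : ∀ᶠ x' in 𝓝 x, α x' = β x') : α.extD x = β.extD x := by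
  have h' : α.inChart x =ᶠ[𝓝[range I] (extChartAt I x x)] β.inChart x :=
    DForm.inChart_eventuallyEq (mem_extChartAt_target x) (by rwa [extChartAt_to_inv])
  unfold DForm.extD
  rw [h'.extDerivWithin_eq_of_mem (mem_range_self _)]

theorem DForm.SmoothAt.congr {α β : DForm I X k} {x : X} (hβ : β.SmoothAt x) (h : ∀ᶠ x' in 𝓝 x, α x' = β x') :
    α.SmoothAt x :=
  ContDiffWithinAt.congr_of_eventuallyEq_of_mem hβ
    (DForm.inChart_eventuallyEq (mem_extChartAt_target x) (by rwa [extChartAt_to_inv]))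
    (mem_range_self _)

/-- Alternatization of continuous multilinear forms, as a continuous linear map. -/
def alternatizationCLM (F : Type) [NormedAddCommGroup F] [NormedSpace ℝ F] (k : ℕ) :
    ContinuousMultilinearMap ℝ (fun _ : Fin k => F) ℝ →L[ℝ] F [⋀^Fin k]→L[ℝ] ℝ :=
  LinearMap.mkContinuous
    { toFun := fun m => ContinuousMultilinearMap.alternatization m
      map_add' := fun m m' => map_add _ m m'
      map_smul' := fun c m => by
        ext v
        simp [ContinuousMultilinearMap.alternatization_apply_apply, Finset.mul_sum,
          mul_smul_comm] }
    (Fintype.card (Equiv.Perm (Fin k))) fun m => by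
      refine ContinuousAlternatingMap.opNorm_le_bound _ (by positivity) fun v => ?_
      change ‖ContinuousMultilinearMap.alternatization m v‖ ≤ _
      rw [ContinuousMultilinearMap.alternatization_apply_apply]
      refine (norm_sum_le _ _).trans ?_
      have h : ∀ σ : Equiv.Perm (Fin k), ‖Equiv.Perm.sign σ • m (v ∘ σ)‖ ≤ ‖m‖ * ∏ i, ‖v i‖ := by
        intro σ
        have h1 : ‖Equiv.Perm.sign σ • m (v ∘ σ)‖ = ‖m (v ∘ σ)‖ := by
          rcases Int.units_eq_one_or (Equiv.Perm.sign σ) with h | h <;> simp [h]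
        rw [h1]
        refine (m.le_opNorm _).trans (le_of_eq ?_)
        congr 1
        exact Equiv.prod_comp σ (fun i => ‖v i‖)
      refine (Finset.sum_le_sum fun σ _ => h σ).trans ?_
      simp [mul_assoc]

theorem alternatizationCLM_toContinuousMultilinearMap {F : Type} [NormedAddCommGroup F]
    [NormedSpace ℝ F] (w : F [⋀^Fin k]→L[ℝ] ℝ) :
    alternatizationCLM F k w.toContinuousMultilinearMap =
      (Fintype.card (Equiv.Perm (Fin k)) : ℝ) • w := by
  ext v
  change ContinuousMultilinearMap.alternatization w.toContinuousMultilinearMap v = _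
  rw [ContinuousMultilinearMap.alternatization_apply_apply]
  have h : ∀ σ : Equiv.Perm (Fin k),
      Equiv.Perm.sign σ • w.toContinuousMultilinearMap (v ∘ σ) = w v := by
    intro σ
    have := w.toAlternatingMap.map_perm v σ
    change Equiv.Perm.sign σ • w.toAlternatingMap (v ∘ σ) = w v
    rw [this, smul_smul, Int.units_mul_self, one_smul]
    rfl
  rw [Finset.sum_congr rfl fun σ _ => h σ]
  simp

/-- Composition of multilinear maps with linear maps is jointly analytic. To return to alternating
maps, the pullback is recovered as `1/k!` times the alternatization of the underlying multilinear
pullback. -/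
theorem contDiffWithinAt_compContinuousLinearMap {E₁ E₂ : Type} [NormedAddCommGroup E₁]
    [NormedSpace ℝ E₁] [NormedAddCommGroup E₂] [NormedSpace ℝ E₂] {s : Set E₁} {y : E₁}
    {w : E₁ → E₂ [⋀^Fin k]→L[ℝ] ℝ} {A : E₁ → E →L[ℝ] E₂} {n : WithTop ℕ∞}
    (hw : ContDiffWithinAt ℝ n w s y) (hA : ContDiffWithinAt ℝ n A s y) :
    ContDiffWithinAt ℝ n (fun z => (w z).compContinuousLinearMap (A z)) s y := by
  let c : ℝ := Fintype.card (Equiv.Perm (Fin k))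
  have hc : c ≠ 0 := by positivity
  have hw' : ContDiffWithinAt ℝ n (fun z => (w z).toContinuousMultilinearMap) s y :=
    (ContinuousAlternatingMap.toContinuousMultilinearMapLI (𝕜 := ℝ) (E := E₂) (F := ℝ)
      (ι := Fin k)).contDiff.comp_contDiffWithinAt hw
  have hQ : ContDiffWithinAt ℝ n (fun z => (w z).toContinuousMultilinearMap.compContinuousLinearMap
      (fun _ : Fin k => A z)) s y :=
    ((ContinuousMultilinearMap.analyticAt_uncurry_compContinuousLinearMap (𝕜 := ℝ)
      (q := (fun _ : Fin k => A y, (w y).toContinuousMultilinearMap))).contDiffAt (n := n)).comp_contDiffWithinAt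
      (f := fun z => (fun _ : Fin k => A z, (w z).toContinuousMultilinearMap)) y
      ((contDiffWithinAt_pi.2 fun _ => hA).prodMk hw')
  have h := ((alternatizationCLM E k).contDiff.comp_contDiffWithinAt hQ).const_smul c⁻¹
  refine h.congr_of_eventuallyEq (Eventually.of_forall fun z => ?_) ?_ <;>
  · change _ = c⁻¹ • alternatizationCLM E k
      ((w _).compContinuousLinearMap (A _)).toContinuousMultilinearMap
    rw [alternatizationCLM_toContinuousMultilinearMap, smul_smul, inv_mul_cancel₀ hc, one_smul]

/-- The change-of-chart formula transports smoothness from the preferred chart of each point to any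
preferred chart containing it, so smoothness can be checked pointwise. -/
theorem DForm.SmoothAt.contDiffWithinAt_inChart [IsManifold I ∞ X] {α : DForm I X k} {x₀ : X} {y : E}
    (hy : y ∈ (extChartAt I x₀).target) (h : α.SmoothAt ((extChartAt I x₀).symm y)) :
    ContDiffWithinAt ℝ ∞ (α.inChart x₀) (range I) y := by
  set x := (extChartAt I x₀).symm y with hx
  have hyr : y ∈ range I := extChartAt_target_subset_range x₀ hy
  have hy' : (extChartAt I x₀).symm y ∈ (extChartAt I x).source := mem_extChartAt_source x
  set φ : E → E := extChartAt I x ∘ (extChartAt I x₀).symm with hφ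
  have hev : (α.inChart x₀) =ᶠ[𝓝[range I] y]
      fun z => (α.inChart x (φ z)).compContinuousLinearMap (fderivWithin ℝ φ (range I) z) := by
    have hc : ContinuousWithinAt (extChartAt I x₀).symm (range I) y :=
      (continuousOn_extChartAt_symm x₀ y hy).mono_of_mem_nhdsWithin
        (extChartAt_target_mem_nhdsWithin_of_mem hy)
    filter_upwards [hc.preimage_mem_nhdsWithin ((isOpen_extChartAt_source (I := I) x).mem_nhds hy'),
      extChartAt_target_mem_nhdsWithin_of_mem hy] with z hz hz'
    exact DForm.inChart_change α x₀ x hz' hz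
  have hφs : ContDiffWithinAt ℝ ∞ φ (range I) y :=
    contDiffWithinAt_ext_coord_change (I := I) (n := ∞) x x₀ ⟨hy, hy'⟩
  refine ContDiffWithinAt.congr_of_eventuallyEq_of_mem ?_ hev hyr
  refine contDiffWithinAt_compContinuousLinearMap ?_ (hφs.fderivWithin_right I.uniqueDiffOn (by simp) hyr)
  exact ContDiffWithinAt.comp (t := range I) (g := α.inChart x) y h hφs (fun z _ => mem_range_self _)

theorem DForm.smooth_iff_smoothAt [IsManifold I ∞ X] {α : DForm I X k} :
    α.Smooth ↔ ∀ x, α.SmoothAt x :=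
  ⟨fun h x => h.smoothAt x, fun h x₀ _ hy =>
    ((h _).contDiffWithinAt_inChart hy).mono (extChartAt_target_subset_range x₀)⟩

variable {E' : Type} [NormedAddCommGroup E'] [NormedSpace ℝ E'] {H' : Type} [TopologicalSpace H']
  {J : ModelWithCorners ℝ E' H'} {Y : Type*} [TopologicalSpace Y] [ChartedSpace H' Y]

/-- Near `y` the inverse chart at `f y` composed with the coordinate expression of `f` equals `f`
composed with the inverse chart at `y`; the chain rule on both sides matches the two linear maps.
This reduces pullbacks on manifolds to pullbacks in vector spaces. -/
theorem inChart_pullbackForm_eventuallyEq [IsManifold I ∞ X] [IsManifold J ∞ Y] (α : DForm I X k)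
    {f : Y → X} {y : Y} (hf : ContMDiffAt J I ∞ f y) :
    (pullbackForm I J f k α).inChart y =ᶠ[𝓝[range J] (extChartAt J y y)]
      fun z => (α.inChart (f y) (writtenInExtChartAt J I y f z)).compContinuousLinearMap
        (fderivWithin ℝ (writtenInExtChartAt J I y f) (range J) z) := by
  have : IsManifold I 1 X := IsManifold.of_le (n := ∞) (by simp)
  have : IsManifold J 1 Y := IsManifold.of_le (n := ∞) (by simp)
  have hev : ∀ᶠ y' in 𝓝 y, MDifferentiableAt J I f y' ∧ f y' ∈ (extChartAt I (f y)).source := by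
    have hf1 : ContMDiffAt J I 1 f y := hf.of_le (by simp)
    refine ((contMDiffAt_iff_contMDiffAt_nhds (by simp)).1 hf1 |>.mono
      fun y' h => ContMDiffAt.mdifferentiableAt h (by simp)).and ?_
    exact hf.continuousAt.eventually (extChartAt_source_mem_nhds (I := I) (f y))
  have hc : Tendsto (extChartAt J y).symm (𝓝[range J] (extChartAt J y y)) (𝓝 y) := by
    have := (continuousAt_extChartAt_symm (I := J) y).tendsto
    rw [extChartAt_to_inv] at this
    exact this.mono_left nhdsWithin_le_nhds
  filter_upwards [hc.eventually hev, extChartAt_target_mem_nhdsWithin (I := J) y] with z hz hzt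
  have hzr := extChartAt_target_subset_range y hzt
  set y' := (extChartAt J y).symm z with hy'
  have hmu : UniqueMDiffWithinAt 𝓘(ℝ, E') (range J) z := (J.uniqueDiffOn z hzr).uniqueMDiffWithinAt
  have hψ : MDifferentiableWithinAt 𝓘(ℝ, E') J (extChartAt J y).symm (range J) z :=
    mdifferentiableWithinAt_extChartAt_symm hzt
  have h1 := mfderiv_comp_mfderivWithin (I := 𝓘(ℝ, E')) (I' := J) (I'' := I) z hz.1 hψ hmu
  have e : (extChartAt I (f y)).symm (extChartAt I (f y) (f y')) = f y' :=
    (extChartAt I (f y)).left_inv hz.2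
  have hg : MDifferentiableWithinAt 𝓘(ℝ, E') 𝓘(ℝ, E) (writtenInExtChartAt J I y f) (range J) z := by
    have ha := mdifferentiableAt_extChartAt (I := I) (x := f y) (y := f y')
      (by simpa using hz.2)
    exact MDifferentiableAt.comp_mdifferentiableWithinAt (f := f ∘ (extChartAt J y).symm) z ha
      (MDifferentiableAt.comp_mdifferentiableWithinAt (g := f) z hz.1 hψ)
  have h2 : mfderivWithin 𝓘(ℝ, E') I ((extChartAt I (f y)).symm ∘ writtenInExtChartAt J I y f)
      (range J) z = (mfderivWithin 𝓘(ℝ, E) I (extChartAt I (f y)).symm (range I)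
        (writtenInExtChartAt J I y f z)).comp
        (mfderivWithin 𝓘(ℝ, E') 𝓘(ℝ, E) (writtenInExtChartAt J I y f) (range J) z) := by
    apply mfderivWithin_comp _ _ hg _ hmu
    · exact mdifferentiableWithinAt_extChartAt_symm ((extChartAt I (f y)).map_source hz.2)
    · intro z _
      exact mem_range_self _
  have h3 : mfderivWithin 𝓘(ℝ, E') I ((extChartAt I (f y)).symm ∘ writtenInExtChartAt J I y f)
      (range J) z = mfderivWithin 𝓘(ℝ, E') I (f ∘ (extChartAt J y).symm) (range J) z := by
    apply Filter.EventuallyEq.mfderivWithin_eq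
    · have hc : ContinuousWithinAt (f ∘ (extChartAt J y).symm) (range J) z :=
        ContinuousAt.comp_continuousWithinAt (g := f) hz.1.continuousAt hψ.continuousWithinAt
      filter_upwards [hc.preimage_mem_nhdsWithin ((isOpen_extChartAt_source (I := I) (f y)).mem_nhds hz.2)]
        with z hz
      exact (extChartAt I (f y)).left_inv hz
    · exact e
  rw [h2, h1] at h3
  rw [mfderivWithin_eq_fderivWithin] at h3
  -- All tangent spaces are copies of `E`; forgetting the base point in the type allows the rewrite
  -- along `e`.
  let αE : X → E [⋀^Fin k]→L[ℝ] ℝ := α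
  change ((αE (f y')).compContinuousLinearMap (_ : E' →L[ℝ] E)).compContinuousLinearMap (_ : E' →L[ℝ] E') =
    ((αE ((extChartAt I (f y)).symm (extChartAt I (f y) (f y')))).compContinuousLinearMap
      (_ : E →L[ℝ] E)).compContinuousLinearMap (_ : E' →L[ℝ] E)
  rw [e]
  change (αE (f y')).compContinuousLinearMap (ContinuousLinearMap.comp (_ : E' →L[ℝ] E) (_ : E' →L[ℝ] E')) =
    (αE (f y')).compContinuousLinearMap (ContinuousLinearMap.comp (_ : E →L[ℝ] E) (_ : E' →L[ℝ] E))
  exact congrArg (αE (f y')).compContinuousLinearMap h3.symm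

theorem DForm.SmoothAt.pullbackForm [IsManifold I ∞ X] [IsManifold J ∞ Y] {α : DForm I X k}
    {f : Y → X} {y : Y} (hα : α.SmoothAt (f y)) (hf : ContMDiffAt J I ∞ f y) :
    (pullbackForm I J f k α).SmoothAt y := by
  have hw : ContDiffWithinAt ℝ ∞ (writtenInExtChartAt J I y f) (range J) (extChartAt J y y) :=
    (contMDiffAt_iff.1 hf).2
  refine ContDiffWithinAt.congr_of_eventuallyEq_of_mem ?_
    (inChart_pullbackForm_eventuallyEq α hf) (mem_range_self _)
  refine contDiffWithinAt_compContinuousLinearMap ?_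
    (hw.fderivWithin_right J.uniqueDiffOn (by simp) (mem_range_self _))
  refine ContDiffWithinAt.comp (t := range I) (g := α.inChart (f y)) _ ?_ hw (fun z _ => mem_range_self _)
  have e : writtenInExtChartAt J I y f (extChartAt J y y) = extChartAt I (f y) (f y) := by
    simp [writtenInExtChartAt]
  rw [e]
  exact hα

/-- Naturality of `d` holds in charts, and the differential of `f` is its coordinate expression's
derivative in the charts centred at `y` and `f y`. Only smoothness at the two points is needed, so
the result applies to forms and maps known locally. -/
theorem extD_pullbackForm [IsManifold I ∞ X] [IsManifold J ∞ Y] {α : DForm I X k}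
    {f : Y → X} {y : Y} (hα : α.SmoothAt (f y)) (hf : ContMDiffAt J I ∞ f y) :
    (pullbackForm I J f k α).extD y = pullbackForm I J f (k + 1) α.extD y := by
  have hw : ContDiffWithinAt ℝ ∞ (writtenInExtChartAt J I y f) (range J) (extChartAt J y y) :=
    (contMDiffAt_iff.1 hf).2
  have e : writtenInExtChartAt J I y f (extChartAt J y y) = extChartAt I (f y) (f y) := by
    simp [writtenInExtChartAt]
  have hyr : extChartAt J y y ∈ range J := mem_range_self _
  change (extDerivWithin ((pullbackForm I J f k α).inChart y) (range J)
    (extChartAt J y y)).compContinuousLinearMap (mfderiv J 𝓘(ℝ, E') (extChartAt J y) y) = _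
  rw [(inChart_pullbackForm_eventuallyEq α hf).extDerivWithin_eq_of_mem hyr]
  rw [extDerivWithin_pullback (t := range I) (r := ∞) _ hw _ J.uniqueDiffOn
    (J.range_subset_closure_interior hyr) hyr (fun z _ => mem_range_self _)]
  · rw [e]
    have hfd : MDifferentiableAt J I f y := ContMDiffAt.mdifferentiableAt hf (by simp)
    have : IsManifold I 1 X := IsManifold.of_le (n := ∞) (by simp)
    have : IsManifold J 1 Y := IsManifold.of_le (n := ∞) (by simp)
    have h1 : (fderivWithin ℝ (writtenInExtChartAt J I y f) (range J) (extChartAt J y y)).comp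
        (mfderiv J 𝓘(ℝ, E') (extChartAt J y) y) =
        (mfderiv I 𝓘(ℝ, E) (extChartAt I (f y)) (f y)).comp (mfderiv J I f y) := by
      rw [← hfd.mfderiv]
      rw [mfderiv_extChartAt_self, mfderiv_extChartAt_self]
      ext v
      rfl
    exact congrArg (extDerivWithin (α.inChart (f y)) (range I)
      (extChartAt I (f y) (f y))).compContinuousLinearMap h1
  · rw [e]
    exact hα.differentiableWithinAt (by simp)
  · simpa using two_le_smooth

end FormCalculus

/-! ### Supports, the Leibniz rule and functoriality of pullback. -/

noncomputable section FormAlgebra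
variable {E : Type} [NormedAddCommGroup E] [NormedSpace ℝ E] {H : Type} [TopologicalSpace H]
  {I : ModelWithCorners ℝ E H} {X : Type*} [TopologicalSpace X] [ChartedSpace H X] {k : ℕ}

theorem DForm.smoothAt_zero (x : X) : (0 : DForm I X k).SmoothAt x :=
  contDiffWithinAt_const (c := (0 : E [⋀^Fin k]→L[ℝ] ℝ))

theorem DForm.SmoothAt.of_notMem_supp {α : DForm I X k} {x : X} (h : x ∉ α.supp) :
    α.SmoothAt x := by
  refine (DForm.smoothAt_zero x).congr ?_
  filter_upwards [isClosed_closure.isOpen_compl.mem_nhds h] with y hy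
  by_contra hne
  exact hy (subset_closure hne)

theorem DForm.eq_zero_of_notMem_supp {α : DForm I X k} {x : X} (h : x ∉ α.supp) : α x = 0 := by
  by_contra hne
  exact h (subset_closure hne)

theorem DForm.supp_subset_of_isClosed {α : DForm I X k} {K : Set X} (hK : IsClosed K)
    (h : ∀ x ∉ K, α x = 0) : α.supp ⊆ K :=
  closure_minimal (fun x hx => by_contra fun hxK => hx (h x hxK)) hK

theorem DForm.SmoothAt.smul [IsManifold I ∞ X] {c : X → ℝ} {α : DForm I X k} {x : X}
    (hc : ContMDiffAt I 𝓘(ℝ, ℝ) ∞ c x) (hα : α.SmoothAt x) :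
    DForm.SmoothAt (fun y => c y • α y : DForm I X k) x := by
  have hw : ContDiffWithinAt ℝ ∞ (c ∘ (extChartAt I x).symm) (range I) (extChartAt I x x) :=
    (contMDiffAt_iff.1 hc).2
  exact ContDiffWithinAt.smul hw hα

/-- The tangent space at `x` is identified with `E` through the preferred chart at `x`, so that
chart contributes the identity at its own centre. -/
theorem DForm.inChart_self [IsManifold I ∞ X] (α : DForm I X k) (x : X) :
    α.inChart x (extChartAt I x x) = α x := by
  have : IsManifold I 1 X := IsManifold.of_le (n := ∞) (by simp)
  unfold DForm.inChart
  rw [mfderivWithin_range_extChartAt_symm, extChartAt_to_inv]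
  rfl

theorem DForm.extD_eq [IsManifold I ∞ X] (α : DForm I X k) (x : X) :
    α.extD x = extDerivWithin (α.inChart x) (range I) (extChartAt I x x) := by
  have : IsManifold I 1 X := IsManifold.of_le (n := ∞) (by simp)
  unfold DForm.extD
  rw [mfderiv_extChartAt_self]
  rfl

/-- The Leibniz rule `d(cα) = dc ∧ α + c dα`, with the wedge product written out as an alternating
sum. -/
theorem DForm.SmoothAt.extD_smul [IsManifold I ∞ X] {c : X → ℝ} {α : DForm I X k} {x : X}
    (hc : ContMDiffAt I 𝓘(ℝ, ℝ) ∞ c x) (hα : α.SmoothAt x)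
    {dc : TangentSpace I x →L[ℝ] ℝ} (hdc : mfderiv I 𝓘(ℝ, ℝ) c x = dc)
    (v : Fin (k + 1) → TangentSpace I x) :
    DForm.extD (fun y => c y • α y : DForm I X k) x v =
      (∑ j : Fin (k + 1), (-1) ^ (j : ℕ) * dc (v j) *
        α x (fun i => v (j.succAbove i))) + c x * α.extD x v := by
  have hw : ContDiffWithinAt ℝ ∞ (c ∘ (extChartAt I x).symm) (range I) (extChartAt I x x) :=
    (contMDiffAt_iff.1 hc).2
  have hud : UniqueDiffWithinAt ℝ (range I) (extChartAt I x x) := I.uniqueDiffOn _ (mem_range_self _)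
  have hwd := hw.differentiableWithinAt (by simp)
  have hαd : DifferentiableWithinAt ℝ (α.inChart x) (range I) (extChartAt I x x) :=
    ContDiffWithinAt.differentiableWithinAt hα (by simp)
  have hcd : MDifferentiableAt I 𝓘(ℝ, ℝ) c x := ContMDiffAt.mdifferentiableAt hc (by simp)
  have hm : mfderiv I 𝓘(ℝ, ℝ) c x = fderivWithin ℝ (c ∘ (extChartAt I x).symm) (range I)
      (extChartAt I x x) := hcd.mfderiv
  let αE : X → E [⋀^Fin k]→L[ℝ] ℝ := α
  let vE : Fin (k + 1) → E := v
  have e1 : DForm.inChart (fun y => c y • α y : DForm I X k) x =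
    fun y => (c ∘ (extChartAt I x).symm) y • α.inChart x y := rfl
  rw [← hdc, DForm.extD_eq, DForm.extD_eq, e1, hm]
  change (extDerivWithin (fun y => (c ∘ (extChartAt I x).symm) y • α.inChart x y) (range I)
    (extChartAt I x x)) vE = (∑ j : Fin (k + 1), (-1) ^ (j : ℕ) * (fderivWithin ℝ
      (c ∘ (extChartAt I x).symm) (range I) (extChartAt I x x)) (vE j) *
        αE x (fun i => vE (j.succAbove i))) +
      c x * extDerivWithin (α.inChart x) (range I) (extChartAt I x x) vE
  rw [extDerivWithin_apply (hwd.fun_smul hαd) hud, extDerivWithin_apply hαd hud, Finset.mul_sum,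
    ← Finset.sum_add_distrib]
  refine Finset.sum_congr rfl fun j _ => ?_
  have h2 : DifferentiableWithinAt ℝ (fun y => α.inChart x y (j.removeNth vE)) (range I)
      (extChartAt I x x) :=
    (ContinuousAlternatingMap.apply ℝ E ℝ (j.removeNth vE)).differentiableAt.comp_differentiableWithinAt
      _ hαd
  have h3 := fderivWithin_fun_smul (𝕜 := ℝ) hud hwd h2
  have e2 : (fun y => ((c ∘ (extChartAt I x).symm) y • α.inChart x y) (j.removeNth vE)) =
    fun y => (c ∘ (extChartAt I x).symm) y • (α.inChart x y (j.removeNth vE)) := rfl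
  rw [e2, h3]
  have e3 : α.inChart x (extChartAt I x x) (j.removeNth vE) = αE x (fun i => vE (j.succAbove i)) := by
    rw [DForm.inChart_self]; rfl
  rw [e3]
  simp only [Function.comp_apply, extChartAt_to_inv, add_apply,
    smul_apply, smul_eq_mul, ContinuousLinearMap.smulRight_apply]
  ring

variable {E' : Type} [NormedAddCommGroup E'] [NormedSpace ℝ E'] {H' : Type} [TopologicalSpace H']
  {J : ModelWithCorners ℝ E' H'} {Y : Type*} [TopologicalSpace Y] [ChartedSpace H' Y]
  {E'' : Type} [NormedAddCommGroup E''] [NormedSpace ℝ E''] {H'' : Type} [TopologicalSpace H'']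
  {L : ModelWithCorners ℝ E'' H''} {Z : Type*} [TopologicalSpace Z] [ChartedSpace H'' Z]

theorem pullbackForm_apply (f : Y → X) (α : DForm I X k) (y : Y) (v : Fin k → TangentSpace J y) :
    pullbackForm I J f k α y v = α (f y) (fun i => mfderiv J I f y (v i)) := rfl

theorem pullbackForm_comp {f : Y → X} {g : Z → Y} {z : Z} (hf : MDifferentiableAt J I f (g z))
    (hg : MDifferentiableAt L J g z) (α : DForm I X k) :
    pullbackForm I L (f ∘ g) k α z = pullbackForm J L g k (pullbackForm I J f k α) z := by
  ext v
  rw [pullbackForm_apply, pullbackForm_apply, pullbackForm_apply, mfderiv_comp z hf hg]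
  rfl

theorem pullbackForm_id (α : DForm I X k) : pullbackForm I I id k α = α := by
  funext x
  ext v
  rw [pullbackForm_apply, mfderiv_id]
  rfl

end FormAlgebra

/-! ### Parameter integrals and implicitly defined functions on sets with boundary. -/

noncomputable section Analysis
variable {E G : Type} [NormedAddCommGroup E] [NormedSpace ℝ E] [NormedAddCommGroup G]
  [NormedSpace ℝ G]

theorem ContDiffOn.continuousOn_partial_fderivWithin {S : Set E} (hS : UniqueDiffOn ℝ S)
    {f : ℝ × E → G} (hf : ContDiffOn ℝ 1 f (univ ×ˢ S)) :
    ContinuousOn (fun z => (fderivWithin ℝ f (univ ×ˢ S) z).comp (ContinuousLinearMap.inr ℝ ℝ E))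
      (univ ×ˢ S) :=
  (hf.continuousOn_fderivWithin (uniqueDiffOn_univ.prod hS) le_rfl).clm_comp continuousOn_const

theorem hasFDerivWithinAt_partial {S : Set E} {f : ℝ × E → G} {r : ℝ} {u : E}
    (hf : DifferentiableWithinAt ℝ f (univ ×ˢ S) (r, u)) :
    HasFDerivWithinAt (fun z => f (r, z)) ((fderivWithin ℝ f (univ ×ˢ S) (r, u)).comp
      (ContinuousLinearMap.inr ℝ ℝ E)) S u := by
  have h : HasFDerivWithinAt (fun z : E => (r, z)) (ContinuousLinearMap.inr ℝ ℝ E) S u :=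
    (hasFDerivAt_prodMk_right r u).hasFDerivWithinAt
  exact HasFDerivWithinAt.comp u hf.hasFDerivWithinAt h (fun z hz => ⟨mem_univ _, hz⟩)

theorem continuous_slice {E G : Type} [TopologicalSpace E] [TopologicalSpace G] {S : Set E} {f : ℝ × E → G} (hf : ContinuousOn f (univ ×ˢ S)) {u : E}
    (hu : u ∈ S) : Continuous fun r => f (r, u) :=
  hf.comp_continuous (by fun_prop) fun _ => ⟨mem_univ _, hu⟩

/-- Local convexity of `S` allows the mean value inequality along segments inside `S`. The resulting
first-order estimate is uniform in `r` because the partial derivative is continuous and the interval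
is compact. -/
theorem hasFDerivWithinAt_intervalIntegral [CompleteSpace G] {S : Set E} (hS : UniqueDiffOn ℝ S)
    (hloc : ∀ u ∈ S, ∃ ε > 0, Convex ℝ (S ∩ Metric.ball u ε)) (a b : ℝ) {f : ℝ × E → G}
    (hf : ContDiffOn ℝ 1 f (univ ×ˢ S)) {u : E} (hu : u ∈ S) :
    HasFDerivWithinAt (fun z => ∫ r in a..b, f (r, z))
      (∫ r in a..b, (fderivWithin ℝ f (univ ×ˢ S) (r, u)).comp (ContinuousLinearMap.inr ℝ ℝ E)) S u := by
  set D : ℝ × E → E →L[ℝ] G := fun z =>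
    (fderivWithin ℝ f (univ ×ˢ S) z).comp (ContinuousLinearMap.inr ℝ ℝ E) with hD
  have hDc : ContinuousOn D (univ ×ˢ S) := hf.continuousOn_partial_fderivWithin hS
  have hd : ∀ r, ∀ z ∈ S, HasFDerivWithinAt (fun z => f (r, z)) (D (r, z)) S z := fun r z hz =>
    hasFDerivWithinAt_partial (hf.differentiableOn (by simp) _ ⟨mem_univ _, hz⟩)
  refine HasFDerivWithinAt.of_isLittleO (Asymptotics.isLittleO_iff.2 fun c hc => ?_)
  -- Chosen so that `ε * |b - a| ≤ c`; the summand `1` covers `a = b`.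
  set ε : ℝ := c / (|b - a| + 1) with hε
  have hεp : 0 < ε := by positivity
  have hsw : ContinuousOn (Function.uncurry fun (z : E) (r : ℝ) => D (r, z)) (S ×ˢ uIcc a b) :=
    hDc.comp (by fun_prop) fun z hz => ⟨mem_univ _, hz.1⟩
  -- Tube lemma: near `u` the partial derivative differs from its value at `u` by less than `ε`, for
  -- all `r` in the interval at once.
  obtain ⟨v, hv, hvD⟩ := isCompact_uIcc.mem_uniformity_of_prod hsw hu (Metric.dist_mem_uniformity hεp)
  obtain ⟨δ₁, hδ₁, hcv⟩ := hloc u hu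
  obtain ⟨δ₂, hδ₂, hsub⟩ := Metric.mem_nhdsWithin_iff.1 hv
  filter_upwards [inter_mem_nhdsWithin S (Metric.ball_mem_nhds u (lt_min hδ₁ hδ₂))] with z hz
  set C := (S ∩ Metric.ball u δ₁) ∩ Metric.ball u δ₂ with hC
  have hCc : Convex ℝ C := hcv.inter (convex_ball u δ₂)
  have hzC : z ∈ C := by
    have := Metric.mem_ball.1 hz.2
    exact ⟨⟨hz.1, Metric.mem_ball.2 (this.trans_le (min_le_left _ _))⟩,
      Metric.mem_ball.2 (this.trans_le (min_le_right _ _))⟩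
  have huC : u ∈ C := ⟨⟨hu, Metric.mem_ball_self hδ₁⟩, Metric.mem_ball_self hδ₂⟩
  have hb : ∀ r ∈ uIcc a b, ‖f (r, z) - f (r, u) - D (r, u) (z - u)‖ ≤ ε * ‖z - u‖ := by
    intro r hr
    refine hCc.norm_image_sub_le_of_norm_hasFDerivWithin_le' (f := fun z => f (r, z))
      (f' := fun z => D (r, z)) (fun w hw => (hd r w hw.1.1).mono fun x hx => hx.1.1)
      (fun w hw => ?_) huC hzC
    have := hvD w (hsub ⟨hw.2, hw.1.1⟩) r hr
    rw [← dist_eq_norm]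
    exact (le_of_lt this)
  have hi1 : ∀ w ∈ S, IntervalIntegrable (fun r => f (r, w)) MeasureTheory.volume a b := fun w hw =>
    (continuous_slice hf.continuousOn hw).intervalIntegrable _ _
  have hi2 : IntervalIntegrable (fun r => D (r, u)) MeasureTheory.volume a b :=
    (continuous_slice hDc hu).intervalIntegrable _ _
  have hi3 : IntervalIntegrable (fun r => D (r, u) (z - u)) MeasureTheory.volume a b :=
    ((continuous_slice hDc hu).clm_apply continuous_const).intervalIntegrable _ _
  have key : (∫ r in a..b, f (r, z)) - (∫ r in a..b, f (r, u)) - (∫ r in a..b, D (r, u)) (z - u)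
      = ∫ r in a..b, (f (r, z) - f (r, u) - D (r, u) (z - u)) := by
    rw [intervalIntegral.integral_sub ((hi1 z hz.1).sub (hi1 u hu)) hi3,
      intervalIntegral.integral_sub (hi1 z hz.1) (hi1 u hu),
      ContinuousLinearMap.intervalIntegral_apply hi2]
  rw [key]
  refine (intervalIntegral.norm_integral_le_of_norm_le_const
    fun r hr => hb r (uIoc_subset_uIcc hr)).trans ?_
  have h1 : ε * |b - a| ≤ c := by
    rw [hε, div_mul_eq_mul_div, div_le_iff₀ (by positivity)]
    nlinarith [abs_nonneg (b - a)]
  calc ε * ‖z - u‖ * |b - a| = (ε * |b - a|) * ‖z - u‖ := by ring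
    _ ≤ c * ‖z - u‖ := by gcongr

/-- The exterior derivative is a continuous linear function `Λ` of the derivative; this form of the
statement lets it pass under the integral. -/
theorem clm_fderivWithin_intervalIntegral {G' : Type} [NormedAddCommGroup G'] [NormedSpace ℝ G']
    [CompleteSpace G] [CompleteSpace G'] {S : Set E} (hS : UniqueDiffOn ℝ S)
    (hloc : ∀ u ∈ S, ∃ ε > 0, Convex ℝ (S ∩ Metric.ball u ε)) (a b : ℝ) {f : ℝ × E → G}
    (hf : ContDiffOn ℝ 1 f (univ ×ˢ S)) {u : E} (hu : u ∈ S) (Λ : (E →L[ℝ] G) →L[ℝ] G') :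
    Λ (fderivWithin ℝ (fun z => ∫ r in a..b, f (r, z)) S u) =
      ∫ r in a..b, Λ (fderivWithin ℝ (fun z => f (r, z)) S u) := by
  have hi : IntervalIntegrable (fun r => (fderivWithin ℝ f (univ ×ˢ S) (r, u)).comp
      (ContinuousLinearMap.inr ℝ ℝ E)) MeasureTheory.volume a b :=
    (continuous_slice (hf.continuousOn_partial_fderivWithin hS) hu).intervalIntegrable _ _
  rw [(hasFDerivWithinAt_intervalIntegral hS hloc a b hf hu).fderivWithin (hS u hu),
    ← Λ.intervalIntegral_comp_comm hi]
  congr 1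
  funext r
  rw [(hasFDerivWithinAt_partial (hf.differentiableOn (by simp) (r, u)
    ⟨mem_univ _, hu⟩)).fderivWithin (hS u hu)]

/-- The derivative of a parameter integral is again a parameter integral. The target space `G` is
quantified inside the induction because the derivative takes values in `E →L[ℝ] G`. -/
theorem contDiffOn_intervalIntegral_nat {S : Set E} (hS : UniqueDiffOn ℝ S)
    (hloc : ∀ u ∈ S, ∃ ε > 0, Convex ℝ (S ∩ Metric.ball u ε)) (a b : ℝ) (n : ℕ) :
    ∀ {G : Type} [NormedAddCommGroup G] [NormedSpace ℝ G] [CompleteSpace G] {f : ℝ × E → G},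
      ContDiffOn ℝ ∞ f (univ ×ˢ S) → ContDiffOn ℝ n (fun z => ∫ r in a..b, f (r, z)) S := by
  induction n with
  | zero =>
    intro G _ _ _ f hf
    exact contDiffOn_zero.2 fun u hu =>
      (hasFDerivWithinAt_intervalIntegral hS hloc a b (hf.of_le (by simp)) hu).continuousWithinAt
  | succ n ih =>
    intro G _ _ _ f hf
    have hf1 : ContDiffOn ℝ 1 f (univ ×ˢ S) := hf.of_le (by simp)
    have hd := fun u (hu : u ∈ S) => hasFDerivWithinAt_intervalIntegral hS hloc a b hf1 hu
    push_cast
    refine (contDiffOn_succ_iff_fderivWithin hS).2 ⟨fun u hu => (hd u hu).differentiableWithinAt,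
      by simp, ?_⟩
    have hf' : ContDiffOn ℝ ∞ (fun z => (fderivWithin ℝ f (univ ×ˢ S) z).comp
        (ContinuousLinearMap.inr ℝ ℝ E)) (univ ×ˢ S) :=
      (hf.fderivWithin (uniqueDiffOn_univ.prod hS) (by simp)).clm_comp contDiffOn_const
    exact (ih hf').congr fun u hu => (hd u hu).fderivWithin (hS u hu)

theorem contDiffOn_intervalIntegral [CompleteSpace G] {S : Set E} (hS : UniqueDiffOn ℝ S)
    (hloc : ∀ u ∈ S, ∃ ε > 0, Convex ℝ (S ∩ Metric.ball u ε)) (a b : ℝ) {f : ℝ × E → G}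
    (hf : ContDiffOn ℝ ∞ f (univ ×ˢ S)) : ContDiffOn ℝ ∞ (fun z => ∫ r in a..b, f (r, z)) S :=
  contDiffOn_infty.2 fun n => contDiffOn_intervalIntegral_nat hS hloc a b n hf

variable {E₁ E₂ E₃ : Type} [NormedAddCommGroup E₁] [NormedSpace ℝ E₁] [NormedAddCommGroup E₂]
  [NormedSpace ℝ E₂] [NormedAddCommGroup E₃] [NormedSpace ℝ E₃]

/-- A continuous solution `ψ` of the equation `F ∘ ψ = χ` is smooth where `F` has invertible
derivative. -/
theorem contDiffOn_of_comp_eq [CompleteSpace E₁] {F : E₁ → E₂} {T : Set E₁} (hT : UniqueDiffOn ℝ T)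
    (hF : ContDiffOn ℝ ∞ F T) {S : Set E₃} (hS : UniqueDiffOn ℝ S) {χ : E₃ → E₂}
    (hχ : ContDiffOn ℝ ∞ χ S) {ψ : E₃ → E₁} (hψ : ContinuousOn ψ S) (hST : MapsTo ψ S T)
    (h : ∀ y ∈ S, F (ψ y) = χ y) (hinv : ∀ y ∈ S, (fderivWithin ℝ F T (ψ y)).IsInvertible) :
    ContDiffOn ℝ ∞ ψ S := by
  have hd : ∀ y ∈ S, HasFDerivWithinAt ψ
      ((fderivWithin ℝ F T (ψ y)).inverse.comp (fderivWithin ℝ χ S y)) S y := by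
    intro y hy
    obtain ⟨e, he⟩ := hinv y hy
    have hFd := (hF.differentiableOn (by simp) _ (hST hy)).hasFDerivWithinAt
    have hχd := (hχ.differentiableOn (by simp) _ hy).hasFDerivWithinAt
    rw [← he] at hFd ⊢
    rw [ContinuousLinearMap.inverse_equiv]
    -- Since `F` has invertible derivative and `ψ` is continuous, differentiability of `χ = F ∘ ψ`
    -- forces that of `ψ`, with derivative `F'⁻¹ ∘ χ'`.
    refine HasFDerivWithinAt.of_comp_of_isEmbedding (t := T) (f := F) (h := χ) ?_ hFd
      e.toHomeomorph.isEmbedding ?_ ?_ hy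
    · exact tendsto_nhdsWithin_of_tendsto_nhds_of_eventually_within _ (hψ y hy)
        (eventually_mem_nhdsWithin.mono fun z hz => hST hz)
    · convert! hχd using 1
      ext v
      simp
    · exact eventually_mem_nhdsWithin.mono fun z hz => h z hz
  -- Bootstrapping: the formula for the derivative involves `ψ` itself only through `F'(ψ)`, so
  -- class `n` implies class `n + 1`.
  have key : ∀ n : ℕ, ContDiffOn ℝ n ψ S := by
    intro n
    induction n with
    | zero => exact contDiffOn_zero.2 hψ
    | succ n ih =>
      push_cast
      refine (contDiffOn_succ_iff_fderivWithin hS).2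
        ⟨fun u hu => (hd u hu).differentiableWithinAt, by simp, ?_⟩
      refine ContDiffOn.congr ?_ fun u hu => (hd u hu).fderivWithin (hS u hu)
      have hF' : ContDiffOn ℝ n (fderivWithin ℝ F T) T :=
        (hF.fderivWithin (m := ∞) hT (by simp)).of_le (by exact_mod_cast le_top)
      have hχ' : ContDiffOn ℝ n (fderivWithin ℝ χ S) S :=
        (hχ.fderivWithin (m := ∞) hS (by simp)).of_le (by exact_mod_cast le_top)
      refine ContDiffOn.clm_comp (fun y hy => ?_) hχ'
      obtain ⟨e, he⟩ := hinv y hy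
      have h1 : ContDiffAt ℝ n ContinuousLinearMap.inverse (fderivWithin ℝ F T (ψ y)) := by
        rw [← he]; exact contDiffAt_map_inverse e
      exact h1.comp_contDiffWithinAt y ((hF'.comp ih hST) y hy)
  exact contDiffOn_infty.2 key

end Analysis

/-! ### Integration along the line in the cylinder `ℝ × X`. -/

noncomputable section FiberHomotopy
variable {E : Type} [NormedAddCommGroup E] [NormedSpace ℝ E] {H : Type} [TopologicalSpace H]
  {I : ModelWithCorners ℝ E H} {X : Type*} [TopologicalSpace X] [ChartedSpace H X] {k : ℕ}

variable (E k) in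
/-- Contraction of a form on `ℝ × E` with the unit vector of `ℝ`, restricted to `E`. -/
def fiberContraction : ((ℝ × E) [⋀^Fin (k + 1)]→L[ℝ] ℝ) →L[ℝ] E [⋀^Fin k]→L[ℝ] ℝ :=
  (ContinuousAlternatingMap.compContinuousLinearMapCLM (ContinuousLinearMap.inr ℝ ℝ E)).comp
    ((ContinuousLinearMap.apply ℝ _ ((1, 0) : ℝ × E)).comp
      (ContinuousAlternatingMap.curryLeftLI (𝕜 := ℝ) (E := ℝ × E) (F := ℝ) (n := k)).toContinuousLinearMap)

theorem fiberContraction_apply (w : (ℝ × E) [⋀^Fin (k + 1)]→L[ℝ] ℝ) (v : Fin k → E) :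
    fiberContraction E k w v =
      w (Fin.cons ((1, 0) : ℝ × E) (fun i => ((0, v i) : ℝ × E)) : Fin (k + 1) → ℝ × E) := rfl

theorem fiberContraction_comp_prodMap {E' : Type} [NormedAddCommGroup E'] [NormedSpace ℝ E']
    (w : (ℝ × E) [⋀^Fin (k + 1)]→L[ℝ] ℝ) (B : E' →L[ℝ] E) :
    fiberContraction E' k (w.compContinuousLinearMap ((ContinuousLinearMap.id ℝ ℝ).prodMap B)) =
      (fiberContraction E k w).compContinuousLinearMap B := by
  ext v
  change w _ = w _
  congr 1
  funext i
  refine Fin.cases ?_ (fun j => ?_) i <;> simp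

/-- Cartan's formula for `∂_r`. In the alternating sum for the exterior derivative the zeroth term
differentiates along `∂_r`; every other term keeps `∂_r` as first argument and carries the opposite
sign of the corresponding term on the slice. -/
theorem fiberContraction_extDerivWithin {S : Set E} (hS : UniqueDiffOn ℝ S)
    {w : ℝ × E → (ℝ × E) [⋀^Fin (k + 1)]→L[ℝ] ℝ} {r : ℝ} {y : E} (hy : y ∈ S)
    (hw : DifferentiableWithinAt ℝ w (univ ×ˢ S) (r, y)) :
    fiberContraction E (k + 1) (extDerivWithin w (univ ×ˢ S) (r, y)) =
      (fderivWithin ℝ w (univ ×ˢ S) (r, y) (1, 0)).compContinuousLinearMap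
        (ContinuousLinearMap.inr ℝ ℝ E) -
      extDerivWithin (fun z => fiberContraction E k (w (r, z))) S y := by
  have hud : UniqueDiffWithinAt ℝ ((univ : Set ℝ) ×ˢ S) (r, y) :=
    (uniqueDiffWithinAt_univ).prod (hS y hy)
  have hd : HasFDerivWithinAt (fun z => fiberContraction E k (w (r, z)))
      ((fiberContraction E k).comp ((fderivWithin ℝ w (univ ×ˢ S) (r, y)).comp
        (ContinuousLinearMap.inr ℝ ℝ E))) S y :=
    (fiberContraction E k).hasFDerivAt.comp_hasFDerivWithinAt y (hasFDerivWithinAt_partial hw)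
  rw [extDerivWithin, extDerivWithin, hd.fderivWithin (hS y hy)]
  ext v
  rw [fiberContraction_apply, ContinuousAlternatingMap.alternatizeUncurryFin_apply,
    ContinuousAlternatingMap.sub_apply, ContinuousAlternatingMap.alternatizeUncurryFin_apply,
    Fin.sum_univ_succ]
  simp only [Fin.val_zero, pow_zero, one_smul, Fin.cons_zero, Fin.removeNth_zero, Fin.tail_cons,
    Fin.cons_succ, Fin.val_succ, pow_succ, mul_neg, mul_one, neg_smul, Finset.sum_neg_distrib,
    sub_eq_add_neg]
  congr 2
  refine Finset.sum_congr rfl fun j _ => ?_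
  congr 1
  change _ = fiberContraction E k (fderivWithin ℝ w (univ ×ˢ S) (r, y) (0, v j)) (j.removeNth v)
  rw [fiberContraction_apply]
  congr 1
  funext i
  refine Fin.cases ?_ (fun i => ?_) i
  · rfl
  · simp [Fin.removeNth]

/-- The values of a form, as alternating forms on the model space. -/
def DForm.modelValue (α : DForm I X k) : X → E [⋀^Fin k]→L[ℝ] ℝ := α

theorem mfderivWithin_extChartAt_symm_eq [IsManifold I ∞ X] (x₀ : X) {y : E}
    (hy : y ∈ (extChartAt I x₀).target) :
    mfderivWithin 𝓘(ℝ, E) I (extChartAt I x₀).symm (range I) y =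
      fderivWithin ℝ (extChartAt I ((extChartAt I x₀).symm y) ∘ (extChartAt I x₀).symm) (range I) y := by
  have : IsManifold I 1 X := IsManifold.of_le (n := ∞) (by simp)
  have h : MDifferentiableWithinAt 𝓘(ℝ, E) I (extChartAt I x₀).symm (range I) y :=
    mdifferentiableWithinAt_extChartAt_symm hy
  rw [h.mfderivWithin]
  have e : (extChartAt 𝓘(ℝ, E) y).symm ⁻¹' (range I) ∩ range 𝓘(ℝ, E) = range I := by
    rw [extChartAt_model_space_eq_id]; simp
  rw [e]
  rfl

/-- The charts of the cylinder are products with the identity of `ℝ`, so the chart based at `(0,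
x₀)` serves every `r`. -/
theorem inChart_cylinder [IsManifold I ∞ X] (w : DForm (𝓘(ℝ, ℝ).prod I) (ℝ × X) k) (x₀ : X)
    {y : E} (hy : y ∈ (extChartAt I x₀).target) (r : ℝ) :
    w.inChart (0, x₀) (r, y) =
      (w.modelValue (r, (extChartAt I x₀).symm y)).compContinuousLinearMap
        ((ContinuousLinearMap.id ℝ ℝ).prodMap
        (mfderivWithin 𝓘(ℝ, E) I (extChartAt I x₀).symm (range I) y : E →L[ℝ] E)) := by
  have hy' : (r, y) ∈ (extChartAt (𝓘(ℝ, ℝ).prod I) ((0 : ℝ), x₀)).target := by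
    rw [extChartAt_prod, extChartAt_model_space_eq_id]
    exact ⟨mem_univ _, hy⟩
  have hr : range (𝓘(ℝ, ℝ).prod I) = univ ×ˢ range I := by
    rw [modelWithCorners_prod_coe, range_prodMap]; simp
  have key : (mfderivWithin 𝓘(ℝ, ℝ × E) (𝓘(ℝ, ℝ).prod I)
      (extChartAt (𝓘(ℝ, ℝ).prod I) ((0 : ℝ), x₀)).symm (range (𝓘(ℝ, ℝ).prod I)) (r, y) :
        ℝ × E →L[ℝ] ℝ × E) = (ContinuousLinearMap.id ℝ ℝ).prodMap
        (mfderivWithin 𝓘(ℝ, E) I (extChartAt I x₀).symm (range I) y : E →L[ℝ] E) := by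
    refine (mfderivWithin_extChartAt_symm_eq _ hy').trans ?_
    have hm := mfderivWithin_extChartAt_symm_eq x₀ hy
    refine Eq.trans ?_ (congrArg (fun B : E →L[ℝ] E => (ContinuousLinearMap.id ℝ ℝ).prodMap B) hm.symm)
    have hd : DifferentiableWithinAt ℝ
        (extChartAt I ((extChartAt I x₀).symm y) ∘ (extChartAt I x₀).symm) (range I) y := by
      refine ContDiffWithinAt.differentiableWithinAt (n := ∞) ?_ (by simp)
      exact contDiffWithinAt_ext_coord_change (I := I) (n := ∞) _ x₀ ⟨hy, mem_extChartAt_source _⟩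
    have hp : HasFDerivWithinAt (Prod.map id
        (extChartAt I ((extChartAt I x₀).symm y) ∘ (extChartAt I x₀).symm))
        ((ContinuousLinearMap.id ℝ ℝ).prodMap (fderivWithin ℝ
          (extChartAt I ((extChartAt I x₀).symm y) ∘ (extChartAt I x₀).symm) (range I) y))
        (univ ×ˢ range I) (r, y) :=
      HasFDerivWithinAt.prodMap (r, y) ((hasFDerivWithinAt_id r univ).mono (subset_univ _))
        (hd.hasFDerivWithinAt.mono (by rintro _ ⟨z, hz, rfl⟩; exact hz.2))
    rw [hr]
    exact hp.fderivWithin (uniqueDiffWithinAt_univ.prod (I.uniqueDiffOn y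
      (extChartAt_target_subset_range x₀ hy)))
  unfold DForm.inChart
  exact congrArg (fun B : ℝ × E →L[ℝ] ℝ × E =>
    (w.modelValue (r, (extChartAt I x₀).symm y)).compContinuousLinearMap B) key

theorem extChartAt_cylinder_target (x₀ : X) :
    (extChartAt (𝓘(ℝ, ℝ).prod I) ((0 : ℝ), x₀)).target = univ ×ˢ (extChartAt I x₀).target := by
  rw [extChartAt_prod, PartialEquiv.prod_target, extChartAt_model_space_eq_id]
  rfl

theorem continuous_cylinder_fiber [IsManifold I ∞ X] {w : DForm (𝓘(ℝ, ℝ).prod I) (ℝ × X) k}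
    (hw : w.Smooth) (x : X) : Continuous (fun r => w.modelValue (r, x)) := by
  have h1 : ∀ r, w.inChart (0, x) (r, extChartAt I x x) = w.modelValue (r, x) := fun r =>
    DForm.inChart_self w (r, x)
  simp_rw [← h1]
  have h := (hw (0, x)).continuousOn
  rw [extChartAt_cylinder_target] at h
  exact continuous_slice h (mem_extChartAt_target x)

variable (I X) in
/-- The fiber integral over `[a, b]` of a form on the cylinder. -/
def cylinderIntegral (a b : ℝ) (w : DForm (𝓘(ℝ, ℝ).prod I) (ℝ × X) (k + 1)) : DForm I X k :=
  fun x => (∫ r in a..b, fiberContraction E k (w.modelValue (r, x)) : E [⋀^Fin k]→L[ℝ] ℝ)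

theorem inChart_cylinderIntegral [IsManifold I ∞ X] {w : DForm (𝓘(ℝ, ℝ).prod I) (ℝ × X) (k + 1)}
    (hw : w.Smooth) (a b : ℝ) (x₀ : X) {y : E} (hy : y ∈ (extChartAt I x₀).target) :
    (cylinderIntegral I X a b w).inChart x₀ y =
      ∫ r in a..b, fiberContraction E k (w.inChart (0, x₀) (r, y)) := by
  have e : ∀ r, fiberContraction E k (w.inChart (0, x₀) (r, y)) =
      (fiberContraction E k (w.modelValue (r, (extChartAt I x₀).symm y))).compContinuousLinearMap
        (mfderivWithin 𝓘(ℝ, E) I (extChartAt I x₀).symm (range I) y : E →L[ℝ] E) := fun r => by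
    rw [inChart_cylinder w x₀ hy]
    exact fiberContraction_comp_prodMap _ _
  simp_rw [e]
  have hc := (fiberContraction E k).continuous.comp
    (continuous_cylinder_fiber hw ((extChartAt I x₀).symm y))
  exact (ContinuousLinearMap.intervalIntegral_comp_comm (E := E [⋀^Fin k]→L[ℝ] ℝ)
    (F := E [⋀^Fin k]→L[ℝ] ℝ) (ContinuousAlternatingMap.compContinuousLinearMapCLM
      (mfderivWithin 𝓘(ℝ, E) I (extChartAt I x₀).symm (range I) y : E →L[ℝ] E))
    (hc.intervalIntegrable a b)).symm

/-- Near each of its points the chart target agrees with the range of the model, which is convex.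
This supplies the local convexity required for differentiating integrals. -/
theorem convex_inter_ball_extChartAt_target (x₀ : X) {y : E} (hy : y ∈ (extChartAt I x₀).target) :
    ∃ ε > 0, Convex ℝ ((extChartAt I x₀).target ∩ Metric.ball y ε) := by
  obtain ⟨ε, hε, h⟩ := Metric.mem_nhdsWithin_iff.1 (extChartAt_target_mem_nhdsWithin_of_mem hy)
  refine ⟨ε, hε, ?_⟩
  have e : (extChartAt I x₀).target ∩ Metric.ball y ε = range I ∩ Metric.ball y ε := by
    ext z
    exact ⟨fun hz => ⟨extChartAt_target_subset_range x₀ hz.1, hz.2⟩, fun hz => ⟨h ⟨hz.2, hz.1⟩, hz.2⟩⟩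
  rw [e]
  exact I.convex_range.inter (convex_ball y ε)

theorem DForm.Smooth.inChart_cylinder {w : DForm (𝓘(ℝ, ℝ).prod I) (ℝ × X) k} (hw : w.Smooth)
    (x₀ : X) : ContDiffOn ℝ ∞ (w.inChart (0, x₀)) (univ ×ˢ (extChartAt I x₀).target) := by
  have h := hw (0, x₀)
  rwa [extChartAt_cylinder_target] at h

theorem smooth_cylinderIntegral [IsManifold I ∞ X] {w : DForm (𝓘(ℝ, ℝ).prod I) (ℝ × X) (k + 1)}
    (hw : w.Smooth) (a b : ℝ) : (cylinderIntegral I X a b w).Smooth := by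
  intro x₀
  refine (contDiffOn_intervalIntegral (uniqueDiffOn_extChartAt_target x₀)
    (fun u hu => convex_inter_ball_extChartAt_target x₀ hu) a b
    ((fiberContraction E k).contDiff.comp_contDiffOn (hw.inChart_cylinder x₀))).congr fun y hy => ?_
  exact inChart_cylinderIntegral hw a b x₀ hy

/-- Restriction of a form on the cylinder to the slice over `r`. -/
def cylinderSlice (r : ℝ) (w : DForm (𝓘(ℝ, ℝ).prod I) (ℝ × X) k) : DForm I X k :=
  fun x => (w.modelValue (r, x)).compContinuousLinearMap (ContinuousLinearMap.inr ℝ ℝ E)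

theorem extDerivWithin_eq_of_mem_nhdsWithin {S T : Set E} {y : E} (h : S ∈ 𝓝[T] y) (hST : S ⊆ T)
    (w : E → E [⋀^Fin k]→L[ℝ] ℝ) : extDerivWithin w S y = extDerivWithin w T y := by
  have e : fderivWithin ℝ w S y = fderivWithin ℝ w T y :=
    fderivWithin_congr_set (hST.eventuallyLE.antisymm (by
      rw [mem_nhdsWithin_iff_eventually] at h
      exact h))
  rw [extDerivWithin, extDerivWithin, e]

theorem extDerivWithin_intervalIntegral {S : Set E} (hS : UniqueDiffOn ℝ S)
    (hloc : ∀ u ∈ S, ∃ ε > 0, Convex ℝ (S ∩ Metric.ball u ε)) (a b : ℝ)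
    {f : ℝ × E → E [⋀^Fin k]→L[ℝ] ℝ} (hf : ContDiffOn ℝ 1 f (univ ×ˢ S)) {u : E} (hu : u ∈ S) :
    extDerivWithin (fun z => ∫ r in a..b, f (r, z)) S u =
      ∫ r in a..b, extDerivWithin (fun z => f (r, z)) S u := by
  exact clm_fderivWithin_intervalIntegral (G := E [⋀^Fin k]→L[ℝ] ℝ) (G' := E [⋀^Fin (k + 1)]→L[ℝ] ℝ)
    hS hloc a b hf hu (ContinuousAlternatingMap.alternatizeUncurryFinCLM ℝ E ℝ (n := k))

/-- A 0-form has no contraction, so Cartan's formula loses its second term. Degree zero needs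
separate treatment throughout, since there are no forms of degree `-1`. -/
theorem fiberContraction_extDerivWithin_zero {S : Set E}
    {w : ℝ × E → (ℝ × E) [⋀^Fin 0]→L[ℝ] ℝ} {r : ℝ} {y : E} :
    fiberContraction E 0 (extDerivWithin w (univ ×ˢ S) (r, y)) =
      (fderivWithin ℝ w (univ ×ˢ S) (r, y) (1, 0)).compContinuousLinearMap
        (ContinuousLinearMap.inr ℝ ℝ E) := by
  ext v
  rw [extDerivWithin, fiberContraction_apply, ContinuousAlternatingMap.alternatizeUncurryFin_apply,
    Fin.sum_univ_one, Fin.val_zero, pow_zero, one_smul]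
  change (fderivWithin ℝ w (univ ×ˢ S) (r, y) (1, 0)) _ = (fderivWithin ℝ w (univ ×ˢ S) (r, y) (1, 0)) _
  congr 1

theorem integral_partial_fderivWithin {S : Set E} (hS : UniqueDiffOn ℝ S) (a b : ℝ)
    {w : ℝ × E → (ℝ × E) [⋀^Fin k]→L[ℝ] ℝ} (hw : ContDiffOn ℝ 1 w (univ ×ˢ S)) {y : E} (hy : y ∈ S) :
    IntervalIntegrable (fun r => (fderivWithin ℝ w (univ ×ˢ S) (r, y) (1, 0)).compContinuousLinearMap
        (ContinuousLinearMap.inr ℝ ℝ E)) MeasureTheory.volume a b ∧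
    ∫ r in a..b, (fderivWithin ℝ w (univ ×ˢ S) (r, y) (1, 0)).compContinuousLinearMap
        (ContinuousLinearMap.inr ℝ ℝ E) =
      (w (b, y)).compContinuousLinearMap (ContinuousLinearMap.inr ℝ ℝ E) -
        (w (a, y)).compContinuousLinearMap (ContinuousLinearMap.inr ℝ ℝ E) := by
  let R : ((ℝ × E) [⋀^Fin k]→L[ℝ] ℝ) →L[ℝ] E [⋀^Fin k]→L[ℝ] ℝ :=
    ContinuousAlternatingMap.compContinuousLinearMapCLM (ContinuousLinearMap.inr ℝ ℝ E)
  have hc : Continuous (fun r => R (fderivWithin ℝ w (univ ×ˢ S) (r, y) (1, 0))) :=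
    R.continuous.comp ((continuous_slice (hw.continuousOn_fderivWithin
      (uniqueDiffOn_univ.prod hS) le_rfl) hy).clm_apply continuous_const)
  have hi := hc.intervalIntegrable (μ := MeasureTheory.volume) a b
  refine ⟨hi, intervalIntegral.integral_eq_sub_of_hasDerivAt
    (f := fun r => R (w (r, y))) (fun r _ => ?_) hi⟩
  have h1 := (hw.differentiableOn (by simp) (r, y) ⟨mem_univ _, hy⟩).hasFDerivWithinAt
  have h2 : HasFDerivWithinAt (fun r : ℝ => (r, y)) (ContinuousLinearMap.inl ℝ ℝ E) univ r :=
    (hasFDerivAt_prodMk_left r y).hasFDerivWithinAt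
  have h3 := HasFDerivWithinAt.comp r h1 h2 (t := univ ×ˢ S) (fun z _ => mk_mem_prod (mem_univ z) hy)
  have h4 := R.hasFDerivAt.comp r (hasFDerivWithinAt_univ.1 h3)
  exact h4.hasDerivAt

theorem DForm.Smooth.modelValue_extD_cylinder [IsManifold I ∞ X]
    {w : DForm (𝓘(ℝ, ℝ).prod I) (ℝ × X) k} (hw : w.Smooth) (x : X) (r : ℝ) :
    w.extD.modelValue (r, x) = extDerivWithin (w.inChart (0, x)) (univ ×ˢ (extChartAt I x).target)
      (r, extChartAt I x x) := by
  have h1 : w.extD.inChart (0, x) (r, extChartAt I x x) = w.extD.modelValue (r, x) :=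
    DForm.inChart_self w.extD (r, x)
  have ht : (r, extChartAt I x x) ∈ (extChartAt (𝓘(ℝ, ℝ).prod I) ((0 : ℝ), x)).target := by
    rw [extChartAt_cylinder_target]
    exact ⟨mem_univ _, mem_extChartAt_target x⟩
  rw [← h1, hw.inChart_extD (0, x) ht, ← extChartAt_cylinder_target]
  exact (extDerivWithin_eq_of_mem_nhdsWithin (extChartAt_target_mem_nhdsWithin_of_mem ht)
    (extChartAt_target_subset_range _) _).symm

theorem cylinderSlice_eq [IsManifold I ∞ X] (w : DForm (𝓘(ℝ, ℝ).prod I) (ℝ × X) k) (x : X) (r : ℝ) :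
    cylinderSlice r w x = (w.inChart (0, x) (r, extChartAt I x x)).compContinuousLinearMap
      (ContinuousLinearMap.inr ℝ ℝ E) := by
  have h1 : w.inChart (0, x) (r, extChartAt I x x) = w.modelValue (r, x) :=
    DForm.inChart_self w (r, x)
  rw [h1]
  rfl

/-- The homotopy formula for integration along the cylinder. -/
theorem extD_cylinderIntegral [IsManifold I ∞ X] {w : DForm (𝓘(ℝ, ℝ).prod I) (ℝ × X) (k + 1)}
    (hw : w.Smooth) (a b : ℝ) :
    (cylinderIntegral I X a b w).extD + cylinderIntegral I X a b w.extD =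
      cylinderSlice b w - cylinderSlice a w := by
  funext x
  set S := (extChartAt I x).target with hSdef
  have hS : UniqueDiffOn ℝ S := uniqueDiffOn_extChartAt_target x
  have hx : extChartAt I x x ∈ S := mem_extChartAt_target x
  have hloc : ∀ u ∈ S, ∃ ε > 0, Convex ℝ (S ∩ Metric.ball u ε) := fun u hu =>
    convex_inter_ball_extChartAt_target x hu
  have hW : ContDiffOn ℝ 1 (w.inChart (0, x)) (univ ×ˢ S) := (hw.inChart_cylinder x).of_le (by simp)
  have hκ : ContDiffOn ℝ 1 (fun z => fiberContraction E k (w.inChart (0, x) z)) (univ ×ˢ S) :=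
    (fiberContraction E k).contDiff.comp_contDiffOn hW
  have h1 : (cylinderIntegral I X a b w).extD x = ∫ r in a..b,
      extDerivWithin (fun z => fiberContraction E k (w.inChart (0, x) (r, z))) S (extChartAt I x x) := by
    rw [← extDerivWithin_intervalIntegral hS hloc a b hκ hx]
    refine (DForm.extD_eq _ x).trans ?_
    rw [← extDerivWithin_eq_of_mem_nhdsWithin (extChartAt_target_mem_nhdsWithin_of_mem hx)
      (extChartAt_target_subset_range _)]
    exact extDerivWithin_congr' (fun y hy => inChart_cylinderIntegral hw a b x hy) hx
  have h2 : cylinderIntegral I X a b w.extD x = ∫ r in a..b, fiberContraction E (k + 1)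
      (extDerivWithin (w.inChart (0, x)) (univ ×ˢ S) (r, extChartAt I x x)) := by
    unfold cylinderIntegral
    simp_rw [hw.modelValue_extD_cylinder x]
    rfl
  obtain ⟨hi, h3⟩ := integral_partial_fderivWithin hS a b hW hx
  have h4 : ∀ r, fiberContraction E (k + 1)
      (extDerivWithin (w.inChart (0, x)) (univ ×ˢ S) (r, extChartAt I x x)) =
      (fderivWithin ℝ (w.inChart (0, x)) (univ ×ˢ S) (r, extChartAt I x x)
        (1, 0)).compContinuousLinearMap (ContinuousLinearMap.inr ℝ ℝ E) -
      extDerivWithin (fun z => fiberContraction E k (w.inChart (0, x) (r, z))) S (extChartAt I x x) :=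
    fun r => fiberContraction_extDerivWithin hS hx (hW.differentiableOn (by simp) _ ⟨mem_univ _, hx⟩)
  have hi2 : IntervalIntegrable (fun r => fiberContraction E (k + 1)
      (extDerivWithin (w.inChart (0, x)) (univ ×ˢ S) (r, extChartAt I x x)))
      MeasureTheory.volume a b := by
    have e : (fun r => fiberContraction E (k + 1) (extDerivWithin (w.inChart (0, x)) (univ ×ˢ S)
        (r, extChartAt I x x))) = fun r => fiberContraction E (k + 1) (w.extD.modelValue (r, x)) :=
      funext fun r => by rw [hw.modelValue_extD_cylinder x]
    rw [e]
    exact ((fiberContraction E (k + 1)).continuous.comp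
      (continuous_cylinder_fiber hw.extD x)).intervalIntegrable _ _
  -- Cartan's formula solved for the differential of the contraction; integrating its `∂_r` term
  -- produces the two boundary slices.
  have h5 : ∀ r, extDerivWithin (fun z => fiberContraction E k (w.inChart (0, x) (r, z))) S
      (extChartAt I x x) = (fderivWithin ℝ (w.inChart (0, x)) (univ ×ˢ S) (r, extChartAt I x x)
        (1, 0)).compContinuousLinearMap (ContinuousLinearMap.inr ℝ ℝ E) - fiberContraction E (k + 1)
      (extDerivWithin (w.inChart (0, x)) (univ ×ˢ S) (r, extChartAt I x x)) := fun r => by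
    rw [h4 r]; abel
  simp_rw [h5] at h1
  rw [intervalIntegral.integral_sub hi hi2, h3, ← h2, ← cylinderSlice_eq, ← cylinderSlice_eq] at h1
  change (cylinderIntegral I X a b w).extD x + cylinderIntegral I X a b w.extD x = _
  rw [h1]
  exact sub_add_cancel _ _

theorem cylinderIntegral_extD_zero [IsManifold I ∞ X] {w : DForm (𝓘(ℝ, ℝ).prod I) (ℝ × X) 0}
    (hw : w.Smooth) (a b : ℝ) :
    cylinderIntegral I X a b w.extD = cylinderSlice b w - cylinderSlice a w := by
  funext x
  have hx := mem_extChartAt_target (I := I) x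
  have hW := (hw.inChart_cylinder x).of_le (m := 1) (by simp)
  have h3 := (integral_partial_fderivWithin (uniqueDiffOn_extChartAt_target x) a b hW hx).2
  change _ = cylinderSlice b w x - cylinderSlice a w x
  rw [cylinderSlice_eq, cylinderSlice_eq]
  refine Eq.trans ?_ h3
  unfold cylinderIntegral
  simp_rw [hw.modelValue_extD_cylinder x, fiberContraction_extDerivWithin_zero]
  rfl

end FiberHomotopy

/-! ### Differentials as maps between fixed model spaces. -/

noncomputable section ModelDerivative
variable {E E' : Type} [NormedAddCommGroup E] [NormedSpace ℝ E] {H H' : Type} [TopologicalSpace H]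
  [NormedAddCommGroup E'] [NormedSpace ℝ E'] [TopologicalSpace H']
  (J : ModelWithCorners ℝ E' H') (I : ModelWithCorners ℝ E H)
  {X Y : Type*} [TopologicalSpace X] [ChartedSpace H X] [TopologicalSpace Y] [ChartedSpace H' Y]

/-- The differential of a map, on the model spaces. -/
def modelDeriv (f : Y → X) (y : Y) : E' →L[ℝ] E := mfderiv J I f y

variable {E'' : Type} [NormedAddCommGroup E''] [NormedSpace ℝ E''] {H'' : Type}
  [TopologicalSpace H''] {L : ModelWithCorners ℝ E'' H''} {Z : Type*} [TopologicalSpace Z]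
  [ChartedSpace H'' Z]

variable {J I} in
-- The chain rule accepts an intermediate point equal to `g z` only propositionally, such as `p` in
-- place of `0 +ᵥ p`.
theorem modelDeriv_comp {f : Y → X} {g : Z → Y} {z : Z} {y : Y} (hf : MDifferentiableAt J I f y)
    (hg : MDifferentiableAt L J g z) (h : g z = y) :
    modelDeriv L I (f ∘ g) z = (modelDeriv J I f y).comp (modelDeriv L J g z) := by
  subst h
  exact mfderiv_comp z hf hg

theorem modelDeriv_id (x : X) : modelDeriv I I (id : X → X) x = ContinuousLinearMap.id ℝ E :=
  mfderiv_id

end ModelDerivative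

/-! ### Integration of forms along segments of orbits. -/

noncomputable section FlowIntegral
variable {E : Type} [NormedAddCommGroup E] [NormedSpace ℝ E] {H : Type} [TopologicalSpace H]
  (I : ModelWithCorners ℝ E H) {M : Type*} [TopologicalSpace M] [ChartedSpace H M] {k : ℕ}
  [AddAction ℝ M]

/-- The differential of a translation, on the model space. -/
def flowDeriv (s : ℝ) (p : M) : E →L[ℝ] E := modelDeriv I I (fun q : M => s +ᵥ q) p

/-- The velocity of the action, on the model space. -/
def velocity (p : M) : E := modelDeriv 𝓘(ℝ, ℝ) I (fun r : ℝ => r +ᵥ p) 0 1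

section
variable [ContMDiffVAdd 𝓘(ℝ, ℝ) I ∞ ℝ M]

theorem contMDiff_action : ContMDiff (𝓘(ℝ, ℝ).prod I) I ∞ (fun z : ℝ × M => z.1 +ᵥ z.2) :=
  contMDiff_vadd (I := 𝓘(ℝ, ℝ)) (I' := I) (n := ∞)

theorem contMDiff_translation (s : ℝ) : ContMDiff I I ∞ (fun q : M => s +ᵥ q) :=
  (contMDiff_action I).comp (contMDiff_const.prodMk contMDiff_id)

theorem contMDiff_orbit (p : M) : ContMDiff 𝓘(ℝ, ℝ) I ∞ (fun r : ℝ => r +ᵥ p) :=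
  (contMDiff_action I).comp (contMDiff_id.prodMk contMDiff_const)

theorem mdifferentiableAt_translation (s : ℝ) (p : M) : MDifferentiableAt I I (fun q : M => s +ᵥ q) p :=
  (contMDiff_translation I s).mdifferentiable (by simp) p

theorem mdifferentiableAt_orbit (p : M) (s : ℝ) :
    MDifferentiableAt 𝓘(ℝ, ℝ) I (fun r : ℝ => r +ᵥ p) s :=
  (contMDiff_orbit I p).mdifferentiable (by simp) s

theorem modelDeriv_orbit (p : M) (s : ℝ) :
    modelDeriv 𝓘(ℝ, ℝ) I (fun r : ℝ => r +ᵥ p) s 1 = velocity I (s +ᵥ p) := by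
  have e : (fun r : ℝ => r +ᵥ p) = (fun r' : ℝ => r' +ᵥ (s +ᵥ p)) ∘ (fun r : ℝ => r - s) := by
    funext r
    simp [vadd_vadd]
  have hd : HasFDerivAt (fun r : ℝ => r - s) (ContinuousLinearMap.id ℝ ℝ) s :=
    (hasFDerivAt_id s).sub_const s
  have h3 : modelDeriv 𝓘(ℝ, ℝ) 𝓘(ℝ, ℝ) (fun r : ℝ => r - s) s = ContinuousLinearMap.id ℝ ℝ :=
    hd.hasMFDerivAt.mfderiv
  rw [e, modelDeriv_comp (mdifferentiableAt_orbit I (s +ᵥ p) 0) hd.hasMFDerivAt.mdifferentiableAt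
    (sub_self s), h3]
  rfl

/-- Translations commute with one another, so the generator is invariant under its own flow. -/
theorem flowDeriv_velocity (s : ℝ) (p : M) :
    flowDeriv I s p (velocity I p) = velocity I (s +ᵥ p) := by
  have e : (fun r : ℝ => r +ᵥ (s +ᵥ p)) = (fun q : M => s +ᵥ q) ∘ (fun r : ℝ => r +ᵥ p) := by
    funext r
    simp [vadd_vadd, add_comm]
  unfold velocity
  rw [e, modelDeriv_comp (mdifferentiableAt_translation I s p) (mdifferentiableAt_orbit I p 0)
    (zero_vadd ℝ p)]
  rfl

theorem flowDeriv_add (r s : ℝ) (p : M) :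
    flowDeriv I (r + s) p = (flowDeriv I r (s +ᵥ p)).comp (flowDeriv I s p) := by
  have e : (fun q : M => (r + s) +ᵥ q) = (fun q : M => r +ᵥ q) ∘ (fun q : M => s +ᵥ q) := by
    funext q
    simp [vadd_vadd]
  unfold flowDeriv
  rw [e]
  exact modelDeriv_comp (mdifferentiableAt_translation I r (s +ᵥ p))
    (mdifferentiableAt_translation I s p) rfl

theorem modelDeriv_action (r : ℝ) (p : M) (c : ℝ) (w : E) :
    modelDeriv (𝓘(ℝ, ℝ).prod I) I (fun z : ℝ × M => z.1 +ᵥ z.2) (r, p) (c, w) =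
      c • velocity I (r +ᵥ p) + flowDeriv I r p w := by
  have h := mfderiv_prod_eq_add_apply (p := (r, p)) (v := (c, w))
    ((contMDiff_action I (M := M)).mdifferentiable (by simp) (r, p))
  have h1 : c • velocity I (r +ᵥ p) = modelDeriv 𝓘(ℝ, ℝ) I (fun r : ℝ => r +ᵥ p) r c := by
    rw [← modelDeriv_orbit, ← map_smul, smul_eq_mul, mul_one]
  rw [h1]
  exact h

end

variable {I}

/-- The pullback of a form along the action map. -/
def actionPullback (φ : DForm I M k) : DForm (𝓘(ℝ, ℝ).prod I) (ℝ × M) k :=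
  pullbackForm I (𝓘(ℝ, ℝ).prod I) (fun z : ℝ × M => z.1 +ᵥ z.2) k φ

/-- The integrand of the integration along orbits. -/
def orbitIntegrand (φ : DForm I M (k + 1)) (r : ℝ) (p : M) : E [⋀^Fin k]→L[ℝ] ℝ :=
  fiberContraction E k ((actionPullback φ).modelValue (r, p))

variable [ContMDiffVAdd 𝓘(ℝ, ℝ) I ∞ ℝ M]

theorem orbitIntegrand_apply (φ : DForm I M (k + 1)) (r : ℝ) (p : M) (w : Fin k → E) :
    orbitIntegrand φ r p w = φ.modelValue (r +ᵥ p)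
      (Fin.cons (velocity I (r +ᵥ p)) (fun i => flowDeriv I r p (w i)) : Fin (k + 1) → E) := by
  rw [orbitIntegrand, fiberContraction_apply]
  change φ.modelValue (r +ᵥ p) _ = _
  congr 1
  funext i
  refine Fin.cases ?_ (fun j => ?_) i
  · refine (modelDeriv_action I r p 1 0).trans ?_
    rw [one_smul, map_zero, add_zero]
    rfl
  · refine (modelDeriv_action I r p 0 (w j)).trans ?_
    rw [zero_smul, zero_add]
    rfl

theorem orbitIntegrand_eq_zero {φ : DForm I M (k + 1)} {r : ℝ} {p : M} (h : r +ᵥ p ∉ φ.supp) :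
    orbitIntegrand φ r p = 0 := by
  ext w
  have h0 : φ.modelValue (r +ᵥ p) = 0 := DForm.eq_zero_of_notMem_supp h
  rw [orbitIntegrand_apply, h0]
  rfl

theorem cylinderSlice_actionPullback (φ : DForm I M k) (s : ℝ) :
    cylinderSlice s (actionPullback φ) = pullbackForm I I (fun q : M => s +ᵥ q) k φ := by
  funext p
  ext w
  change φ.modelValue (s +ᵥ p) _ = φ.modelValue (s +ᵥ p) _
  congr 1
  funext i
  refine (modelDeriv_action I s p 0 (w i)).trans ?_
  rw [zero_smul, zero_add]
  rfl

/-- The integral of a form along the orbit segments `[a, b] +ᵥ p`. -/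
def flowIntegral (a b : ℝ) (φ : DForm I M (k + 1)) : DForm I M k :=
  cylinderIntegral I M a b (actionPullback φ)

/-- The integral of a form along the full orbits. -/
def orbitIntegral (φ : DForm I M (k + 1)) : DForm I M k :=
  fun p => (∫ r, orbitIntegrand φ r p : E [⋀^Fin k]→L[ℝ] ℝ)

/-- The integral of a form along the backward half orbits. -/
def halfOrbitIntegral (φ : DForm I M (k + 1)) : DForm I M k :=
  fun p => (∫ r in Iic 0, orbitIntegrand φ r p : E [⋀^Fin k]→L[ℝ] ℝ)

/-- Compact sets are moved off a compact set by large translations. -/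
theorem exists_forall_vadd_notMem {M : Type*} [TopologicalSpace M] [AddAction ℝ M] [ProperVAdd ℝ M]
    {K L : Set M} (hK : IsCompact K) (hL : IsCompact L) :
    ∃ R > 0, ∀ r : ℝ, R ≤ |r| → ∀ p ∈ K, r +ᵥ p ∉ L := by
  obtain ⟨C, hC⟩ := (ProperVAdd.isCompact_setOfPred_inter_nonempty (G := ℝ) hK hL).isBounded.exists_norm_le
  refine ⟨|C| + 1, by positivity, fun r hr p hp hrp => ?_⟩
  have h1 : ‖r‖ ≤ C := hC r ⟨r +ᵥ p, ⟨p, hp, rfl⟩, hrp⟩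
  rw [Real.norm_eq_abs] at h1
  linarith [le_abs_self C]

/-- A compact neighbourhood of `p` leaves `K` after a bounded time, so the improper integrals are
locally integrals over fixed intervals. One `R` serves all forms supported in `K`, in particular `φ`
and `dφ` together. -/
theorem orbitIntegral_eventuallyEq [ProperVAdd ℝ M] [LocallyCompactSpace M] {K : Set M}
    (hK : IsCompact K) (p : M) : ∃ R > 0, (∀ r : ℝ, R ≤ |r| → ∀ᶠ q in 𝓝 p, r +ᵥ q ∉ K) ∧
      ∀ {k : ℕ} (φ : DForm I M (k + 1)), φ.supp ⊆ K →
      (∀ᶠ q in 𝓝 p, orbitIntegral φ q = flowIntegral (-R) R φ q) ∧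
      (∀ᶠ q in 𝓝 p, halfOrbitIntegral φ q = flowIntegral (-R) 0 φ q) := by
  obtain ⟨C, hC, hCp⟩ := exists_compact_mem_nhds p
  obtain ⟨R, hR, h⟩ := exists_forall_vadd_notMem hC hK
  refine ⟨R, hR, fun r hr => by filter_upwards [hCp] with q hq using h r hr q hq, fun φ hφ => ?_⟩
  have h0 : ∀ q ∈ C, ∀ r, r ∉ Ioc (-R) R → orbitIntegrand φ r q = 0 := fun q hq r hr =>
    orbitIntegrand_eq_zero fun hs => h r (by
      rw [mem_Ioc, not_and_or, not_lt, not_le] at hr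
      rcases hr with hr | hr
      · rw [abs_of_neg (by linarith)]; linarith
      · exact hr.le.trans (le_abs_self r)) q hq (hφ hs)
  constructor
  · filter_upwards [hCp] with q hq
    change (∫ r, orbitIntegrand φ r q) = ∫ r in (-R)..R, orbitIntegrand φ r q
    rw [intervalIntegral.integral_of_le (by linarith)]
    exact (MeasureTheory.setIntegral_eq_integral_of_forall_compl_eq_zero (h0 q hq)).symm
  · filter_upwards [hCp] with q hq
    change (∫ r in Iic 0, orbitIntegrand φ r q) = ∫ r in (-R)..0, orbitIntegrand φ r q
    rw [intervalIntegral.integral_of_le (by linarith)]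
    refine MeasureTheory.setIntegral_eq_of_subset_of_forall_sdiff_eq_zero measurableSet_Iic
      (fun r hr => hr.2) fun r hr => h0 q hq r fun hr' => hr.2 ⟨hr'.1, hr.1⟩

section
variable [IsManifold I ∞ M]

theorem DForm.Smooth.actionPullback {φ : DForm I M k} (hφ : φ.Smooth) :
    (actionPullback φ).Smooth :=
  DForm.smooth_iff_smoothAt.2 fun z => (hφ.smoothAt _).pullbackForm (contMDiff_action I z)

theorem DForm.Smooth.extD_actionPullback {φ : DForm I M k} (hφ : φ.Smooth) :
    (_root_.actionPullback φ).extD = _root_.actionPullback φ.extD :=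
  funext fun z => extD_pullbackForm (hφ.smoothAt _) (contMDiff_action I z)

theorem continuous_orbitIntegrand {φ : DForm I M (k + 1)} (hφ : φ.Smooth) (p : M) :
    Continuous fun r => orbitIntegrand φ r p :=
  (fiberContraction E k).continuous.comp (continuous_cylinder_fiber hφ.actionPullback p)

theorem smooth_flowIntegral (a b : ℝ) {φ : DForm I M (k + 1)} (hφ : φ.Smooth) :
    (flowIntegral a b φ).Smooth := smooth_cylinderIntegral hφ.actionPullback a b

/-- The cylinder formula applied to the pullback by the action, whose slices are the pullbacks by
translations. -/
theorem extD_flowIntegral (a b : ℝ) {φ : DForm I M (k + 1)} (hφ : φ.Smooth) :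
    (flowIntegral a b φ).extD + flowIntegral a b φ.extD =
      pullbackForm I I (fun q : M => b +ᵥ q) (k + 1) φ -
        pullbackForm I I (fun q : M => a +ᵥ q) (k + 1) φ := by
  rw [← cylinderSlice_actionPullback, ← cylinderSlice_actionPullback,
    ← extD_cylinderIntegral hφ.actionPullback, hφ.extD_actionPullback]
  rfl

theorem flowIntegral_extD_zero (a b : ℝ) {φ : DForm I M 0} (hφ : φ.Smooth) :
    flowIntegral a b φ.extD = pullbackForm I I (fun q : M => b +ᵥ q) 0 φ -
        pullbackForm I I (fun q : M => a +ᵥ q) 0 φ := by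
  rw [← cylinderSlice_actionPullback, ← cylinderSlice_actionPullback,
    ← cylinderIntegral_extD_zero hφ.actionPullback, hφ.extD_actionPullback]
  rfl

end

end FlowIntegral

/-! ### Integration along full and half orbits of a proper action. -/

noncomputable section OrbitIntegral
variable {E : Type} [NormedAddCommGroup E] [NormedSpace ℝ E] {H : Type} [TopologicalSpace H]
  {I : ModelWithCorners ℝ E H} {M : Type*} [TopologicalSpace M] [ChartedSpace H M] {k : ℕ}
  [AddAction ℝ M] [ContMDiffVAdd 𝓘(ℝ, ℝ) I ∞ ℝ M]

theorem pullbackForm_zero_vadd (φ : DForm I M k) :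
    pullbackForm I I (fun q : M => (0 : ℝ) +ᵥ q) k φ = φ := by
  have e : (fun q : M => (0 : ℝ) +ᵥ q) = id := funext fun q => zero_vadd ℝ q
  rw [e, pullbackForm_id]

theorem pullbackForm_vadd_eq_zero {φ : DForm I M k} {s : ℝ} {p : M} (h : s +ᵥ p ∉ φ.supp) :
    pullbackForm I I (fun q : M => s +ᵥ q) k φ p = 0 := by
  ext w
  have h0 : φ (s +ᵥ p) = 0 := DForm.eq_zero_of_notMem_supp h
  rw [pullbackForm_apply, h0]
  rfl

/-- By invariance of the generator, `φ` receives the velocity at `r +ᵥ p` in two slots. Consequently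
all integrals along orbits are horizontal. -/
theorem orbitIntegrand_velocity (φ : DForm I M (k + 1)) (r : ℝ) (p : M) {w : Fin k → E} {i : Fin k}
    (h : w i = velocity I p) : orbitIntegrand φ r p w = 0 := by
  rw [orbitIntegrand_apply]
  refine (φ.modelValue (r +ᵥ p)).map_eq_zero_of_eq _ (i := 0) (j := i.succ) ?_ (Fin.succ_ne_zero i).symm
  simp only [Fin.cons_zero, Fin.cons_succ, h, flowDeriv_velocity]

section Proper
variable [IsManifold I ∞ M] [ProperVAdd ℝ M]

theorem hasCompactSupport_orbitIntegrand {φ : DForm I M (k + 1)} (hc : IsCompact φ.supp) (p : M) :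
    HasCompactSupport fun r => orbitIntegrand φ r p := by
  obtain ⟨R, hR, h⟩ := exists_forall_vadd_notMem isCompact_singleton hc
  refine HasCompactSupport.intro (K := Icc (-R) R) isCompact_Icc fun r hr => ?_
  refine orbitIntegrand_eq_zero (h r ?_ p rfl)
  by_contra hlt
  exact hr (abs_le.1 (not_le.1 hlt).le)

theorem integrable_orbitIntegrand {φ : DForm I M (k + 1)} (hφ : φ.Smooth) (hc : IsCompact φ.supp)
    (p : M) : MeasureTheory.Integrable fun r => orbitIntegrand φ r p :=
  (continuous_orbitIntegrand hφ p).integrable_of_hasCompactSupport (hasCompactSupport_orbitIntegrand hc p)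

theorem orbitIntegral_apply {φ : DForm I M (k + 1)} (hφ : φ.Smooth) (hc : IsCompact φ.supp)
    (p : M) (w : Fin k → E) :
    (orbitIntegral φ).modelValue p w = ∫ r : ℝ, φ.modelValue (r +ᵥ p)
      (Fin.cons (velocity I (r +ᵥ p)) (fun i => flowDeriv I r p (w i)) : Fin (k + 1) → E) := by
  have h := (ContinuousAlternatingMap.apply ℝ E ℝ w).integral_comp_comm
    (integrable_orbitIntegrand hφ hc p)
  refine h.symm.trans (MeasureTheory.integral_congr_ae (Eventually.of_forall fun r => ?_))
  exact orbitIntegrand_apply φ r p w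

theorem halfOrbitIntegral_apply {φ : DForm I M (k + 1)} (hφ : φ.Smooth) (hc : IsCompact φ.supp)
    (p : M) (w : Fin k → E) :
    (halfOrbitIntegral φ).modelValue p w = ∫ r in Iic (0 : ℝ), orbitIntegrand φ r p w :=
  ((ContinuousAlternatingMap.apply ℝ E ℝ w).integral_comp_comm
    (integrable_orbitIntegrand hφ hc p).integrableOn).symm

/-- Invariance of Lebesgue measure under `r ↦ r + s`. -/
theorem orbitIntegral_vadd {φ : DForm I M (k + 1)} (hφ : φ.Smooth) (hc : IsCompact φ.supp)
    (s : ℝ) (p : M) (w : Fin k → E) :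
    (orbitIntegral φ).modelValue (s +ᵥ p) (fun i => flowDeriv I s p (w i)) =
      (orbitIntegral φ).modelValue p w := by
  rw [orbitIntegral_apply hφ hc, orbitIntegral_apply hφ hc]
  rw [← MeasureTheory.integral_add_right_eq_self (fun r : ℝ => φ.modelValue (r +ᵥ p) _) s]
  congr 1
  funext r
  rw [add_vadd, flowDeriv_add]
  rfl

theorem orbitIntegral_velocity {φ : DForm I M (k + 1)} (hφ : φ.Smooth) (hc : IsCompact φ.supp)
    (p : M) {w : Fin k → E} {i : Fin k} (h : w i = velocity I p) :
    (orbitIntegral φ).modelValue p w = 0 := by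
  rw [orbitIntegral_apply hφ hc]
  simp_rw [← orbitIntegrand_apply, orbitIntegrand_velocity φ _ p h, MeasureTheory.integral_zero]

theorem halfOrbitIntegral_velocity {φ : DForm I M (k + 1)} (hφ : φ.Smooth) (hc : IsCompact φ.supp)
    (p : M) {w : Fin k → E} {i : Fin k} (h : w i = velocity I p) :
    (halfOrbitIntegral φ).modelValue p w = 0 := by
  rw [halfOrbitIntegral_apply hφ hc]
  simp_rw [orbitIntegrand_velocity φ _ p h, MeasureTheory.integral_zero]

theorem orbitIntegral_add {φ ψ : DForm I M (k + 1)} (hφ : φ.Smooth) (hc : IsCompact φ.supp)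
    (hψ : ψ.Smooth) (hc' : IsCompact ψ.supp) :
    orbitIntegral (φ + ψ) = orbitIntegral φ + orbitIntegral ψ := by
  funext p
  exact MeasureTheory.integral_add (integrable_orbitIntegrand hφ hc p)
    (integrable_orbitIntegrand hψ hc' p)

theorem halfOrbitIntegral_add {φ ψ : DForm I M (k + 1)} (hφ : φ.Smooth) (hc : IsCompact φ.supp)
    (hψ : ψ.Smooth) (hc' : IsCompact ψ.supp) :
    halfOrbitIntegral (φ + ψ) = halfOrbitIntegral φ + halfOrbitIntegral ψ := by
  funext p
  exact MeasureTheory.integral_add (integrable_orbitIntegrand hφ hc p).integrableOn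
    (integrable_orbitIntegrand hψ hc' p).integrableOn

theorem orbitIntegral_smul (c : ℝ) (φ : DForm I M (k + 1)) :
    orbitIntegral (c • φ) = c • orbitIntegral φ := by
  funext p
  exact MeasureTheory.integral_smul c (fun r => orbitIntegrand φ r p)

theorem halfOrbitIntegral_smul (c : ℝ) (φ : DForm I M (k + 1)) :
    halfOrbitIntegral (c • φ) = c • halfOrbitIntegral φ := by
  funext p
  exact MeasureTheory.integral_smul c (fun r => orbitIntegrand φ r p)

theorem orbitIntegral_eq_zero {φ : DForm I M (k + 1)} {p : M} (h : ∀ r : ℝ, r +ᵥ p ∉ φ.supp) :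
    orbitIntegral φ p = 0 := by
  change (∫ r, orbitIntegrand φ r p) = 0
  simp_rw [orbitIntegrand_eq_zero (h _), MeasureTheory.integral_zero]

theorem halfOrbitIntegral_eq_zero {φ : DForm I M (k + 1)} {p : M}
    (h : ∀ r : ℝ, r ≤ 0 → r +ᵥ p ∉ φ.supp) : halfOrbitIntegral φ p = 0 := by
  change (∫ r in Iic 0, orbitIntegrand φ r p) = 0
  exact MeasureTheory.setIntegral_eq_zero_of_forall_eq_zero fun r hr => orbitIntegrand_eq_zero (h r hr)

/-- Where the backward orbit contains the whole intersection of the orbit with the support, the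
half orbit integral is the orbit integral. -/
theorem halfOrbitIntegral_eq_orbitIntegral {φ : DForm I M (k + 1)} {p : M}
    (h : ∀ r : ℝ, 0 < r → r +ᵥ p ∉ φ.supp) : halfOrbitIntegral φ p = orbitIntegral φ p := by
  change (∫ r in Iic 0, orbitIntegrand φ r p) = ∫ r, orbitIntegrand φ r p
  exact MeasureTheory.setIntegral_eq_integral_of_forall_compl_eq_zero fun r hr =>
    orbitIntegrand_eq_zero (h r (not_le.1 hr))

variable [LocallyCompactSpace M]

theorem smooth_orbitIntegral {φ : DForm I M (k + 1)} (hφ : φ.Smooth) (hc : IsCompact φ.supp) :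
    (orbitIntegral φ).Smooth := DForm.smooth_iff_smoothAt.2 fun p => by
  obtain ⟨R, -, -, h⟩ := orbitIntegral_eventuallyEq (I := I) hc p
  exact ((smooth_flowIntegral (-R) R hφ).smoothAt p).congr (h φ le_rfl).1

theorem smooth_halfOrbitIntegral {φ : DForm I M (k + 1)} (hφ : φ.Smooth) (hc : IsCompact φ.supp) :
    (halfOrbitIntegral φ).Smooth := DForm.smooth_iff_smoothAt.2 fun p => by
  obtain ⟨R, -, -, h⟩ := orbitIntegral_eventuallyEq (I := I) hc p
  exact ((smooth_flowIntegral (-R) 0 hφ).smoothAt p).congr (h φ le_rfl).2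

/-- Both boundary terms of the homotopy formula on `[-R, R]` vanish, since translations by `±R`
leave the support. -/
theorem extD_orbitIntegral {φ : DForm I M (k + 1)} (hφ : φ.Smooth) (hc : IsCompact φ.supp) :
    (orbitIntegral φ).extD + orbitIntegral φ.extD = 0 := by
  funext p
  obtain ⟨R, hR, h0, h⟩ := orbitIntegral_eventuallyEq (I := I) hc p
  have h1 := congrFun (extD_flowIntegral (-R) R hφ) p
  change (orbitIntegral φ).extD p + orbitIntegral φ.extD p = 0
  rw [DForm.extD_congr (h φ le_rfl).1, (h φ.extD φ.supp_extD).1.self_of_nhds]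
  refine h1.trans ?_
  change pullbackForm I I _ _ _ p - pullbackForm I I _ _ _ p = 0
  rw [pullbackForm_vadd_eq_zero (h0 R (le_abs_self R)).self_of_nhds,
    pullbackForm_vadd_eq_zero (h0 (-R) (by rw [abs_neg]; exact le_abs_self R)).self_of_nhds, sub_zero]

theorem orbitIntegral_extD_zero {φ : DForm I M 0} (hφ : φ.Smooth) (hc : IsCompact φ.supp) :
    orbitIntegral φ.extD = 0 := by
  funext p
  obtain ⟨R, hR, h0, h⟩ := orbitIntegral_eventuallyEq (I := I) hc p
  have h1 := congrFun (flowIntegral_extD_zero (-R) R hφ) p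
  rw [(h φ.extD φ.supp_extD).1.self_of_nhds]
  refine h1.trans ?_
  change pullbackForm I I _ _ _ p - pullbackForm I I _ _ _ p = 0
  rw [pullbackForm_vadd_eq_zero (h0 R (le_abs_self R)).self_of_nhds,
    pullbackForm_vadd_eq_zero (h0 (-R) (by rw [abs_neg]; exact le_abs_self R)).self_of_nhds, sub_zero]

/-- Of the boundary terms at `-R` and `0` only the second survives, and it is `φ`. Backward
integration would thus be a contracting homotopy, were it not for its supports, which need not be
compact in the forward direction. -/
theorem extD_halfOrbitIntegral {φ : DForm I M (k + 1)} (hφ : φ.Smooth) (hc : IsCompact φ.supp) :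
    (halfOrbitIntegral φ).extD + halfOrbitIntegral φ.extD = φ := by
  funext p
  obtain ⟨R, hR, h0, h⟩ := orbitIntegral_eventuallyEq (I := I) hc p
  have h1 := congrFun (extD_flowIntegral (-R) 0 hφ) p
  change (halfOrbitIntegral φ).extD p + halfOrbitIntegral φ.extD p = φ p
  rw [DForm.extD_congr (h φ le_rfl).2, (h φ.extD φ.supp_extD).2.self_of_nhds]
  refine h1.trans ?_
  change pullbackForm I I _ _ _ p - pullbackForm I I _ _ _ p = φ p
  rw [pullbackForm_vadd_eq_zero (h0 (-R) (by rw [abs_neg]; exact le_abs_self R)).self_of_nhds,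
    sub_zero, pullbackForm_zero_vadd]

theorem halfOrbitIntegral_extD_zero {φ : DForm I M 0} (hφ : φ.Smooth) (hc : IsCompact φ.supp) :
    halfOrbitIntegral φ.extD = φ := by
  funext p
  obtain ⟨R, hR, h0, h⟩ := orbitIntegral_eventuallyEq (I := I) hc p
  have h1 := congrFun (flowIntegral_extD_zero (-R) 0 hφ) p
  rw [(h φ.extD φ.supp_extD).2.self_of_nhds]
  refine h1.trans ?_
  change pullbackForm I I _ _ _ p - pullbackForm I I _ _ _ p = φ p
  rw [pullbackForm_vadd_eq_zero (h0 (-R) (by rw [abs_neg]; exact le_abs_self R)).self_of_nhds,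
    sub_zero, pullbackForm_zero_vadd]

end Proper
end OrbitIntegral


/-! ### Freeness of proper actions and hitting times of transverse hypersurfaces. -/

noncomputable section HittingTime
variable {E : Type} [NormedAddCommGroup E] [NormedSpace ℝ E] {H : Type} [TopologicalSpace H]
  (I : ModelWithCorners ℝ E H) {M : Type*} [TopologicalSpace M] [ChartedSpace H M]
  [AddAction ℝ M] 

/-- If `s ≠ 0` fixed `p`, so would all its multiples, although large translations move `p` off the
compact set `{p}`. -/
theorem eq_zero_of_vadd_eq [T2Space M] [ProperVAdd ℝ M] {s : ℝ} {p : M} (h : s +ᵥ p = p) : s = 0 := by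
  by_contra hs
  obtain ⟨R, -, hR⟩ := exists_forall_vadd_notMem (isCompact_singleton (x := p)) (isCompact_singleton (x := p))
  have hn : ∀ n : ℕ, ((n : ℝ) * s) +ᵥ p = p := by
    intro n
    induction n with
    | zero => simp
    | succ n ih =>
      rw [Nat.cast_succ, add_mul, one_mul, ← vadd_vadd, h, ih]
  obtain ⟨n, hn'⟩ := exists_nat_gt (R / |s|)
  refine hR ((n : ℝ) * s) ?_ p rfl (hn n)
  rw [abs_mul, Nat.abs_cast]
  exact ((div_lt_iff₀ (abs_pos.2 hs)).1 hn').le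

/-- The map `(s, q) ↦ (s +ᵥ q, q)` is closed, so the image of `{δ ≤ |s|}` is closed, and by freeness
it misses `(p, p)`. This excludes late returns to a slice. -/
theorem exists_isOpen_forall_vadd_mem_lt [T2Space M] [ProperVAdd ℝ M] (p : M) {δ : ℝ} (hδ : 0 < δ) :
    ∃ U : Set M, IsOpen U ∧ p ∈ U ∧ ∀ (s : ℝ) (q : M), q ∈ U → s +ᵥ q ∈ U → |s| < δ := by
  have hc : IsClosedMap fun z : ℝ × M => (z.1 +ᵥ z.2, z.2) :=
    (ProperVAdd.isProperMap_vadd_pair (G := ℝ) (X := M)).isClosedMap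
  have hC : IsClosed {z : ℝ × M | δ ≤ |z.1|} := isClosed_le continuous_const (by fun_prop)
  have ho := (hc _ hC).isOpen_compl
  have hp : (p, p) ∈ ((fun z : ℝ × M => (z.1 +ᵥ z.2, z.2)) '' {z : ℝ × M | δ ≤ |z.1|})ᶜ := by
    rintro ⟨⟨s, q⟩, hs, he⟩
    obtain ⟨h1, h2⟩ := Prod.mk.inj he
    subst h2
    have hs0 : s = 0 := eq_zero_of_vadd_eq h1
    have hs' : δ ≤ |s| := hs
    rw [hs0, abs_zero] at hs'
    linarith
  obtain ⟨U₁, U₂, h1, h2, hp1, hp2, hU⟩ := isOpen_prod_iff.1 ho p p hp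
  refine ⟨U₁ ∩ U₂, h1.inter h2, ⟨hp1, hp2⟩, fun s q hq hsq => ?_⟩
  by_contra hcon
  exact hU (mk_mem_prod hsq.1 hq.2) ⟨(s, q), not_lt.1 hcon, rfl⟩

variable [ContMDiffVAdd 𝓘(ℝ, ℝ) I ∞ ℝ M] [IsManifold I ∞ M]

theorem hasDerivAt_comp_vadd {F : Type} [NormedAddCommGroup F] [NormedSpace ℝ F] {f : M → F} {p : M}
    {s : ℝ} (hf : MDifferentiableAt I 𝓘(ℝ, F) f (s +ᵥ p)) :
    HasDerivAt (fun r : ℝ => f (r +ᵥ p)) (modelDeriv I 𝓘(ℝ, F) f (s +ᵥ p) (velocity I (s +ᵥ p))) s := by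
  have h := hf.hasMFDerivAt.comp s (mdifferentiableAt_orbit I p s).hasMFDerivAt
  have h' : HasFDerivAt (fun r : ℝ => f (r +ᵥ p)) ((modelDeriv I 𝓘(ℝ, F) f (s +ᵥ p)).comp
    (modelDeriv 𝓘(ℝ, ℝ) I (fun r : ℝ => r +ᵥ p) s)) s := h.hasFDerivAt
  rw [← modelDeriv_orbit]
  exact h'.hasDerivAt

/-- A zero of the invariant generator makes it vanish along the whole orbit. The orbit is then
constant for short times, contradicting freeness. -/
theorem velocity_ne_zero [T2Space M] [ProperVAdd ℝ M] (p : M) : velocity I p ≠ 0 := by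
  have : IsManifold I 1 M := IsManifold.of_le (n := ∞) (by simp)
  intro h0
  have hs : ∀ s : ℝ, velocity I (s +ᵥ p) = 0 := fun s => by
    rw [← flowDeriv_velocity, h0, map_zero]
  have hcont : Continuous fun r : ℝ => r +ᵥ p := (contMDiff_orbit I p).continuous
  have hm : (fun r : ℝ => r +ᵥ p) ⁻¹' (extChartAt I p).source ∈ 𝓝 (0 : ℝ) :=
    hcont.continuousAt.preimage_mem_nhds (by
      rw [zero_vadd]; exact extChartAt_source_mem_nhds (I := I) p)
  obtain ⟨ε, hε, hb⟩ := Metric.mem_nhds_iff.1 hm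
  have hd : ∀ s ∈ Metric.ball (0 : ℝ) ε, HasDerivAt (fun r : ℝ => extChartAt I p (r +ᵥ p)) 0 s := by
    intro s hs'
    have := hasDerivAt_comp_vadd I (mdifferentiableAt_extChartAt (I := I) (x := p) (y := s +ᵥ p)
      (by simpa using hb hs'))
    rwa [hs, map_zero] at this
  have hc := (convex_ball (0 : ℝ) ε).is_const_of_fderivWithin_eq_zero (𝕜 := ℝ)
    (f := fun r : ℝ => extChartAt I p (r +ᵥ p))
    (fun s hs' => (hd s hs').differentiableAt.differentiableWithinAt) (fun s hs' => by
      rw [fderivWithin_of_isOpen Metric.isOpen_ball hs', (hd s hs').hasFDerivAt.fderiv]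
      ext; simp) (x := 0) (y := ε / 2) (Metric.mem_ball_self hε)
      (by simp [abs_of_pos hε, hε])
  have he := (extChartAt I p).injOn (hb (Metric.mem_ball_self hε))
    (hb (by simp [abs_of_pos hε, hε] : ε / 2 ∈ Metric.ball (0 : ℝ) ε)) hc
  change (0 : ℝ) +ᵥ p = (ε / 2) +ᵥ p at he
  rw [zero_vadd] at he
  linarith [eq_zero_of_vadd_eq he.symm]

/-- The map is block triangular, with diagonal blocks `L (1, 0)` and the identity. -/
theorem isInvertible_prod_snd (L : ℝ × E →L[ℝ] ℝ) (hL : L (1, 0) ≠ 0) :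
    (L.prod (ContinuousLinearMap.snd ℝ ℝ E)).IsInvertible := by
  have hL' : ∀ a b, L (a, b) = a * L (1, 0) + L (0, b) := fun a b => by
    rw [← smul_eq_mul, ← map_smul, ← map_add]; simp
  refine ⟨ContinuousLinearEquiv.equivOfInverse (L.prod (ContinuousLinearMap.snd ℝ ℝ E))
    (((L (1, 0))⁻¹ • (ContinuousLinearMap.fst ℝ ℝ E - L.comp ((0 : ℝ × E →L[ℝ] ℝ).prod
      (ContinuousLinearMap.snd ℝ ℝ E)))).prod (ContinuousLinearMap.snd ℝ ℝ E)) ?_ ?_, rfl⟩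
  · rintro ⟨a, b⟩
    simp [hL' a b]
    field_simp
  · rintro ⟨a, b⟩
    simp
    rw [hL']
    field_simp
    ring

/-- The time at which orbits hit a transverse hypersurface. -/
theorem exists_hittingTime [CompleteSpace E] {f : M → ℝ} {O₀ : Set M} (hO₀ : IsOpen O₀) {p : M} (hp : p ∈ O₀)
    (hf : ContMDiffOn I 𝓘(ℝ, ℝ) ∞ f O₀) (hfp : f p = 0) {d : ℝ} (hd : 0 < d)
    (hfd : HasDerivAt (fun s : ℝ => f (s +ᵥ p)) d 0) :
    ∃ δ > 0, ∃ O : Set M, IsOpen O ∧ p ∈ O ∧ ∃ θ : M → ℝ, ContMDiffOn I 𝓘(ℝ, ℝ) ∞ θ O ∧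
      ∀ q ∈ O, θ q +ᵥ q ∈ O₀ ∧ f (θ q +ᵥ q) = 0 ∧ ∀ s : ℝ, |s| < δ → f (s +ᵥ q) = 0 → s = θ q := by
  set x := extChartAt I p with hx
  -- The action read in the chart at `p`. Its domain is a product of `ℝ` with a set having unique
  -- derivatives, so boundary points are covered as well.
  set A : ℝ × E → M := fun z => z.1 +ᵥ x.symm z.2 with hA
  have hAs : ContMDiffOn 𝓘(ℝ, ℝ × E) I ∞ A (univ ×ˢ x.target) := by
    have h1 : ContMDiffOn 𝓘(ℝ, ℝ × E) I ∞ (fun z : ℝ × E => x.symm z.2) (univ ×ˢ x.target) :=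
      (contMDiffOn_extChartAt_symm (I := I) (n := ∞) p).comp contDiff_snd.contMDiff.contMDiffOn
        (fun z hz => hz.2)
    exact (contMDiff_action I).comp_contMDiffOn (contDiff_fst.contMDiff.contMDiffOn.prodMk h1)
  obtain ⟨u, hu, hTu⟩ := continuousOn_iff'.1 hAs.continuousOn O₀ hO₀
  set T := A ⁻¹' O₀ ∩ univ ×ˢ x.target with hT
  have huT : UniqueDiffOn ℝ (univ ×ˢ x.target : Set (ℝ × E)) :=
    uniqueDiffOn_univ.prod (uniqueDiffOn_extChartAt_target (I := I) p)
  have hTd : UniqueDiffOn ℝ T := by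
    rw [hTu, inter_comm]
    exact huT.inter hu
  have hg : ContDiffOn ℝ ∞ (f ∘ A) T :=
    contMDiffOn_iff_contDiffOn.1 (hf.comp (hAs.mono inter_subset_right) fun z hz => hz.1)
  have hder : ∀ (s : ℝ) (y : E), (s, y) ∈ T →
      HasDerivAt (fun r : ℝ => f (A (r, y))) (fderivWithin ℝ (f ∘ A) T (s, y) (1, 0)) s := by
    intro s y hz
    have h1 := (hg.differentiableOn (by simp) _ hz).hasFDerivWithinAt
    have h2 : HasDerivAt (fun r : ℝ => (r, y)) (1, 0) s := (hasDerivAt_id s).prodMk (hasDerivAt_const s y)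
    refine (h1.comp_hasDerivWithinAt (s := {r : ℝ | (r, y) ∈ u}) s h2.hasDerivWithinAt ?_).hasDerivAt ?_
    · intro r hr
      rw [hTu]
      exact ⟨hr, mem_univ _, hz.2.2⟩
    · rw [hTu] at hz
      exact (hu.preimage (by fun_prop : Continuous fun r : ℝ => (r, y))).mem_nhds hz.1
  have hxp : x p ∈ x.target := mem_extChartAt_target (I := I) p
  have hsp : x.symm (x p) = p := extChartAt_to_inv (I := I) p
  have h0T : ((0 : ℝ), x p) ∈ T := by
    refine ⟨?_, mem_univ _, hxp⟩
    simp [hA, hsp, hp]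
  have hfd0 : fderivWithin ℝ (f ∘ A) T (0, x p) (1, 0) = d := by
    refine (hder 0 (x p) h0T).unique ?_
    simpa [hA, hsp] using hfd
  -- Transversality persists near `(0, x p)` by continuity of the derivative.
  have hpos : {z | z ∈ T ∧ 0 < fderivWithin ℝ (f ∘ A) T z (1, 0)} ∈
      𝓝[univ ×ˢ x.target] ((0 : ℝ), x p) := by
    have hc : ContinuousWithinAt (fun z => fderivWithin ℝ (f ∘ A) T z (1, 0)) T (0, x p) :=
      ((hg.continuousOn_fderivWithin hTd (by simp)).clm_apply continuousOn_const) _ h0T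
    have hm := hc.preimage_mem_nhdsWithin (Ioi_mem_nhds (hd.trans_eq hfd0.symm))
    rw [hTu, inter_comm, nhdsWithin_inter' ] at hm
    have h2 : u ∈ 𝓝[univ ×ˢ x.target] ((0 : ℝ), x p) :=
      nhdsWithin_le_nhds (hu.mem_nhds (hTu ▸ h0T : _ ∈ u ∩ _).1)
    rw [inf_of_le_left (le_principal_iff.2 h2)] at hm
    filter_upwards [hm, h2, self_mem_nhdsWithin] with z hz hz2 hz3
    refine ⟨hTu ▸ ⟨hz2, hz3⟩, ?_⟩
    rw [hTu, inter_comm]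
    exact hz
  rw [nhdsWithin_prod_eq, nhdsWithin_univ] at hpos
  obtain ⟨P₁, hP₁, P₂, hP₂, hP⟩ := mem_prod_iff.1 hpos
  obtain ⟨ε, hε, hb⟩ := Metric.mem_nhds_iff.1 hP₁
  obtain ⟨Y, hY, hYp, hYP⟩ := mem_nhdsWithin.1 hP₂
  set δ := ε / 2 with hδ
  have hδ0 : 0 < δ := half_pos hε
  set O₁ := x.source ∩ x ⁻¹' Y with hO₁
  have hO₁o : IsOpen O₁ := (continuousOn_extChartAt (I := I) p).isOpen_inter_preimage
    (isOpen_extChartAt_source p) hY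
  have hO₁p : p ∈ O₁ := ⟨mem_extChartAt_source p, hYp⟩
  have hAx : ∀ q ∈ O₁, ∀ s, A (s, x q) = s +ᵥ q := fun q hq s => by
    simp only [hA]; rw [x.left_inv hq.1]
  have hzT : ∀ q ∈ O₁, ∀ s : ℝ, |s| ≤ δ → (s, x q) ∈ T ∧ 0 < fderivWithin ℝ (f ∘ A) T (s, x q) (1, 0) :=
    fun q hq s hs => hP (mk_mem_prod (hb (by rw [mem_ball_zero_iff, Real.norm_eq_abs]; linarith))
      (hYP ⟨hq.2, x.map_source hq.1⟩))
  -- Monotonicity along short orbit segments gives uniqueness of the zero; the signs at `±δ` give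
  -- its existence by the intermediate value theorem.
  have hmono : ∀ q ∈ O₁, StrictMonoOn (fun s : ℝ => f (s +ᵥ q)) (Icc (-δ) δ) := by
    intro q hq
    have hd' : ∀ s ∈ Icc (-δ) δ, HasDerivAt (fun s : ℝ => f (s +ᵥ q))
        (fderivWithin ℝ (f ∘ A) T (s, x q) (1, 0)) s := fun s hs => by
      have := hder s (x q) (hzT q hq s (abs_le.2 hs)).1
      simpa only [hAx q hq] using this
    refine strictMonoOn_of_deriv_pos (convex_Icc _ _)
      (fun s hs => (hd' s hs).continuousAt.continuousWithinAt) fun s hs => ?_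
    have hs' := interior_subset hs
    rw [(hd' s hs').deriv]
    exact (hzT q hq s (abs_le.2 hs')).2
  have hO₀' : ∀ q ∈ O₁, ∀ s : ℝ, |s| ≤ δ → s +ᵥ q ∈ O₀ := fun q hq s hs => by
    have := (hzT q hq s hs).1.1
    rwa [mem_preimage, hAx q hq] at this
  have hact : Continuous fun z : ℝ × M => z.1 +ᵥ z.2 := (contMDiff_action I).continuous
  have hcq : ∀ s : ℝ, |s| ≤ δ → ∀ q ∈ O₁, ContinuousAt (fun q : M => f (s +ᵥ q)) q := fun s hs q hq =>
    (hf.continuousOn.continuousAt (hO₀.mem_nhds (hO₀' q hq s hs))).comp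
      (f := fun q : M => s +ᵥ q) (contMDiff_translation I s).continuous.continuousAt
  have hδm : δ ∈ Icc (-δ) δ := ⟨by linarith, le_rfl⟩
  have hδm' : -δ ∈ Icc (-δ) δ := ⟨le_rfl, by linarith⟩
  have h0m : (0 : ℝ) ∈ Icc (-δ) δ := ⟨by linarith, hδ0.le⟩
  have habs : |δ| ≤ δ := (abs_of_pos hδ0).le
  have habs' : |-δ| ≤ δ := by rw [abs_neg]; exact habs
  have hpp : 0 < f (δ +ᵥ p) := by
    have := hmono p hO₁p h0m hδm hδ0
    simpa [hfp] using this
  have hpn : f (-δ +ᵥ p) < 0 := by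
    have := hmono p hO₁p hδm' h0m (by linarith)
    simpa [hfp] using this
  have hev : ∀ᶠ q in 𝓝 p, q ∈ O₁ ∧ 0 < f (δ +ᵥ q) ∧ f (-δ +ᵥ q) < 0 := by
    filter_upwards [hO₁o.mem_nhds hO₁p, (hcq δ habs p hO₁p).eventually (lt_mem_nhds hpp),
      (hcq (-δ) habs' p hO₁p).eventually (gt_mem_nhds hpn)] with q h1 h2 h3
    exact ⟨h1, h2, h3⟩
  obtain ⟨O, hOs, hO, hpO⟩ := eventually_nhds_iff.1 hev
  have hex : ∀ q : M, ∃ s : ℝ, q ∈ O → s ∈ Ioo (-δ) δ ∧ f (s +ᵥ q) = 0 := by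
    intro q
    by_cases hq : q ∈ O
    · obtain ⟨h1, h2, h3⟩ := hOs q hq
      have hc : ContinuousOn (fun s : ℝ => f (s +ᵥ q)) (Icc (-δ) δ) :=
        hf.continuousOn.comp (contMDiff_orbit I q).continuous.continuousOn
          fun s hs => hO₀' q h1 s (abs_le.2 hs)
      obtain ⟨s, hs, hs0⟩ := intermediate_value_Icc (by linarith : -δ ≤ δ) hc ⟨h3.le, h2.le⟩
      have hs0' : f (s +ᵥ q) = 0 := hs0
      refine ⟨s, fun _ => ⟨⟨lt_of_le_of_ne hs.1 ?_, lt_of_le_of_ne hs.2 ?_⟩, hs0'⟩⟩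
      · rintro rfl
        exact h3.ne hs0
      · rintro h
        rw [h] at hs0'
        exact h2.ne' hs0'
    · exact ⟨0, fun h => absurd h hq⟩
  choose θ hθ using hex
  have huniq : ∀ q ∈ O, ∀ s : ℝ, |s| < δ → f (s +ᵥ q) = 0 → s = θ q := fun q hq s hs h0 =>
    (hmono q (hOs q hq).1).injOn (abs_le.1 hs.le) (Ioo_subset_Icc_self (hθ q hq).1)
      (h0.trans (hθ q hq).2.symm)
  -- The sign of `f` at a time just before or after `θ q` persists for nearby points, which by
  -- monotonicity traps their hitting times. The `max` and `min` keep the test time within `[-δ,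
  -- δ]`.
  have hθc : ContinuousOn θ O := by
    intro q hq
    refine ContinuousAt.continuousWithinAt (tendsto_order.2 ⟨fun a ha => ?_, fun a ha => ?_⟩)
    · have hm : max a (-δ) ∈ Icc (-δ) δ := ⟨le_max_right _ _, max_le (ha.le.trans (hθ q hq).1.2.le) hδm.1⟩
      have hneg : f (max a (-δ) +ᵥ q) < 0 := by
        have := hmono q (hOs q hq).1 hm (Ioo_subset_Icc_self (hθ q hq).1) (max_lt ha (hθ q hq).1.1)
        exact this.trans_eq (hθ q hq).2
      filter_upwards [(hcq _ (abs_le.2 hm) q (hOs q hq).1).eventually (gt_mem_nhds hneg),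
        hO.mem_nhds hq] with r hr hrO
      refine (le_max_left _ _).trans_lt (((hmono r (hOs r hrO).1).lt_iff_lt hm
        (Ioo_subset_Icc_self (hθ r hrO).1)).1 ?_)
      exact hr.trans_eq (hθ r hrO).2.symm
    · have hm : min a δ ∈ Icc (-δ) δ := ⟨le_min ((hθ q hq).1.1.le.trans ha.le) hδm.1, min_le_right _ _⟩
      have hneg : 0 < f (min a δ +ᵥ q) := by
        have := hmono q (hOs q hq).1 (Ioo_subset_Icc_self (hθ q hq).1) hm (lt_min ha (hθ q hq).1.2)
        exact (hθ q hq).2.symm.trans_lt this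
      filter_upwards [(hcq _ (abs_le.2 hm) q (hOs q hq).1).eventually (lt_mem_nhds hneg),
        hO.mem_nhds hq] with r hr hrO
      refine lt_of_lt_of_le (((hmono r (hOs r hrO).1).lt_iff_lt 
        (Ioo_subset_Icc_self (hθ r hrO).1) hm).1 ?_) (min_le_left _ _)
      exact (hθ r hrO).2.trans_lt hr
  have hOx : O ⊆ x.source := fun q hq => (hOs q hq).1.1
  refine ⟨δ, hδ0, O, hO, hpO, θ, ?_, fun q hq =>
    ⟨hO₀' q (hOs q hq).1 _ (abs_lt.2 (hθ q hq).1).le, (hθ q hq).2, huniq q hq⟩⟩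
  have hxc : ContinuousOn x.symm x.target := continuousOn_extChartAt_symm (I := I) p
  obtain ⟨u', hu', hSu⟩ := continuousOn_iff'.1 hxc O hO
  set S := x.symm ⁻¹' O ∩ x.target with hS
  have hSd : UniqueDiffOn ℝ S := by
    rw [hSu, inter_comm]
    exact (uniqueDiffOn_extChartAt_target (I := I) p).inter hu'
  -- The graph of the hitting time solves `F ∘ ψ = (0, id)` for `F (s, y) = (f (A (s, y)), y)`,
  -- whose derivative is triangular and invertible by transversality.
  have hψ : ContDiffOn ℝ ∞ (fun y => (θ (x.symm y), y)) S := by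
    have hψT : MapsTo (fun y => (θ (x.symm y), y)) S T := fun y hy => by
      have := (hzT _ (hOs _ hy.1).1 _ (abs_lt.2 (hθ _ hy.1).1).le).1
      rwa [x.right_inv hy.2] at this
    have hFd : ∀ z ∈ T, HasFDerivWithinAt (fun z => ((f ∘ A) z, z.2))
        ((fderivWithin ℝ (f ∘ A) T z).prod (ContinuousLinearMap.snd ℝ ℝ E)) T z := fun z hz =>
      (hg.differentiableOn (by simp) _ hz).hasFDerivWithinAt.prodMk hasFDerivWithinAt_snd
    refine contDiffOn_of_comp_eq (F := fun z => ((f ∘ A) z, z.2)) (χ := fun y => ((0 : ℝ), y)) hTd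
      (hg.prodMk contDiffOn_snd) hSd (contDiffOn_const.prodMk contDiffOn_id)
      ((hθc.comp (hxc.mono inter_subset_right) fun y hy => hy.1).prodMk continuousOn_id) hψT
      (fun y hy => ?_) fun y hy => ?_
    · refine Prod.ext ?_ rfl
      exact (hθ _ hy.1).2
    · rw [(hFd _ (hψT hy)).fderivWithin (hTd _ (hψT hy))]
      refine isInvertible_prod_snd _ (ne_of_gt ?_)
      have := (hzT _ (hOs _ hy.1).1 _ (abs_lt.2 (hθ _ hy.1).1).le).2
      rwa [x.right_inv hy.2] at this
  have h1 : ContMDiffOn 𝓘(ℝ, E) 𝓘(ℝ, ℝ) ∞ (fun y => θ (x.symm y)) S :=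
    contMDiffOn_iff_contDiffOn.2 hψ.fst
  refine (h1.comp ((contMDiffOn_extChartAt (I := I) (n := ∞) (x := p)).mono
    (fun q hq => by simpa [hx] using hOx hq)) fun q hq => ⟨?_, x.map_source (hOx hq)⟩).congr fun q hq => ?_
  · change x.symm (x q) ∈ O
    rwa [x.left_inv (hOx hq)]
  · change θ q = θ (x.symm (x q))
    rw [x.left_inv (hOx hq)]

end HittingTime


/-! ### Coordinate hyperplanes in the half space. -/

noncomputable section HalfSpace

theorem contMDiffAt_of_val {n : ℕ} [NeZero n] {E : Type} [NormedAddCommGroup E] [NormedSpace ℝ E] {H : Type} [TopologicalSpace H]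
    {J : ModelWithCorners ℝ E H} {X : Type*} [TopologicalSpace X] [ChartedSpace H X]
    {f : X → EuclideanHalfSpace n} {x : X}
    (h : ContMDiffAt J (𝓡 n) ∞ (fun x => (f x).val) x) : ContMDiffAt J (𝓡∂ n) ∞ f x := by
  have e : f = (𝓡∂ n).symm ∘ fun x => (𝓡∂ n) (f x) := by
    funext y
    exact ((𝓡∂ n).left_inv (f y)).symm
  rw [e]
  have h1 := (𝓡∂ n).contMDiffOn_symm (n := ∞) _ (mem_range_self (f x))
  exact contMDiffWithinAt_univ.1 (ContMDiffWithinAt.comp x h1 h.contMDiffWithinAt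
    fun y _ => mem_range_self (f y))

theorem contMDiff_val (n : ℕ) [NeZero n] :
    ContMDiff (𝓡∂ n) (𝓡 n) ∞ (fun u : EuclideanHalfSpace n => u.val) :=
  (𝓡∂ n).contMDiff

/-- The hyperplane fixes a coordinate `j` along which `v` is nonzero, and `c`, `l` are coordinates
on it. If `j` can be `1` or `2`, the boundary coordinate `0` is kept, so the half space cuts the
hyperplane in a half plane. Otherwise `v` points along axis `0`, and the hypothesis on `v` puts `y₀`
in the interior. -/
theorem exists_coordinate_hyperplane {y₀ v : EuclideanSpace ℝ (Fin 3)} (hv : v ≠ 0) (hy : 0 ≤ y₀ 0)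
    (hv0 : y₀ 0 = 0 → v 0 = 0) :
    ∃ (j : Fin 3) (c : EuclideanSpace ℝ (Fin 3) → EuclideanSpace ℝ (Fin 2))
      (l : EuclideanSpace ℝ (Fin 2) → EuclideanSpace ℝ (Fin 3)) (Y : Set (EuclideanSpace ℝ (Fin 3))),
      v j ≠ 0 ∧ ContDiff ℝ ∞ c ∧ ContDiff ℝ ∞ l ∧ IsOpen Y ∧ y₀ ∈ Y ∧ (∀ u, c (l u) = u) ∧
      (∀ y, y j = y₀ j → l (c y) = y) ∧ (∀ u, l u j = y₀ j) ∧ (∀ y ∈ Y, 0 ≤ y 0 → 0 ≤ c y 0) ∧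
      (∀ u, 0 ≤ u 0 → l u ∈ Y → 0 ≤ l u 0) ∧ (y₀ 0 = 0 → c y₀ 0 = 0) := by
  have hcoord : ∀ i : Fin 3, ContDiff ℝ ∞ fun y : EuclideanSpace ℝ (Fin 3) => y i := fun i => by fun_prop
  have hcoord' : ∀ i : Fin 2, ContDiff ℝ ∞ fun y : EuclideanSpace ℝ (Fin 2) => y i := fun i => by fun_prop
  by_cases h1 : v 1 = 0
  · by_cases h2 : v 2 = 0
    · have h0 : v 0 ≠ 0 := fun h0 => hv (by ext i; fin_cases i <;> assumption)
      have hy0 : y₀ 0 ≠ 0 := fun h => h0 (hv0 h)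
      -- Interior case: the shift gives `y₀` first coordinate `1`, and `Y` keeps that coordinate
      -- positive, so the slice has values in the half plane.
      refine ⟨0, fun y => !₂[y 1 - y₀ 1 + 1, y 2], fun u => !₂[y₀ 0, u 0 + y₀ 1 - 1, u 1],
        {y | y₀ 1 - 1 < y 1}, h0, ?_, ?_, isOpen_lt continuous_const (hcoord 1).continuous, ?_, ?_, ?_, ?_,
        ?_, ?_, ?_⟩
      · rw [contDiff_euclidean]
        intro i
        fin_cases i
        · exact ((hcoord 1).sub contDiff_const).add contDiff_const
        · exact hcoord 2
      · rw [contDiff_euclidean]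
        intro i
        fin_cases i
        · exact contDiff_const
        · exact ((hcoord' 0).add contDiff_const).sub contDiff_const
        · exact hcoord' 1
      · simp
      · intro u
        ext i
        fin_cases i <;> simp <;> ring
      · intro y h
        ext i
        fin_cases i <;> simp [h] <;> ring
      · intro u
        simp
      · intro y h _
        have h' : y₀ 1 - 1 < y 1 := h
        simp only [Matrix.cons_val_zero]
        linarith
      · intro u _ _
        simpa using hy
      · intro h
        exact absurd h hy0
    · refine ⟨2, fun y => !₂[y 0, y 1], fun u => !₂[u 0, u 1, y₀ 2], univ, h2, ?_, ?_, isOpen_univ,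
        mem_univ _, ?_, ?_, ?_, ?_, ?_, ?_⟩
      · rw [contDiff_euclidean]
        intro i
        fin_cases i
        · exact hcoord 0
        · exact hcoord 1
      · rw [contDiff_euclidean]
        intro i
        fin_cases i
        · exact hcoord' 0
        · exact hcoord' 1
        · exact contDiff_const
      · intro u
        ext i
        fin_cases i <;> simp
      · intro y h
        ext i
        fin_cases i <;> simp [h]
      · intro u
        simp
      · intro y _ h
        simpa using h
      · intro u h _
        simpa using h
      · intro h
        simpa using h
  · refine ⟨1, fun y => !₂[y 0, y 2], fun u => !₂[u 0, y₀ 1, u 1], univ, h1, ?_, ?_, isOpen_univ,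
      mem_univ _, ?_, ?_, ?_, ?_, ?_, ?_⟩
    · rw [contDiff_euclidean]
      intro i
      fin_cases i
      · exact hcoord 0
      · exact hcoord 2
    · rw [contDiff_euclidean]
      intro i
      fin_cases i
      · exact hcoord' 0
      · exact contDiff_const
      · exact hcoord' 1
    · intro u
      ext i
      fin_cases i <;> simp
    · intro y h
      ext i
      fin_cases i <;> simp [h]
    · intro u
      simp
    · intro y _ h
      simpa using h
    · intro u h _
      simpa using h
    · intro h
      simpa using h
end HalfSpace

/-! ### Slices of the action and charts of the orbit space. -/

noncomputable section Slice
variable (M : Type*) [TopologicalSpace M] [ChartedSpace (EuclideanHalfSpace 3) M] [AddAction ℝ M]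

/-- A chart of the orbit space given by a smooth slice of the action. -/
structure OrbitChart where
  chart : OpenPartialHomeomorph (OrbitSpace M) (EuclideanHalfSpace 2)
  slice : EuclideanHalfSpace 2 → M
  time : M → ℝ
  contMDiffOn_slice : ContMDiffOn (𝓡∂ 2) (𝓡∂ 3) ∞ slice chart.target
  mk_slice : ∀ u ∈ chart.target, orbitMk (slice u) = chart.symm u
  contMDiffOn_chart : ContMDiffOn (𝓡∂ 3) (𝓡∂ 2) ∞ (chart ∘ orbitMk) (orbitMk ⁻¹' chart.source)
  contMDiffOn_time : ContMDiffOn (𝓡∂ 3) 𝓘(ℝ, ℝ) ∞ time (orbitMk ⁻¹' chart.source)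
  vadd_slice : ∀ q, orbitMk q ∈ chart.source → time q +ᵥ slice (chart (orbitMk q)) = q

variable {M}

theorem orbitMk_eq_iff {p q : M} : (orbitMk p : OrbitSpace M) = orbitMk q ↔ ∃ s : ℝ, s +ᵥ q = p :=
  Quotient.eq.trans Iff.rfl

theorem orbitMk_vadd (s : ℝ) (p : M) : (orbitMk (s +ᵥ p) : OrbitSpace M) = orbitMk p :=
  orbitMk_eq_iff.2 ⟨s, rfl⟩

theorem surjective_orbitMk : Function.Surjective (orbitMk : M → OrbitSpace M) := Quotient.mk_surjective

theorem isOpenQuotientMap_orbitMk [ContinuousConstVAdd ℝ M] :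
    IsOpenQuotientMap (orbitMk : M → OrbitSpace M) := by
  exact AddAction.isOpenQuotientMap_quotientMk

theorem zero_le_of_mem_range {y : EuclideanSpace ℝ (Fin 3)} (h : y ∈ range (𝓡∂ 3)) : 0 ≤ y 0 := by
  rw [range_modelWithCornersEuclideanHalfSpace] at h
  exact h

variable [T2Space M] [IsManifold (𝓡∂ 3) ∞ M] [ContMDiffVAdd 𝓘(ℝ, ℝ) (𝓡∂ 3) ∞ ℝ M] [ProperVAdd ℝ M]

/-- A coordinate hyperplane through `p` transverse to its orbit is a slice. The hitting time moves
nearby points onto it, and the absence of late returns ensures that an orbit meets it at most once.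
-/
theorem exists_local_slice (p : M) : ∃ (U : Set (EuclideanHalfSpace 2)) (σ : EuclideanHalfSpace 2 → M),
    IsOpen U ∧ ContMDiffOn (𝓡∂ 2) (𝓡∂ 3) ∞ σ U ∧
    (∃ u ∈ U, σ u = p ∧ (p ∈ (𝓡∂ 3).boundary M → u.val 0 = 0)) ∧
    (∀ u ∈ U, ∀ u' ∈ U, ∀ s : ℝ, s +ᵥ σ u = σ u' → s = 0 ∧ u = u') ∧
    ∀ u ∈ U, ∃ (O : Set M) (θ : M → ℝ) (c : M → EuclideanHalfSpace 2), IsOpen O ∧ σ u ∈ O ∧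
      ContMDiffOn (𝓡∂ 3) 𝓘(ℝ, ℝ) ∞ θ O ∧ ContMDiffOn (𝓡∂ 3) (𝓡∂ 2) ∞ c O ∧
      ∀ q ∈ O, c q ∈ U ∧ q = θ q +ᵥ σ (c q) := by
  have : IsManifold (𝓡∂ 3) 1 M := IsManifold.of_le (n := ∞) (by simp)
  set x := extChartAt (𝓡∂ 3) p with hx
  have hps : p ∈ x.source := mem_extChartAt_source p
  have hmd : MDifferentiableAt (𝓡∂ 3) (𝓡 3) x p := mdifferentiableAt_extChartAt (mem_chart_source _ p)
  set v : EuclideanSpace ℝ (Fin 3) := modelDeriv (𝓡∂ 3) (𝓡 3) x p (velocity (𝓡∂ 3) p) with hv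
  have hxd : HasDerivAt (fun r : ℝ => x (r +ᵥ p)) v 0 := by
    have := hasDerivAt_comp_vadd (𝓡∂ 3) (p := p) (s := 0) (f := x) (by rwa [zero_vadd])
    rwa [zero_vadd] at this
  have hxdj : ∀ j, HasDerivAt (fun r : ℝ => x (r +ᵥ p) j) (v j) 0 := fun j =>
    (EuclideanSpace.proj (𝕜 := ℝ) j).hasFDerivAt.comp_hasDerivAt (0 : ℝ) hxd
  have hv0 : v ≠ 0 := by
    obtain ⟨e, he⟩ := isInvertible_mfderiv_extChartAt (I := 𝓡∂ 3) hps
    let e' : EuclideanSpace ℝ (Fin 3) ≃L[ℝ] EuclideanSpace ℝ (Fin 3) := e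
    have hv' : v = e' (velocity (𝓡∂ 3) p) := by
      rw [hv]
      exact (DFunLike.congr_fun (show (e' : EuclideanSpace ℝ (Fin 3) →L[ℝ] EuclideanSpace ℝ (Fin 3)) =
        modelDeriv (𝓡∂ 3) (𝓡 3) x p from he) (velocity (𝓡∂ 3) p)).symm
    rw [hv']
    exact fun h => velocity_ne_zero (𝓡∂ 3) p (e'.map_eq_zero_iff.1 h)
  have hrange : ∀ q ∈ x.source, 0 ≤ x q 0 := fun q hq =>
    zero_le_of_mem_range (extChartAt_target_subset_range p (x.map_source hq))
  -- At a boundary point the orbit cannot leave the half space in either direction of time, so the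
  -- boundary coordinate has a local minimum at time `0`: the velocity is tangent to the boundary.
  have hbv : x p 0 = 0 → v 0 = 0 := by
    intro h0
    refine IsLocalMin.hasDerivAt_eq_zero (f := fun r : ℝ => x (r +ᵥ p) 0) ?_ (hxdj 0)
    have hc : ContinuousAt (fun r : ℝ => r +ᵥ p) 0 := (contMDiff_orbit (𝓡∂ 3) p).continuous.continuousAt
    filter_upwards [hc.preimage_mem_nhds (show x.source ∈ 𝓝 ((0 : ℝ) +ᵥ p) by
      rw [zero_vadd]; exact extChartAt_source_mem_nhds p)] with r hr
    simp only [zero_vadd, h0]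
    exact hrange _ hr
  obtain ⟨j, c, l, Y, hj, hc, hl, hY, hpY, hcl, hlc, hlj, hcY, hlY, hcb⟩ :=
    exists_coordinate_hyperplane hv0 (hrange p hps) hbv
  have hxs : ContMDiffOn (𝓡∂ 3) (𝓡 3) ∞ x x.source := by
    have := contMDiffOn_extChartAt (I := 𝓡∂ 3) (n := ∞) (x := p)
    rwa [← extChartAt_source (𝓡∂ 3)] at this
  -- The factor `v j` makes the derivative along the orbit the square `v j * v j`, positive for
  -- either sign.
  set f : M → ℝ := fun q => v j * (x q j - x p j) with hf
  have hfs : ContMDiffOn (𝓡∂ 3) 𝓘(ℝ, ℝ) ∞ f x.source := by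
    have h1 : ContDiff ℝ ∞ fun y : EuclideanSpace ℝ (Fin 3) => v j * (y j - x p j) := by fun_prop
    exact h1.contMDiff.comp_contMDiffOn hxs
  obtain ⟨δ, hδ, O, hO, hpO, θ, hθ, hθO⟩ := exists_hittingTime (𝓡∂ 3) (isOpen_extChartAt_source p) hps
    hfs (by simp [hf]) (d := v j * v j) (mul_self_pos.2 hj) (((hxdj j).sub_const _).const_mul (v j))
  have hf0 : ∀ {q : M}, f q = 0 ↔ x q j = x p j := fun {q} => by
    simp [hf, hj, sub_eq_zero]
  obtain ⟨D, hD, hpD, hDδ⟩ := exists_isOpen_forall_vadd_mem_lt p hδ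
  set O₂ := O ∩ D ∩ (x.source ∩ x ⁻¹' Y) with hO₂
  have hO₂o : IsOpen O₂ := (hO.inter hD).inter
    (hxs.continuousOn.isOpen_inter_preimage (isOpen_extChartAt_source p) hY)
  have hpO₂ : p ∈ O₂ := ⟨⟨hpO, hpD⟩, hps, hpY⟩
  set σ : EuclideanHalfSpace 2 → M := fun u => x.symm (l u.val) with hσ
  have hlc' : Continuous fun u : EuclideanHalfSpace 2 => l u.val :=
    hl.continuous.comp continuous_subtype_val
  set U₀ : Set (EuclideanHalfSpace 2) := (fun u => l u.val) ⁻¹' (Y ∩ (𝓡∂ 3).symm ⁻¹' (chartAt _ p).target)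
    with hU₀
  have hU₀o : IsOpen U₀ := (hY.inter ((chartAt _ p).open_target.preimage (𝓡∂ 3).continuous_symm)).preimage hlc'
  have hU₀t : ∀ u ∈ U₀, l u.val ∈ x.target := by
    intro u hu
    rw [hx, extChartAt_target]
    refine ⟨hu.2, ?_⟩
    rw [range_modelWithCornersEuclideanHalfSpace]
    exact hlY _ u.2 hu.1
  have hσs : ContMDiffOn (𝓡∂ 2) (𝓡∂ 3) ∞ σ U₀ :=
    (contMDiffOn_extChartAt_symm (I := 𝓡∂ 3) (n := ∞) p).comp
      (hl.contMDiff.comp (contMDiff_val 2)).contMDiffOn hU₀t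
  set U := U₀ ∩ σ ⁻¹' O₂ with hU
  have hxσ : ∀ u ∈ U, x (σ u) = l u.val := fun u hu => x.right_inv (hU₀t u hu.1)
  have hfσ : ∀ u ∈ U, f (σ u) = 0 := fun u hu => hf0.2 (by rw [hxσ u hu, hlj])
  -- Points of the slice are hit at time `0`, and short hitting times are unique.
  have hθσ : ∀ u ∈ U, θ (σ u) = 0 := fun u hu =>
    ((hθO _ hu.2.1.1).2.2 0 (by simpa using hδ) (by rw [zero_vadd]; exact hfσ u hu)).symm
  have hpt : ∀ q ∈ O₂, f q = 0 → ∃ u ∈ U, u.val = c (x q) ∧ σ u = q := by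
    intro q hq hfq
    have h1 : l (c (x q)) = x q := hlc _ (hf0.1 hfq)
    have h2 : σ ⟨c (x q), hcY _ hq.2.2 (hrange q hq.2.1)⟩ = q := by
      simp only [hσ, h1]
      exact x.left_inv hq.2.1
    refine ⟨⟨c (x q), hcY _ hq.2.2 (hrange q hq.2.1)⟩, ⟨⟨?_, ?_⟩, ?_⟩, rfl, h2⟩
    · simp only [h1]
      exact hq.2.2
    · have := x.map_source hq.2.1
      rw [hx, extChartAt_target, ← hx] at this
      simp only [h1]
      exact this.1
    · rw [mem_preimage, h2]
      exact hq
  refine ⟨U, σ, hσs.continuousOn.isOpen_inter_preimage hU₀o hO₂o, hσs.mono inter_subset_left, ?_, ?_, ?_⟩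
  · obtain ⟨u, hu, huc, huσ⟩ := hpt p hpO₂ (by simp [hf])
    refine ⟨u, hu, huσ, fun hb => ?_⟩
    rw [huc]
    refine hcb ?_
    have hb' := ((𝓡∂ 3).isBoundaryPoint_iff).1 hb
    rw [frontier_range_modelWithCornersEuclideanHalfSpace] at hb'
    exact hb'.symm
  · intro u hu u' hu' s hs
    have h1 : |s| < δ := hDδ s (σ u) hu.2.1.2 (by rw [hs]; exact hu'.2.1.2)
    have h2 := (hθO _ hu.2.1.1).2.2 s h1 (by rw [hs]; exact hfσ u' hu')
    rw [hθσ u hu] at h2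
    refine ⟨h2, ?_⟩
    rw [h2, zero_vadd] at hs
    have h3 : l u.val = l u'.val := by rw [← hxσ u hu, ← hxσ u' hu', hs]
    apply EuclideanHalfSpace.ext
    rw [← hcl u.val, ← hcl u'.val, h3]
  · intro u hu
    -- The retraction along orbits onto the hyperplane; `O'` consists of the points whose image lies
    -- in the part parametrized by `U`, and the time back is `-θ`.
    set κ : M → M := fun q => θ q +ᵥ q with hκ
    have hκs : ContMDiffOn (𝓡∂ 3) (𝓡∂ 3) ∞ κ O :=
      (contMDiff_action (𝓡∂ 3)).comp_contMDiffOn (hθ.prodMk contMDiffOn_id)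
    have hκu : κ (σ u) = σ u := by simp [hκ, hθσ u hu]
    set O' := O ∩ κ ⁻¹' O₂ with hO'
    have hO'o : IsOpen O' := hκs.continuousOn.isOpen_inter_preimage hO hO₂o
    have hex : ∀ q : M, ∃ u' : EuclideanHalfSpace 2, q ∈ O' → u' ∈ U ∧ u'.val = c (x (κ q)) ∧ σ u' = κ q := by
      intro q
      by_cases hq : q ∈ O'
      · obtain ⟨u', h1, h2, h3⟩ := hpt (κ q) hq.2 (hθO q hq.1).2.1
        exact ⟨u', fun _ => ⟨h1, h2, h3⟩⟩
      · exact ⟨u, fun h => absurd h hq⟩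
    choose C hC using hex
    refine ⟨O', fun q => -θ q, C, hO'o, ⟨hu.2.1.1, by rw [mem_preimage, hκu]; exact hu.2⟩,
      (contDiff_neg.contMDiff.comp_contMDiffOn hθ).mono inter_subset_left, fun q hq => ?_, fun q hq => ?_⟩
    · refine ContMDiffAt.contMDiffWithinAt (contMDiffAt_of_val ?_)
      have h1 : ContMDiffOn (𝓡∂ 3) (𝓡 2) ∞ (fun q => c (x (κ q))) O' :=
        hc.contMDiff.comp_contMDiffOn (hxs.comp (hκs.mono inter_subset_left) fun q hq => hq.2.2.1)
      refine (h1.contMDiffAt (hO'o.mem_nhds hq)).congr_of_eventuallyEq ?_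
      filter_upwards [hO'o.mem_nhds hq] with r hr
      exact (hC r hr).2.1
    · refine ⟨(hC q hq).1, ?_⟩
      rw [(hC q hq).2.2]
      simp [hκ, vadd_vadd]

/-- Each orbit through the saturation `W` of a slice meets the slice exactly once. The slice
parameter is thus a function on orbits, and together with the slice itself it gives a homeomorphism.
-/
theorem exists_orbitChart (p : M) : ∃ S : OrbitChart M, orbitMk p ∈ S.chart.source ∧
    (p ∈ (𝓡∂ 3).boundary M → (S.chart (orbitMk p)).val 0 = 0) := by
  obtain ⟨U, σ, hU, hσ, ⟨u₀, hu₀, hσu₀, hb⟩, huniq, hloc⟩ := exists_local_slice p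
  have hcv : ContinuousConstVAdd ℝ M := ⟨fun s => (contMDiff_translation (𝓡∂ 3) s).continuous⟩
  set W : Set M := {q | ∃ (s : ℝ) (u : EuclideanHalfSpace 2), u ∈ U ∧ q = s +ᵥ σ u} with hW
  have hWv : ∀ (s : ℝ) (q : M), q ∈ W → s +ᵥ q ∈ W := by
    rintro s _ ⟨r, u, hu, rfl⟩
    exact ⟨s + r, u, hu, by rw [vadd_vadd]⟩
  have hex : ∀ q : M, ∃ (s : ℝ) (u : EuclideanHalfSpace 2), q ∈ W → u ∈ U ∧ q = s +ᵥ σ u := by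
    intro q
    by_cases hq : q ∈ W
    · obtain ⟨s, u, h⟩ := hq
      exact ⟨s, u, fun _ => h⟩
    · exact ⟨0, u₀, fun h => absurd h hq⟩
  choose τ C hC using hex
  -- By uniqueness on the slice the chosen time and parameter are the only possible ones, so they
  -- agree with every local smooth formula.
  have hun : ∀ (s : ℝ) (u : EuclideanHalfSpace 2), u ∈ U → C (s +ᵥ σ u) = u ∧ τ (s +ᵥ σ u) = s := by
    intro s u hu
    obtain ⟨h1, h2⟩ := hC (s +ᵥ σ u) ⟨s, u, hu, rfl⟩
    set q := s +ᵥ σ u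
    have h3 : (s - τ q) +ᵥ σ u = σ (C q) := by
      rw [sub_eq_neg_add, ← vadd_vadd]
      change -τ q +ᵥ q = _
      nth_rewrite 2 [h2]
      rw [neg_vadd_vadd]
    obtain ⟨h4, h5⟩ := huniq u hu _ h1 _ h3
    exact ⟨h5.symm, by linarith⟩
  -- Far from the slice the local formulas are transported by the translation `-s`.
  have hlocal : ∀ q₀ ∈ W, ∃ O : Set M, IsOpen O ∧ q₀ ∈ O ∧ O ⊆ W ∧ ContMDiffOn (𝓡∂ 3) 𝓘(ℝ, ℝ) ∞ τ O ∧
      ContMDiffOn (𝓡∂ 3) (𝓡∂ 2) ∞ C O := by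
    rintro _ ⟨s, u, hu, rfl⟩
    obtain ⟨O, θ, c, hO, huO, hθ, hc, hOc⟩ := hloc u hu
    have ht : ContMDiff (𝓡∂ 3) (𝓡∂ 3) ∞ (fun q : M => -s +ᵥ q) := contMDiff_translation (𝓡∂ 3) (-s)
    have hq : ∀ q ∈ (fun q : M => -s +ᵥ q) ⁻¹' O,
        c (-s +ᵥ q) ∈ U ∧ q = (s + θ (-s +ᵥ q)) +ᵥ σ (c (-s +ᵥ q)) := by
      intro q hq
      obtain ⟨h1, h2⟩ := hOc _ hq
      refine ⟨h1, ?_⟩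
      rw [← vadd_vadd, ← h2, vadd_neg_vadd]
    refine ⟨(fun q : M => -s +ᵥ q) ⁻¹' O, hO.preimage ht.continuous, ?_, fun q h => ⟨_, _, hq q h⟩, ?_, ?_⟩
    · change -s +ᵥ (s +ᵥ σ u) ∈ O
      rwa [neg_vadd_vadd]
    · have h1 : ContMDiffOn (𝓡∂ 3) 𝓘(ℝ, ℝ) ∞ (fun q => s + θ (-s +ᵥ q)) ((fun q : M => -s +ᵥ q) ⁻¹' O) :=
        (contDiff_const.add contDiff_id).contMDiff.comp_contMDiffOn
          (hθ.comp ht.contMDiffOn fun q hq => hq)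
      refine h1.congr fun q h => ?_
      obtain ⟨h2, h3⟩ := hq q h
      have := (hun (s + θ (-s +ᵥ q)) _ h2).2
      rwa [← h3] at this
    · refine (hc.comp ht.contMDiffOn fun q hq => hq).congr fun q h => ?_
      obtain ⟨h2, h3⟩ := hq q h
      have := (hun (s + θ (-s +ᵥ q)) _ h2).1
      rwa [← h3] at this
  have hWo : IsOpen W := isOpen_iff_forall_mem_open.2 fun q hq => by
    obtain ⟨O, h1, h2, h3, -⟩ := hlocal q hq
    exact ⟨O, h3, h1, h2⟩
  have hτs : ContMDiffOn (𝓡∂ 3) 𝓘(ℝ, ℝ) ∞ τ W := fun q hq => by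
    obtain ⟨O, h1, h2, h3, h4, h5⟩ := hlocal q hq
    exact (h4.contMDiffAt (h1.mem_nhds h2)).contMDiffWithinAt
  have hCs : ContMDiffOn (𝓡∂ 3) (𝓡∂ 2) ∞ C W := fun q hq => by
    obtain ⟨O, h1, h2, h3, h4, h5⟩ := hlocal q hq
    exact (h5.contMDiffAt (h1.mem_nhds h2)).contMDiffWithinAt
  have hCv : ∀ (s : ℝ) (q : M), q ∈ W → C (s +ᵥ q) = C q := by
    rintro s _ ⟨r, u, hu, rfl⟩
    rw [vadd_vadd, (hun _ u hu).1, (hun _ u hu).1]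
  have hpre : (orbitMk ⁻¹' (orbitMk '' W) : Set M) = W := by
    refine subset_antisymm ?_ (subset_preimage_image _ _)
    rintro q ⟨q', hq', he⟩
    obtain ⟨s, rfl⟩ := orbitMk_eq_iff.1 he.symm
    exact hWv s q' hq'
  have hout : ∀ q ∈ W, C (Quotient.out (orbitMk q : OrbitSpace M)) = C q := by
    intro q hq
    have he : (orbitMk (Quotient.out (orbitMk q : OrbitSpace M)) : OrbitSpace M) = orbitMk q :=
      Quotient.out_eq _
    obtain ⟨s, hs⟩ := orbitMk_eq_iff.1 he
    rw [← hs]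
    exact hCv s q hq
  have hσW : ∀ u ∈ U, σ u ∈ W := fun u hu => ⟨0, u, hu, (zero_vadd ℝ _).symm⟩
  have hCσ : ∀ u ∈ U, C (σ u) = u := fun u hu => by
    have := (hun 0 u hu).1
    rwa [zero_vadd] at this
  let e : OpenPartialHomeomorph (OrbitSpace M) (EuclideanHalfSpace 2) :=
    { toFun := fun b => C b.out
      invFun := fun u => orbitMk (σ u)
      source := orbitMk '' W
      target := U
      map_source' := by
        rintro _ ⟨q, hq, rfl⟩
        rw [hout q hq]
        exact (hC q hq).1
      map_target' := fun u hu => mem_image_of_mem _ (hσW u hu)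
      left_inv' := by
        rintro _ ⟨q, hq, rfl⟩
        rw [hout q hq]
        refine Eq.symm (orbitMk_eq_iff.2 ⟨τ q, ?_⟩)
        exact (hC q hq).2.symm
      right_inv' := fun u hu => (hout _ (hσW u hu)).trans (hCσ u hu)
      open_source := isOpenQuotientMap_orbitMk.isOpenMap _ hWo
      open_target := hU
      continuousOn_toFun := by
        rw [isOpenQuotientMap_orbitMk.isQuotientMap.continuousOn_isOpen_iff
          (isOpenQuotientMap_orbitMk.isOpenMap _ hWo), hpre]
        exact hCs.continuousOn.congr hout
      continuousOn_invFun := isOpenQuotientMap_orbitMk.continuous.comp_continuousOn hσ.continuousOn }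
  have hpW : p ∈ W := hσu₀ ▸ hσW u₀ hu₀
  refine ⟨{ chart := e
            slice := σ
            time := τ
            contMDiffOn_slice := hσ
            mk_slice := fun u _ => rfl
            contMDiffOn_chart := ?_
            contMDiffOn_time := ?_
            vadd_slice := ?_ }, mem_image_of_mem _ hpW, fun hp => ?_⟩
  · change ContMDiffOn _ _ _ _ (orbitMk ⁻¹' (orbitMk '' W))
    rw [hpre]
    exact hCs.congr hout
  · change ContMDiffOn _ _ _ _ (orbitMk ⁻¹' (orbitMk '' W))
    rwa [hpre]
  · intro q hq
    have hq' : q ∈ orbitMk ⁻¹' (orbitMk '' W) := hq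
    rw [hpre] at hq'
    change τ q +ᵥ σ (C (Quotient.out (orbitMk q : OrbitSpace M))) = q
    rw [hout q hq']
    exact (hC q hq').2.symm
  · change (C (Quotient.out (orbitMk p : OrbitSpace M))).val 0 = 0
    rw [hout p hpW, ← hσu₀, hCσ u₀ hu₀]
    exact hb hp

end Slice


/-! ### The smooth structure of the orbit space and its boundary. -/

noncomputable section QuotientStructure
variable {M : Type*} [TopologicalSpace M] [ChartedSpace (EuclideanHalfSpace 3) M] [AddAction ℝ M]

namespace OrbitChart
variable (S : OrbitChart M)

theorem orbitMk_slice_chart {q : M} (hq : orbitMk q ∈ S.chart.source) :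
    orbitMk (S.slice (S.chart (orbitMk q))) = (orbitMk q : OrbitSpace M) := by
  rw [S.mk_slice _ (S.chart.map_source hq), S.chart.left_inv hq]

theorem slice_chart_mem {u : EuclideanHalfSpace 2} (hu : u ∈ S.chart.target) :
    orbitMk (S.slice u) ∈ S.chart.source := by
  rw [S.mk_slice u hu]
  exact S.chart.map_target hu

theorem chart_orbitMk_slice {u : EuclideanHalfSpace 2} (hu : u ∈ S.chart.target) :
    S.chart (orbitMk (S.slice u)) = u := by
  rw [S.mk_slice u hu, S.chart.right_inv hu]

/-- A transition map runs along one slice and reads off the parameter of the other, which is smooth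
on `M`. -/
theorem contMDiffOn_transition (S' : OrbitChart M) :
    ContMDiffOn (𝓡∂ 2) (𝓡∂ 2) ∞ (S.chart.symm.trans S'.chart) (S.chart.symm.trans S'.chart).source := by
  have hs : (S.chart.symm.trans S'.chart).source =
      S.chart.target ∩ S.chart.symm ⁻¹' S'.chart.source := S.chart.symm.trans_source S'.chart
  have hm : ∀ u ∈ (S.chart.symm.trans S'.chart).source, u ∈ S.chart.target ∧
      orbitMk (S.slice u) ∈ S'.chart.source := fun u hu => by
    rw [hs] at hu
    exact ⟨hu.1, by rw [S.mk_slice u hu.1]; exact hu.2⟩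
  refine (S'.contMDiffOn_chart.comp (S.contMDiffOn_slice.mono fun u hu => (hm u hu).1)
    fun u hu => (hm u hu).2).congr fun u hu => ?_
  change S'.chart (S.chart.symm u) = S'.chart (orbitMk (S.slice u))
  rw [S.mk_slice u (hm u hu).1]

variable [ContinuousConstVAdd ℝ M]

theorem isOpen_preimage_source : IsOpen (orbitMk ⁻¹' S.chart.source : Set M) :=
  S.chart.open_source.preimage isOpenQuotientMap_orbitMk.continuous

end OrbitChart

variable [T2Space M] [IsManifold (𝓡∂ 3) ∞ M] [ContMDiffVAdd 𝓘(ℝ, ℝ) (𝓡∂ 3) ∞ ℝ M] [ProperVAdd ℝ M]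

theorem exists_isSmoothQuotient :
    ∃ _ : ChartedSpace (EuclideanHalfSpace 2) (OrbitSpace M), IsSmoothQuotient M := by
  have hcv : ContinuousConstVAdd ℝ M := ⟨fun s => (contMDiff_translation (𝓡∂ 3) s).continuous⟩
  have hex : ∀ b : OrbitSpace M, ∃ S : OrbitChart M, b ∈ S.chart.source := fun b => by
    obtain ⟨p, rfl⟩ := surjective_orbitMk b
    obtain ⟨S, hS, -⟩ := exists_orbitChart p
    exact ⟨S, hS⟩
  choose S hS using hex
  let cs : ChartedSpace (EuclideanHalfSpace 2) (OrbitSpace M) :=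
    { atlas := range fun S : OrbitChart M => S.chart
      chartAt := fun b => (S b).chart
      mem_chart_source := hS
      chart_mem_atlas := fun b => ⟨S b, rfl⟩ }
  have hmf : IsManifold (𝓡∂ 2) ∞ (OrbitSpace M) := by
    refine isManifold_of_contDiffOn _ _ _ ?_
    rintro _ _ ⟨S₁, rfl⟩ ⟨S₂, rfl⟩
    refine contMDiffOn_iff_contDiffOn.1 ((𝓡∂ 2).contMDiff.comp_contMDiffOn
      ((S₁.contMDiffOn_transition S₂).comp ((𝓡∂ 2).contMDiffOn_symm.mono inter_subset_right)
        fun u hu => hu.1))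
  have hmk : ContMDiff (𝓡∂ 3) (𝓡∂ 2) ∞ (orbitMk : M → OrbitSpace M) := fun p => by
    rw [contMDiffAt_iff_target]
    refine ⟨isOpenQuotientMap_orbitMk.continuous.continuousAt, ?_⟩
    exact (𝓡∂ 2).contMDiff.contMDiffAt.comp p ((S (orbitMk p)).contMDiffOn_chart.contMDiffAt
      ((S (orbitMk p)).isOpen_preimage_source.mem_nhds (hS _)))
  refine ⟨cs, { toIsManifold := hmf, contMDiff_mk := hmk, surjective_mfderiv_mk := fun p w => ?_ }⟩
  let S₀ := S (orbitMk p)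
  have hp : orbitMk p ∈ S₀.chart.source := hS _
  -- A local section through `p` itself; the chain rule for `orbitMk ∘ lift = id` makes the
  -- differential of the quotient map surjective.
  let lift : OrbitSpace M → M := fun b => S₀.time p +ᵥ S₀.slice (S₀.chart b)
  have hch : ContMDiffAt (𝓡∂ 2) (𝓡∂ 2) ∞ S₀.chart (orbitMk p) :=
    contMDiffOn_chart.contMDiffAt (S₀.chart.open_source.mem_nhds hp)
  have hl : ContMDiffAt (𝓡∂ 2) (𝓡∂ 3) ∞ lift (orbitMk p) :=
    (contMDiff_translation (𝓡∂ 3) (S₀.time p)).contMDiffAt.comp _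
      ((S₀.contMDiffOn_slice.contMDiffAt (S₀.chart.open_target.mem_nhds (S₀.chart.map_source hp))).comp
        _ hch)
  have hlp : lift (orbitMk p) = p := S₀.vadd_slice p hp
  have hid : (orbitMk ∘ lift) =ᶠ[𝓝 (orbitMk p : OrbitSpace M)] id := by
    filter_upwards [S₀.chart.open_source.mem_nhds hp] with b hb
    change orbitMk (S₀.time p +ᵥ S₀.slice (S₀.chart b)) = b
    rw [orbitMk_vadd, S₀.mk_slice _ (S₀.chart.map_source hb), S₀.chart.left_inv hb]
  have h1 : modelDeriv (𝓡∂ 2) (𝓡∂ 2) (orbitMk ∘ lift) (orbitMk p : OrbitSpace M) =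
      ContinuousLinearMap.id ℝ _ := hid.mfderiv_eq.trans (modelDeriv_id (𝓡∂ 2) _)
  rw [modelDeriv_comp (hmk.mdifferentiable (by simp) p) (hl.mdifferentiableAt (by simp)) hlp] at h1
  exact ⟨_, DFunLike.congr_fun h1 w⟩

variable [ChartedSpace (EuclideanHalfSpace 2) (OrbitSpace M)] [IsSmoothQuotient M]

theorem contMDiff_orbitMk : ContMDiff (𝓡∂ 3) (𝓡∂ 2) ∞ (orbitMk : M → OrbitSpace M) :=
  IsSmoothQuotient.contMDiff_mk

theorem surjective_modelDeriv_orbitMk (p : M) :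
    Function.Surjective (modelDeriv (𝓡∂ 3) (𝓡∂ 2) (orbitMk : M → OrbitSpace M) p) :=
  IsSmoothQuotient.surjective_mfderiv_mk p

theorem mdifferentiableAt_orbitMk (p : M) :
    MDifferentiableAt (𝓡∂ 3) (𝓡∂ 2) (orbitMk : M → OrbitSpace M) p :=
  contMDiff_orbitMk.mdifferentiable (by simp) p

namespace OrbitChart
variable (S : OrbitChart M)

/-- Near the slice the quotient map factors through `orbitMk ∘ S.slice`, and its differential is
surjective for any smooth quotient structure. -/
theorem surjective_modelDeriv_orbitMk_slice {u : EuclideanHalfSpace 2} (hu : u ∈ S.chart.target) :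
    Function.Surjective (modelDeriv (𝓡∂ 2) (𝓡∂ 2) (orbitMk ∘ S.slice : _ → OrbitSpace M) u) := by
  have hcv : ContinuousConstVAdd ℝ M := ⟨fun s => (contMDiff_translation (𝓡∂ 3) s).continuous⟩
  set q := S.slice u with hq
  have hqs := S.slice_chart_mem hu
  have hev : (orbitMk : M → OrbitSpace M) =ᶠ[𝓝 q] (orbitMk ∘ S.slice) ∘ (S.chart ∘ orbitMk) := by
    filter_upwards [S.isOpen_preimage_source.mem_nhds hqs] with r hr
    exact (S.orbitMk_slice_chart hr).symm
  have h1 := hev.mfderiv_eq (I := 𝓡∂ 3) (I' := 𝓡∂ 2)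
  have h2 : modelDeriv (𝓡∂ 3) (𝓡∂ 2) (orbitMk : M → OrbitSpace M) q =
      modelDeriv (𝓡∂ 3) (𝓡∂ 2) ((orbitMk ∘ S.slice) ∘ (S.chart ∘ orbitMk)) q := h1
  rw [modelDeriv_comp (y := u)
    ((contMDiff_orbitMk.contMDiffAt.comp u (S.contMDiffOn_slice.contMDiffAt
      (S.chart.open_target.mem_nhds hu))).mdifferentiableAt (by simp))
    ((S.contMDiffOn_chart.contMDiffAt (S.isOpen_preimage_source.mem_nhds hqs)).mdifferentiableAt
      (by simp)) (S.chart_orbitMk_slice hu)] at h2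
  have h3 := surjective_modelDeriv_orbitMk q
  rw [h2] at h3
  exact Function.Surjective.of_comp h3

/-- A slice chart is smooth for every smooth quotient structure. -/
theorem contMDiffOn_chart' : ContMDiffOn (𝓡∂ 2) (𝓡∂ 2) ∞ S.chart S.chart.source := by
  have : IsManifold (𝓡∂ 2) ∞ (OrbitSpace M) := IsSmoothQuotient.toIsManifold
  have : IsManifold (𝓡∂ 2) 1 (OrbitSpace M) := IsManifold.of_le (n := ∞) (by simp)
  intro b₀ hb₀
  set y := extChartAt (𝓡∂ 2) b₀ with hy
  set A : EuclideanHalfSpace 2 → OrbitSpace M := orbitMk ∘ S.slice with hA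
  have hAs : ContMDiffOn (𝓡∂ 2) (𝓡∂ 2) ∞ A S.chart.target :=
    contMDiff_orbitMk.comp_contMDiffOn S.contMDiffOn_slice
  have hAe : ∀ b ∈ S.chart.source, A (S.chart b) = b := fun b hb => by
    change orbitMk (S.slice (S.chart b)) = b
    rw [S.mk_slice _ (S.chart.map_source hb), S.chart.left_inv hb]
  have hys : IsOpen y.source := isOpen_extChartAt_source b₀
  have hysm : ContMDiffOn (𝓡∂ 2) (𝓡 2) ∞ y y.source := by
    have := contMDiffOn_extChartAt (I := 𝓡∂ 2) (n := ∞) (x := b₀)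
    rwa [← extChartAt_source (𝓡∂ 2)] at this
  set D : Set (EuclideanHalfSpace 2) := S.chart.target ∩ A ⁻¹' y.source with hD
  have hDo : IsOpen D := hAs.continuousOn.isOpen_inter_preimage S.chart.open_target hys
  have hyA : ContMDiffOn (𝓡∂ 2) (𝓡 2) ∞ (y ∘ A) D :=
    hysm.comp (hAs.mono inter_subset_left) fun u hu => hu.2
  set T : Set (EuclideanSpace ℝ (Fin 2)) := (𝓡∂ 2).symm ⁻¹' D ∩ range (𝓡∂ 2) with hT
  have hTu : UniqueDiffOn ℝ T := by
    rw [hT, inter_comm]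
    exact (𝓡∂ 2).uniqueDiffOn.inter (hDo.preimage (𝓡∂ 2).continuous_symm)
  set F : EuclideanSpace ℝ (Fin 2) → EuclideanSpace ℝ (Fin 2) := (y ∘ A) ∘ (𝓡∂ 2).symm with hF
  have hFs : ContDiffOn ℝ ∞ F T := contMDiffOn_iff_contDiffOn.1
    (hyA.comp ((𝓡∂ 2).contMDiffOn_symm.mono inter_subset_right) fun z hz => hz.1)
  -- The parametrization has surjective derivative between spaces of the same dimension two.
  have hinv : ∀ u ∈ D, (fderivWithin ℝ F T ((𝓡∂ 2) u)).IsInvertible := by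
    intro u hu
    have huT : (𝓡∂ 2) u ∈ T := ⟨by rw [mem_preimage, (𝓡∂ 2).left_inv]; exact hu, mem_range_self u⟩
    have h1 : HasMFDerivAt (𝓡∂ 2) (𝓡 2) (𝓡∂ 2) u (modelDeriv (𝓡∂ 2) (𝓡 2) (𝓡∂ 2) u) :=
      ((𝓡∂ 2).contMDiff (n := ∞) |>.mdifferentiable (by simp) u).hasMFDerivAt
    have h2 : HasMFDerivWithinAt (𝓡 2) (𝓡 2) F T ((𝓡∂ 2) u) (fderivWithin ℝ F T ((𝓡∂ 2) u)) :=
      (hFs.differentiableOn (by simp) _ huT).hasFDerivWithinAt.hasMFDerivWithinAt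
    have hmaps : MapsTo (𝓡∂ 2) D T := fun v hv =>
      ⟨by rw [mem_preimage, (𝓡∂ 2).left_inv]; exact hv, mem_range_self v⟩
    have h3 := (HasMFDerivWithinAt.comp u h2 (h1.hasMFDerivWithinAt (s := D)) hmaps).hasMFDerivAt
      (hDo.mem_nhds hu)
    have h4 : F ∘ (𝓡∂ 2) = y ∘ A := by
      funext v
      simp only [hF, Function.comp_apply, (𝓡∂ 2).left_inv]
    rw [h4] at h3
    have h5 : modelDeriv (𝓡∂ 2) (𝓡 2) (y ∘ A) u =
        (fderivWithin ℝ F T ((𝓡∂ 2) u)).comp (modelDeriv (𝓡∂ 2) (𝓡 2) (𝓡∂ 2) u) := h3.mfderiv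
    rw [modelDeriv_comp (y := A u) (mdifferentiableAt_extChartAt (by
        have := hu.2
        rwa [mem_preimage, hy, extChartAt_source] at this))
      ((hAs.contMDiffAt (S.chart.open_target.mem_nhds hu.1)).mdifferentiableAt (by simp)) rfl] at h5
    obtain ⟨ey, hey⟩ := isInvertible_mfderiv_extChartAt (I := 𝓡∂ 2) (x := b₀) hu.2
    let ey' : EuclideanSpace ℝ (Fin 2) ≃L[ℝ] EuclideanSpace ℝ (Fin 2) := ey
    have hey' : modelDeriv (𝓡∂ 2) (𝓡 2) y (A u) = ey' := hey.symm
    have hsurj : Function.Surjective (fderivWithin ℝ F T ((𝓡∂ 2) u)) := by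
      have h6 : Function.Surjective ((modelDeriv (𝓡∂ 2) (𝓡 2) y (A u)).comp
          (modelDeriv (𝓡∂ 2) (𝓡∂ 2) A u)) := by
        rw [hey']
        exact ey'.surjective.comp (S.surjective_modelDeriv_orbitMk_slice hu.1)
      rw [h5] at h6
      exact Function.Surjective.of_comp h6
    have hinj : Function.Injective (fderivWithin ℝ F T ((𝓡∂ 2) u)).toLinearMap :=
      LinearMap.injective_iff_surjective.2 hsurj
    exact ⟨(LinearEquiv.ofBijective _ ⟨hinj, hsurj⟩).toContinuousLinearEquiv, by ext v; rfl⟩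
  set S₀ : Set (EuclideanSpace ℝ (Fin 2)) := y.symm ⁻¹' S.chart.source ∩ y.target with hS₀
  have hyc : ContinuousOn y.symm y.target := continuousOn_extChartAt_symm b₀
  have hS₀u : UniqueDiffOn ℝ S₀ := by
    obtain ⟨u', hu', hSu⟩ := continuousOn_iff'.1 hyc _ S.chart.open_source
    rw [hS₀, hSu, inter_comm]
    exact (uniqueDiffOn_extChartAt_target (I := 𝓡∂ 2) b₀).inter hu'
  have hmem : ∀ z ∈ S₀, S.chart (y.symm z) ∈ D := fun z hz =>
    ⟨S.chart.map_source hz.1, by rw [mem_preimage, hAe _ hz.1]; exact y.map_target hz.2⟩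
  -- The slice chart is a continuous solution of `F ∘ ψ = id`, hence smooth up to the boundary.
  have hψ : ContDiffOn ℝ ∞ (fun z => (𝓡∂ 2) (S.chart (y.symm z))) S₀ := by
    refine contDiffOn_of_comp_eq hTu hFs hS₀u contDiffOn_id
      ((𝓡∂ 2).continuous.comp_continuousOn (S.chart.continuousOn.comp (hyc.mono inter_subset_right)
        fun z hz => hz.1)) (fun z hz => ⟨?_, mem_range_self _⟩) (fun z hz => ?_) fun z hz =>
        hinv _ (hmem z hz)
    · rw [mem_preimage, (𝓡∂ 2).left_inv]
      exact hmem z hz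
    · simp only [hF, Function.comp_apply, (𝓡∂ 2).left_inv, hAe _ hz.1, id]
      exact y.right_inv hz.2
  refine (contMDiffAt_of_val ?_).contMDiffWithinAt
  have ho : IsOpen (y.source ∩ S.chart.source) := hys.inter S.chart.open_source
  have h7 : ContMDiffOn (𝓡∂ 2) (𝓡 2) ∞ ((fun z => (𝓡∂ 2) (S.chart (y.symm z))) ∘ y)
      (y.source ∩ S.chart.source) :=
    (contMDiffOn_iff_contDiffOn.2 hψ).comp (hysm.mono inter_subset_left) fun b hb =>
      ⟨by rw [mem_preimage, y.left_inv hb.1]; exact hb.2, y.map_source hb.1⟩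
  have hb₀m : y.source ∩ S.chart.source ∈ 𝓝 b₀ := ho.mem_nhds ⟨mem_extChartAt_source b₀, hb₀⟩
  refine (h7.contMDiffAt hb₀m).congr_of_eventuallyEq ?_
  filter_upwards [hb₀m] with b hb
  change (S.chart b).val = (S.chart (y.symm (y b))).val
  rw [y.left_inv hb.1]

end OrbitChart

/-- A submersion sends interior points to interior points. Conversely a slice chart at a boundary
point has boundary coordinate zero, and being a local diffeomorphism it detects boundary points of
the quotient. -/
theorem orbitMk_mem_boundary_iff {p : M} :
    orbitMk p ∈ (𝓡∂ 2).boundary (OrbitSpace M) ↔ p ∈ (𝓡∂ 3).boundary M := by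
  have : IsManifold (𝓡∂ 2) ∞ (OrbitSpace M) := IsSmoothQuotient.toIsManifold
  refine ⟨fun h => ?_, fun h => ?_⟩
  · by_contra hp
    have hp' : (𝓡∂ 3).IsInteriorPoint p := (𝓡∂ 3).isInteriorPoint_iff_not_isBoundaryPoint p |>.2 hp
    exact (𝓡∂ 2).isInteriorPoint_iff_not_isBoundaryPoint _ |>.1
      ((mdifferentiableAt_orbitMk p).isInteriorPoint_of_surjective_mfderiv
        (surjective_modelDeriv_orbitMk p) hp') h
  · obtain ⟨S, hS, hb⟩ := exists_orbitChart p
    have hA : ContMDiffOn (𝓡∂ 2) (𝓡∂ 2) ∞ S.chart.symm S.chart.target :=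
      (contMDiff_orbitMk.comp_contMDiffOn S.contMDiffOn_slice).congr fun u hu => (S.mk_slice u hu).symm
    have hloc : IsLocalDiffeomorphAt (𝓡∂ 2) (𝓡∂ 2) ∞ S.chart (orbitMk p) :=
      ⟨{ toPartialEquiv := S.chart.toPartialEquiv
         open_source := S.chart.open_source
         open_target := S.chart.open_target
         contMDiffOn_toFun := S.contMDiffOn_chart'
         contMDiffOn_invFun := hA }, hS, fun _ _ => rfl⟩
    refine (hloc.isBoundaryPoint_iff (by simp)).2 ?_
    rw [(𝓡∂ 2).isBoundaryPoint_iff, frontier_range_modelWithCornersEuclideanHalfSpace]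
    exact (hb h).symm

end QuotientStructure


/-! ### Global fibre coordinates and the sections they define. -/

noncomputable section Section
variable {M : Type*} [TopologicalSpace M] [ChartedSpace (EuclideanHalfSpace 3) M] [AddAction ℝ M]
  [T2Space M] [IsManifold (𝓡∂ 3) ∞ M] [ContMDiffVAdd 𝓘(ℝ, ℝ) (𝓡∂ 3) ∞ ℝ M] [ProperVAdd ℝ M]

theorem OrbitChart.time_vadd (S : OrbitChart M) {q : M} (hq : orbitMk q ∈ S.chart.source) (s : ℝ) :
    S.time (s +ᵥ q) = S.time q + s := by
  have h1 := S.vadd_slice q hq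
  have h2 := S.vadd_slice (s +ᵥ q) (by rwa [orbitMk_vadd])
  rw [orbitMk_vadd] at h2
  set m := S.slice (S.chart (orbitMk q))
  have h3 : (-(S.time (s +ᵥ q)) + (s + S.time q)) +ᵥ m = m := by
    rw [← vadd_vadd, ← vadd_vadd, h1]
    nth_rewrite 2 [← h2]
    rw [neg_vadd_vadd]
  linarith [eq_zero_of_vadd_eq h3]

variable [ChartedSpace (EuclideanHalfSpace 2) (OrbitSpace M)] [IsSmoothQuotient M]

/-- Equivariance is an affine condition, so local times of slices can be averaged with a partition
of unity on the orbit space, which is Hausdorff by properness. -/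
theorem exists_trivialization [SecondCountableTopology M] :
    ∃ t : M → ℝ, IsTrivialization (univ : Set (OrbitSpace M)) t := by
  have hmf : IsManifold (𝓡∂ 2) ∞ (OrbitSpace M) := IsSmoothQuotient.toIsManifold
  have hcv : ContinuousConstVAdd ℝ M := ⟨fun s => (contMDiff_translation (𝓡∂ 3) s).continuous⟩
  have : T2Space (OrbitSpace M) := t2Space_quotient_addAction_of_properVAdd
  have : SecondCountableTopology (OrbitSpace M) := ContinuousConstVAdd.secondCountableTopology
  have : LocallyCompactSpace (EuclideanHalfSpace 2) := (𝓡∂ 2).locallyCompactSpace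
  have : LocallyCompactSpace (OrbitSpace M) :=
    ChartedSpace.locallyCompactSpace (EuclideanHalfSpace 2) (OrbitSpace M)
  have hex : ∀ b : OrbitSpace M, ∃ S : OrbitChart M, b ∈ S.chart.source := fun b => by
    obtain ⟨p, rfl⟩ := surjective_orbitMk b
    obtain ⟨S, hS, -⟩ := exists_orbitChart p
    exact ⟨S, hS⟩
  choose S hS using hex
  obtain ⟨ρ, hρ⟩ := SmoothPartitionOfUnity.exists_isSubordinate (𝓡∂ 2) (isClosed_univ (X := OrbitSpace M))
    (fun b => (S b).chart.source) (fun b => (S b).chart.open_source)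
    (fun b _ => mem_iUnion_of_mem b (hS b))
  have hlf : LocallyFinite fun b => Function.support fun p : M => ρ b (orbitMk p) * (S b).time p :=
    LocallyFinite.subset (LocallyFinite.preimage_continuous (g := (orbitMk : M → OrbitSpace M))
      ρ.locallyFinite isOpenQuotientMap_orbitMk.continuous) fun b p hp => left_ne_zero_of_mul hp
  refine ⟨fun p => ∑ᶠ b, ρ b (orbitMk p) * (S b).time p,
    (contMDiff_finsum (fun b => ?_) hlf).contMDiffOn, fun p _ s => ?_⟩
  · intro p
    by_cases hp : orbitMk p ∈ (S b).chart.source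
    · refine ContMDiffAt.mul ?_ ?_
      · exact (ρ b).contMDiff.contMDiffAt.comp p contMDiff_orbitMk.contMDiffAt
      · exact (S b).contMDiffOn_time.contMDiffAt ((S b).isOpen_preimage_source.mem_nhds hp)
    · have hp' : p ∈ (orbitMk ⁻¹' (tsupport (ρ b))ᶜ : Set M) := fun h => hp (hρ b h)
      have ho : IsOpen (orbitMk ⁻¹' (tsupport (ρ b))ᶜ : Set M) :=
        (isClosed_tsupport _).isOpen_compl.preimage isOpenQuotientMap_orbitMk.continuous
      refine (contMDiffAt_const (c := (0 : ℝ))).congr_of_eventuallyEq ?_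
      filter_upwards [ho.mem_nhds hp'] with q hq
      have : ρ b (orbitMk q) = 0 := image_eq_zero_of_notMem_tsupport hq
      simp [this]
  · have hfin : ∀ c : OrbitSpace M → ℝ, (Function.support fun b => ρ b (orbitMk p) * c b).Finite :=
      fun c => (ρ.locallyFinite.point_finite (orbitMk p)).subset fun b hb => left_ne_zero_of_mul hb
    -- Weights are constant on orbits, and each local time with nonzero weight grows by `s`; since
    -- the weights sum to one, so does the average.
    have h1 : ∀ b, ρ b (orbitMk (s +ᵥ p)) * (S b).time (s +ᵥ p) =
        ρ b (orbitMk p) * (S b).time p + ρ b (orbitMk p) * s := by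
      intro b
      rw [orbitMk_vadd]
      by_cases h0 : ρ b (orbitMk p) = 0
      · simp [h0]
      · rw [(S b).time_vadd (hρ b (subset_tsupport _ h0)), mul_add]
    simp only [h1]
    rw [finsum_add_distrib (hfin _) (hfin fun _ => s), ← finsum_mul,
      ρ.sum_eq_one (mem_univ _), one_mul]

/-- The section of the quotient map on which the fibre coordinate `t` vanishes. -/
def orbitSection (t : M → ℝ) (b : OrbitSpace M) : M := -t b.out +ᵥ b.out

variable {t : M → ℝ} {V : Set (OrbitSpace M)}

theorem orbitMk_orbitSection (b : OrbitSpace M) : orbitMk (orbitSection t b) = b := by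
  rw [orbitSection, orbitMk_vadd]
  exact Quotient.out_eq _

theorem orbitSection_orbitMk (ht : IsTrivialization V t) {p : M} (hp : orbitMk p ∈ V) :
    orbitSection t (orbitMk p) = -t p +ᵥ p := by
  have he : (orbitMk (Quotient.out (orbitMk p : OrbitSpace M)) : OrbitSpace M) = orbitMk p :=
    Quotient.out_eq _
  obtain ⟨s, hs⟩ := orbitMk_eq_iff.1 he
  rw [orbitSection, ← hs, ht.equivariant p hp, vadd_vadd]
  congr 1
  ring

theorem vadd_orbitSection (ht : IsTrivialization V t) {p : M} (hp : orbitMk p ∈ V) :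
    t p +ᵥ orbitSection t (orbitMk p) = p := by
  rw [orbitSection_orbitMk ht hp, vadd_neg_vadd]

/-- Although defined with arbitrary representatives, the section is locally a slice translated by
`-t`. -/
theorem contMDiffOn_orbitSection (hV : IsOpen V) (ht : IsTrivialization V t) :
    ContMDiffOn (𝓡∂ 2) (𝓡∂ 3) ∞ (orbitSection t) V := by
  have hmf : IsManifold (𝓡∂ 2) ∞ (OrbitSpace M) := IsSmoothQuotient.toIsManifold
  intro b hbV
  obtain ⟨p, rfl⟩ := surjective_orbitMk b
  obtain ⟨S, hS, -⟩ := exists_orbitChart p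
  have hbr : ∀ b ∈ S.chart.source, orbitMk (S.slice (S.chart b)) = b := fun b hb => by
    rw [S.mk_slice _ (S.chart.map_source hb), S.chart.left_inv hb]
  have h1 : ContMDiffOn (𝓡∂ 2) (𝓡∂ 3) ∞ (fun b => S.slice (S.chart b)) (S.chart.source ∩ V) :=
    (S.contMDiffOn_slice.comp S.contMDiffOn_chart' fun b hb => S.chart.map_source hb).mono
      inter_subset_left
  have h2 : ContMDiffOn (𝓡∂ 2) (𝓡∂ 3) ∞
      (fun b => -t (S.slice (S.chart b)) +ᵥ S.slice (S.chart b)) (S.chart.source ∩ V) := by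
    refine (contMDiff_action (𝓡∂ 3)).comp_contMDiffOn
      ((contDiff_neg.contMDiff.comp_contMDiffOn (ht.contMDiffOn.comp h1 fun b hb => ?_)).prodMk h1)
    rw [mem_preimage, mem_preimage, hbr b hb.1]
    exact hb.2
  have hm := (S.chart.open_source.inter hV).mem_nhds ⟨hS, hbV⟩
  refine ((h2.contMDiffAt hm).congr_of_eventuallyEq ?_).contMDiffWithinAt
  filter_upwards [hm] with b hb
  rw [← orbitSection_orbitMk ht (by rw [hbr b hb.1]; exact hb.2), hbr b hb.1]

theorem contMDiff_orbitSection (ht : IsTrivialization univ t) :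
    ContMDiff (𝓡∂ 2) (𝓡∂ 3) ∞ (orbitSection t) :=
  contMDiffOn_univ.1 (contMDiffOn_orbitSection isOpen_univ ht)

/-- The part of the bundle over a compact set in which the fibre coordinate is bounded is compact. -/
theorem isCompact_tube (hV : IsOpen V) (ht : IsTrivialization V t) {K : Set (OrbitSpace M)}
    (hK : IsCompact K) (hKV : K ⊆ V) (R : ℝ) : IsCompact {p : M | orbitMk p ∈ K ∧ |t p| ≤ R} := by
  have hcont : ContinuousOn (fun z : ℝ × OrbitSpace M => z.1 +ᵥ orbitSection t z.2) (Icc (-R) R ×ˢ K) :=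
    (contMDiff_action (𝓡∂ 3)).continuous.comp_continuousOn (continuousOn_fst.prodMk
      (((contMDiffOn_orbitSection hV ht).continuousOn.mono hKV).comp continuousOn_snd fun z hz => hz.2))
  -- The trivialization identifies the tube with the compact set `[-R, R] × K`.
  have himg : {p : M | orbitMk p ∈ K ∧ |t p| ≤ R} =
      (fun z : ℝ × OrbitSpace M => z.1 +ᵥ orbitSection t z.2) '' (Icc (-R) R ×ˢ K) := by
    ext p
    constructor
    · rintro ⟨h1, h2⟩
      exact ⟨(t p, orbitMk p), ⟨abs_le.1 h2, h1⟩, vadd_orbitSection ht (hKV h1)⟩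
    · rintro ⟨⟨r, b⟩, ⟨h1, h2⟩, rfl⟩
      have hb : orbitMk (orbitSection t b) ∈ V := by rw [orbitMk_orbitSection]; exact hKV h2
      have ht0 : t (orbitSection t b) = 0 := by
        have := vadd_orbitSection ht hb
        rw [orbitMk_orbitSection] at this
        exact eq_zero_of_vadd_eq this
      refine ⟨?_, ?_⟩
      · simp only [orbitMk_vadd, orbitMk_orbitSection]
        exact h2
      · simp only [ht.equivariant _ hb, ht0, zero_add]
        exact abs_le.2 h1
  rw [himg]
  exact (isCompact_Icc.prod hK).image_of_continuousOn hcont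

end Section


/-! ### Primitives of bump functions. -/

noncomputable section Cutoff

/-- `C` is a primitive of the density `ρ` of total mass one, and `ρ` is supported in `[-R, R]`. -/
structure IsCutoff (ρ C : ℝ → ℝ) (R : ℝ) : Prop where
  contDiff : ContDiff ℝ ∞ C
  hasDerivAt : ∀ x, HasDerivAt C (ρ x) x
  eq_zero : ∀ x, x ≤ -R → C x = 0
  eq_one : ∀ x, R ≤ x → C x = 1
  density_eq_zero : ∀ x, R < |x| → ρ x = 0
  integral_eq_one : ∫ x, ρ x = 1

theorem exists_isCutoff {ρ : ℝ → ℝ} (hρ : ContDiff ℝ ∞ ρ) (hc : HasCompactSupport ρ)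
    (h1 : ∫ r, ρ r = 1) : ∃ C R, IsCutoff ρ C R := by
  obtain ⟨R, hR⟩ := hc.isCompact.isBounded.subset_closedBall (0 : ℝ)
  have h0 : ∀ x, R < |x| → ρ x = 0 := fun x hx => image_eq_zero_of_notMem_tsupport fun h => by
    have := hR h
    rw [mem_closedBall_zero_iff, Real.norm_eq_abs] at this
    linarith
  have hd : ∀ x, HasDerivAt (fun x => ∫ r in (-R)..x, ρ r) (ρ x) x := fun x =>
    intervalIntegral.integral_hasDerivAt_right (hρ.continuous.intervalIntegrable _ _)
      (hρ.continuous.stronglyMeasurableAtFilter _ _) hρ.continuous.continuousAt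
  have hsupp : ∀ x, x ≠ -R → x ∉ Icc (-R) R → ρ x = 0 := fun x _ hx => h0 x (by
    by_contra hlt
    exact hx (abs_le.1 (not_lt.1 hlt)))
  refine ⟨fun x => ∫ r in (-R)..x, ρ r, R, ?_, hd, fun x hx => ?_, fun x hx => ?_, h0, h1⟩
  · rw [contDiff_infty_iff_deriv]
    refine ⟨fun x => (hd x).differentiableAt, ?_⟩
    rwa [show deriv (fun x => ∫ r in (-R)..x, ρ r) = ρ from funext fun x => (hd x).deriv]
  · rw [intervalIntegral.integral_symm, neg_eq_zero, intervalIntegral.integral_of_le hx,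
      MeasureTheory.integral_Ioc_eq_integral_Ioo]
    refine MeasureTheory.setIntegral_eq_zero_of_forall_eq_zero fun r hr => h0 r ?_
    exact lt_abs.2 (Or.inr (by linarith [hr.2]))
  · rw [← h1]
    by_cases hRR : -R ≤ x
    · rw [intervalIntegral.integral_of_le hRR, ← MeasureTheory.integral_Icc_eq_integral_Ioc]
      refine MeasureTheory.setIntegral_eq_integral_of_forall_compl_eq_zero fun r hr => h0 r ?_
      by_contra hlt
      have := abs_le.1 (not_lt.1 hlt)
      exact hr ⟨this.1, this.2.trans hx⟩
    -- Here `R ≤ x < -R`, so `R` is negative and `ρ` vanishes everywhere, contradicting total mass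
    -- one.
    · have hz : ρ = 0 := funext fun r => h0 r (by
        have := abs_nonneg r
        linarith)
      rw [hz] at h1
      simp at h1

end Cutoff

/-! ### Fibre integration as descent of the orbit integral. -/

noncomputable section FiberIntegration
variable {M : Type*} [TopologicalSpace M] [ChartedSpace (EuclideanHalfSpace 3) M] [AddAction ℝ M]
  [T2Space M] [IsManifold (𝓡∂ 3) ∞ M] [ContMDiffVAdd 𝓘(ℝ, ℝ) (𝓡∂ 3) ∞ ℝ M] [ProperVAdd ℝ M]
  [ChartedSpace (EuclideanHalfSpace 2) (OrbitSpace M)] [IsSmoothQuotient M] {k : ℕ}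

theorem modelDeriv_orbitMk_velocity (p : M) :
    modelDeriv (𝓡∂ 3) (𝓡∂ 2) (orbitMk : M → OrbitSpace M) p (velocity (𝓡∂ 3) p) = 0 := by
  have h := modelDeriv_comp (mdifferentiableAt_orbitMk p) (mdifferentiableAt_orbit (𝓡∂ 3) p 0)
    (zero_vadd ℝ p)
  have e : (orbitMk ∘ fun r : ℝ => r +ᵥ p) = fun _ => (orbitMk p : OrbitSpace M) :=
    funext fun r => orbitMk_vadd r p
  rw [e] at h
  have h0 : modelDeriv 𝓘(ℝ, ℝ) (𝓡∂ 2) (fun _ : ℝ => (orbitMk p : OrbitSpace M)) 0 = 0 := mfderiv_const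
  rw [h0] at h
  exact (DFunLike.congr_fun h 1).symm

theorem IsTrivialization.modelDeriv_velocity {V : Set (OrbitSpace M)} (hV : IsOpen V) {t : M → ℝ}
    (ht : IsTrivialization V t) {p : M} (hp : orbitMk p ∈ V) :
    modelDeriv (𝓡∂ 3) 𝓘(ℝ, ℝ) t p (velocity (𝓡∂ 3) p) = 1 := by
  have hm : MDifferentiableAt (𝓡∂ 3) 𝓘(ℝ, ℝ) t ((0 : ℝ) +ᵥ p) := by
    rw [zero_vadd]
    exact (ht.contMDiffOn.contMDiffAt ((hV.preimage contMDiff_orbitMk.continuous).mem_nhds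
      hp)).mdifferentiableAt (by simp)
  have h1 := hasDerivAt_comp_vadd (𝓡∂ 3) hm
  rw [zero_vadd] at h1
  have h2 : (fun r : ℝ => t (r +ᵥ p)) = fun r => t p + r := funext fun r => ht.equivariant p hp r
  rw [h2] at h1
  exact h1.unique ((hasDerivAt_id (0 : ℝ)).const_add (t p))

/-- In the multilinear expansion every term other than `g w` contains `X` in some slot. A horizontal
form is therefore insensitive to vertical changes of its arguments. -/
theorem ContinuousAlternatingMap.map_add_smul_of_forall {E : Type} [NormedAddCommGroup E]
    [NormedSpace ℝ E] (g : E [⋀^Fin k]→L[ℝ] ℝ) {X : E}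
    (hg : ∀ (w : Fin k → E) (i : Fin k), w i = X → g w = 0) (w : Fin k → E) (c : Fin k → ℝ) :
    g (fun i => w i + c i • X) = g w := by
  have h := g.toMultilinearMap.map_add_univ w (fun i => c i • X)
  refine h.trans ((Finset.sum_eq_single Finset.univ (fun s _ hs => ?_) (by simp)).trans ?_)
  · obtain ⟨i, hi⟩ : ∃ i, i ∉ s := by
      by_contra! hcon
      exact hs (Finset.eq_univ_iff_forall.2 hcon)
    have e : s.piecewise w (fun i => c i • X) =
        Function.update (s.piecewise w (fun i => c i • X)) i (c i • X) := by
      rw [eq_comm, Function.update_eq_self_iff, Finset.piecewise_eq_of_notMem _ _ _ hi]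
    rw [e, MultilinearMap.map_update_smul]
    have : g (Function.update (s.piecewise w (fun i => c i • X)) i X) = 0 := hg _ i (by simp)
    exact (congrArg _ this).trans (smul_zero _)
  · rw [Finset.piecewise_univ]
    rfl

/-- Integration along the fibres, computed on the section given by a trivialization. -/
def fiberPush (t : M → ℝ) (φ : DForm (𝓡∂ 3) M (k + 1)) : DForm (𝓡∂ 2) (OrbitSpace M) k :=
  pullbackForm (𝓡∂ 3) (𝓡∂ 2) (orbitSection t) k (orbitIntegral φ)

section Push
variable {t : M → ℝ}

/-- Projecting to the base and lifting by the section is translation by `-t`, whose differential is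
that of a fixed translation plus a multiple of the velocity. The orbit integral is invariant and
horizontal, so it does not notice the difference and descends to the base. -/
theorem pullbackForm_orbitMk_fiberPush (ht : IsTrivialization univ t) {φ : DForm (𝓡∂ 3) M (k + 1)}
    (hφ : φ.Smooth) (hc : IsCompact φ.supp) :
    pullbackForm (𝓡∂ 2) (𝓡∂ 3) orbitMk k (fiberPush t φ) = orbitIntegral φ := by
  have hts : ContMDiff (𝓡∂ 3) 𝓘(ℝ, ℝ) ∞ t := contMDiffOn_univ.1 (by simpa using ht.contMDiffOn)
  funext p
  ext w
  change (orbitIntegral φ).modelValue (orbitSection t (orbitMk p)) (fun i =>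
    modelDeriv (𝓡∂ 2) (𝓡∂ 3) (orbitSection t) (orbitMk p)
      (modelDeriv (𝓡∂ 3) (𝓡∂ 2) orbitMk p (w i))) = (orbitIntegral φ).modelValue p w
  have hn : MDifferentiableAt (𝓡∂ 3) 𝓘(ℝ, ℝ) (fun q => -t q) p :=
    (contDiff_neg.contMDiff.comp hts).mdifferentiable (by simp) p
  have hpair : HasMFDerivAt (𝓡∂ 3) (𝓘(ℝ, ℝ).prod (𝓡∂ 3)) (fun q : M => (-t q, q)) p
      ((modelDeriv (𝓡∂ 3) 𝓘(ℝ, ℝ) (fun q => -t q) p).prod (ContinuousLinearMap.id ℝ _)) :=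
    hn.hasMFDerivAt.prodMk (hasMFDerivAt_id p)
  have h1 : modelDeriv (𝓡∂ 3) (𝓡∂ 3) (orbitSection t ∘ orbitMk) p =
      (modelDeriv (𝓘(ℝ, ℝ).prod (𝓡∂ 3)) (𝓡∂ 3) (fun z : ℝ × M => z.1 +ᵥ z.2) (-t p, p)).comp
        ((modelDeriv (𝓡∂ 3) 𝓘(ℝ, ℝ) (fun q => -t q) p).prod (ContinuousLinearMap.id ℝ _)) := by
    have e : orbitSection t ∘ orbitMk = (fun z : ℝ × M => z.1 +ᵥ z.2) ∘ fun q : M => (-t q, q) :=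
      funext fun q => orbitSection_orbitMk ht (mem_univ _)
    rw [e, modelDeriv_comp ((contMDiff_action (𝓡∂ 3) (M := M)).mdifferentiable (by simp) (-t p, p))
      hpair.mdifferentiableAt rfl]
    exact congrArg _ hpair.mfderiv
  rw [modelDeriv_comp ((contMDiff_orbitSection ht).mdifferentiable (by simp) _)
    (mdifferentiableAt_orbitMk p) rfl] at h1
  have h2 : ∀ i, modelDeriv (𝓡∂ 2) (𝓡∂ 3) (orbitSection t) (orbitMk p)
      (modelDeriv (𝓡∂ 3) (𝓡∂ 2) orbitMk p (w i)) = flowDeriv (𝓡∂ 3) (-t p) p (w i) +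
        (modelDeriv (𝓡∂ 3) 𝓘(ℝ, ℝ) (fun q => -t q) p (w i)) • velocity (𝓡∂ 3) (-t p +ᵥ p) := by
    intro i
    refine (DFunLike.congr_fun h1 (w i)).trans ?_
    rw [add_comm]
    exact modelDeriv_action (𝓡∂ 3) (-t p) p _ _
  simp only [h2]
  rw [orbitSection_orbitMk ht (mem_univ _), ContinuousAlternatingMap.map_add_smul_of_forall]
  · exact orbitIntegral_vadd hφ hc (-t p) p w
  · exact fun w' i hi => orbitIntegral_velocity hφ hc _ hi

theorem isFiberIntegral_fiberPush (ht : IsTrivialization univ t) {φ : DForm (𝓡∂ 3) M (k + 1)}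
    (hφ : φ.Smooth) (hc : IsCompact φ.supp) : IsFiberIntegral rfl φ (fiberPush t φ) := by
  intro p w
  have h : pullbackForm (𝓡∂ 2) (𝓡∂ 3) orbitMk k (fiberPush t φ) p w = orbitIntegral φ p w := by
    rw [pullbackForm_orbitMk_fiberPush ht hφ hc]
  refine h.trans ((orbitIntegral_apply hφ hc p w).trans ?_)
  congr 1
  funext s
  change φ.modelValue (s +ᵥ p) _ = φ.modelValue (s +ᵥ p) _
  congr 1
  rw [← modelDeriv_orbit]
  rfl

theorem fiberPush_eq_zero {φ : DForm (𝓡∂ 3) M (k + 1)} {b : OrbitSpace M}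
    (hb : b ∉ orbitMk '' φ.supp) : fiberPush t φ b = 0 := by
  have h0 : orbitIntegral φ (orbitSection t b) = 0 := orbitIntegral_eq_zero fun r hr =>
    hb ⟨_, hr, by rw [orbitMk_vadd, orbitMk_orbitSection]⟩
  ext w
  change orbitIntegral φ (orbitSection t b) _ = 0
  rw [h0]
  rfl

theorem isClosed_orbitMk_image {K : Set M} (hK : IsCompact K) :
    IsClosed (orbitMk '' K : Set (OrbitSpace M)) := by
  have : T2Space (OrbitSpace M) := t2Space_quotient_addAction_of_properVAdd
  exact (hK.image contMDiff_orbitMk.continuous).isClosed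

variable [LocallyCompactSpace M]

theorem smooth_fiberPush (ht : IsTrivialization univ t) {φ : DForm (𝓡∂ 3) M (k + 1)} (hφ : φ.Smooth)
    (hc : IsCompact φ.supp) : (fiberPush t φ).Smooth := by
  have hmf : IsManifold (𝓡∂ 2) ∞ (OrbitSpace M) := IsSmoothQuotient.toIsManifold
  exact DForm.smooth_iff_smoothAt.2 fun b =>
    ((smooth_orbitIntegral hφ hc).smoothAt _).pullbackForm (contMDiff_orbitSection ht b)

theorem fiberPush_mem {V : Set (OrbitSpace M)} (ht : IsTrivialization univ t)
    {φ : DForm (𝓡∂ 3) M (k + 1)} (hφ : φ ∈ compactForms (𝓡∂ 3) (orbitMk ⁻¹' V) (k + 1)) :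
    fiberPush t φ ∈ compactForms (𝓡∂ 2) V k := by
  have hs : (fiberPush t φ).supp ⊆ orbitMk '' φ.supp :=
    DForm.supp_subset_of_isClosed (isClosed_orbitMk_image hφ.2.1) fun b hb => fiberPush_eq_zero hb
  refine ⟨smooth_fiberPush ht hφ.1 hφ.2.1, (hφ.2.1.image contMDiff_orbitMk.continuous).of_isClosed_subset
    isClosed_closure hs, hs.trans ?_⟩
  rintro _ ⟨p, hp, rfl⟩
  exact hφ.2.2 hp

theorem extD_fiberPush (ht : IsTrivialization univ t) {φ : DForm (𝓡∂ 3) M (k + 1)} (hφ : φ.Smooth)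
    (hc : IsCompact φ.supp) : (fiberPush t φ).extD = -fiberPush t φ.extD := by
  have hmf : IsManifold (𝓡∂ 2) ∞ (OrbitSpace M) := IsSmoothQuotient.toIsManifold
  funext b
  have h1 : (fiberPush t φ).extD b = pullbackForm (𝓡∂ 3) (𝓡∂ 2) (orbitSection t) (k + 1)
      (orbitIntegral φ).extD b :=
    extD_pullbackForm ((smooth_orbitIntegral hφ hc).smoothAt _) (contMDiff_orbitSection ht b)
  rw [h1, eq_neg_of_add_eq_zero_left (extD_orbitIntegral hφ hc), map_neg]
  rfl

theorem fiberPush_extD_zero {φ : DForm (𝓡∂ 3) M 0} (hφ : φ.Smooth) (hc : IsCompact φ.supp) :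
    fiberPush t φ.extD = 0 := by
  rw [fiberPush, orbitIntegral_extD_zero hφ hc, map_zero]

theorem fiberPush_add {φ ψ : DForm (𝓡∂ 3) M (k + 1)} (hφ : φ.Smooth) (hc : IsCompact φ.supp)
    (hψ : ψ.Smooth) (hc' : IsCompact ψ.supp) :
    fiberPush t (φ + ψ) = fiberPush t φ + fiberPush t ψ := by
  rw [fiberPush, orbitIntegral_add hφ hc hψ hc', map_add]
  rfl

theorem fiberPush_smul (c : ℝ) (φ : DForm (𝓡∂ 3) M (k + 1)) :
    fiberPush t (c • φ) = c • fiberPush t φ := by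
  rw [fiberPush, orbitIntegral_smul, map_smul]
  rfl

end Push

end FiberIntegration


/-! ### Products of functions and forms. -/

noncomputable section MulForm
variable {E : Type} [NormedAddCommGroup E] [NormedSpace ℝ E] {H : Type} [TopologicalSpace H]
  {I : ModelWithCorners ℝ E H} {X : Type*} [TopologicalSpace X] [ChartedSpace H X] {k : ℕ}

/-- The product of a function and a form. -/
def mulForm (c : X → ℝ) (β : DForm I X k) : DForm I X k := fun x => c x • β x

theorem mulForm_apply (c : X → ℝ) (β : DForm I X k) (x : X) : mulForm c β x = c x • β x := rfl

theorem mulForm_add (c : X → ℝ) (β γ : DForm I X k) : mulForm c (β + γ) = mulForm c β + mulForm c γ :=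
  funext fun _ => smul_add _ _ _

theorem mulForm_neg (c : X → ℝ) (β : DForm I X k) : mulForm c (-β) = -mulForm c β :=
  funext fun _ => smul_neg _ _

theorem mulForm_smul (c : X → ℝ) (r : ℝ) (β : DForm I X k) : mulForm c (r • β) = r • mulForm c β :=
  funext fun x => (smul_comm (c x) r (β x) : c x • r • β x = r • c x • β x)

theorem supp_mulForm_subset (c : X → ℝ) (β : DForm I X k) : (mulForm c β).supp ⊆ β.supp :=
  DForm.supp_subset_of_isClosed isClosed_closure fun x hx => by
    rw [mulForm_apply, DForm.eq_zero_of_notMem_supp hx, smul_zero]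

/-- Smoothness of `c` is required only near the support of the form, as the fibre coordinate is only
controlled over `V`. -/
theorem smooth_mulForm [IsManifold I ∞ X] {W : Set X} (hW : IsOpen W) {c : X → ℝ}
    (hc : ContMDiffOn I 𝓘(ℝ, ℝ) ∞ c W) {β : DForm I X k} (hβ : β.Smooth) (hs : β.supp ⊆ W) :
    (mulForm c β).Smooth := DForm.smooth_iff_smoothAt.2 fun x => by
  by_cases hx : x ∈ β.supp
  · exact (hβ.smoothAt x).smul (hc.contMDiffAt (hW.mem_nhds (hs hx)))
  · exact DForm.SmoothAt.of_notMem_supp fun h => hx (supp_mulForm_subset c β h)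

theorem DForm.extD_eq_zero_of_notMem_supp {β : DForm I X k} {x : X} (hx : x ∉ β.supp) :
    β.extD x = 0 := DForm.eq_zero_of_notMem_supp fun h => hx (β.supp_extD h)

theorem DForm.Smooth.neg {α : DForm I X k} (hα : α.Smooth) : (-α).Smooth :=
  fun x₀ => (hα x₀).neg

theorem DForm.Smooth.sub {α β : DForm I X k} (hα : α.Smooth) (hβ : β.Smooth) : (α - β).Smooth :=
  fun x₀ => (hα x₀).sub (hβ x₀)

theorem DForm.extD_neg (α : DForm I X k) : (-α).extD = -α.extD := by
  have e : ∀ {l : ℕ} (β : DForm I X l), -β = (-1 : ℝ) • β := fun β =>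
    funext fun x => (neg_one_smul ℝ (β x)).symm
  rw [e, e, DForm.extD_smul]

theorem DForm.Smooth.extD_sub [IsManifold I ∞ X] {α β : DForm I X k} (hα : α.Smooth) (hβ : β.Smooth) :
    (α - β).extD = α.extD - β.extD := by
  rw [sub_eq_add_neg, hα.extD_add hβ.neg, DForm.extD_neg, ← sub_eq_add_neg]

end MulForm

/-! ### The lift by a bump form and the Poincaré homotopy. -/

noncomputable section Lift
variable {M : Type*} [TopologicalSpace M] [ChartedSpace (EuclideanHalfSpace 3) M] [AddAction ℝ M]
  [T2Space M] [IsManifold (𝓡∂ 3) ∞ M] [ContMDiffVAdd 𝓘(ℝ, ℝ) (𝓡∂ 3) ∞ ℝ M] [ProperVAdd ℝ M]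
  [ChartedSpace (EuclideanHalfSpace 2) (OrbitSpace M)] [IsSmoothQuotient M] {k : ℕ}

/-- Pullback of forms along the quotient map. -/
def orbitPullback (α : DForm (𝓡∂ 2) (OrbitSpace M) k) : DForm (𝓡∂ 3) M k :=
  pullbackForm (𝓡∂ 2) (𝓡∂ 3) orbitMk k α

theorem smooth_orbitPullback {α : DForm (𝓡∂ 2) (OrbitSpace M) k} (hα : α.Smooth) :
    (orbitPullback α).Smooth := by
  have hmf : IsManifold (𝓡∂ 2) ∞ (OrbitSpace M) := IsSmoothQuotient.toIsManifold
  exact DForm.smooth_iff_smoothAt.2 fun p => (hα.smoothAt _).pullbackForm (contMDiff_orbitMk p)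

theorem extD_orbitPullback {α : DForm (𝓡∂ 2) (OrbitSpace M) k} (hα : α.Smooth) :
    (orbitPullback α).extD = orbitPullback α.extD := by
  have hmf : IsManifold (𝓡∂ 2) ∞ (OrbitSpace M) := IsSmoothQuotient.toIsManifold
  exact funext fun p => extD_pullbackForm (hα.smoothAt _) (contMDiff_orbitMk p)

theorem orbitPullback_eq_zero {α : DForm (𝓡∂ 2) (OrbitSpace M) k} {p : M} (h : α (orbitMk p) = 0) :
    orbitPullback α p = 0 := by
  ext w
  change α (orbitMk p) _ = 0
  rw [h]
  rfl

theorem supp_orbitPullback (α : DForm (𝓡∂ 2) (OrbitSpace M) k) :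
    (orbitPullback α).supp ⊆ orbitMk ⁻¹' α.supp :=
  DForm.supp_subset_of_isClosed (isClosed_closure.preimage contMDiff_orbitMk.continuous) fun _ hp =>
    orbitPullback_eq_zero (DForm.eq_zero_of_notMem_supp hp)

theorem orbitPullback_velocity (α : DForm (𝓡∂ 2) (OrbitSpace M) k) (p : M)
    {w : Fin k → EuclideanSpace ℝ (Fin 3)} {i : Fin k} (h : w i = velocity (𝓡∂ 3) p) :
    (orbitPullback α).modelValue p w = 0 := by
  refine (α (orbitMk p)).map_coord_zero i ?_
  rw [h]
  exact modelDeriv_orbitMk_velocity p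

theorem orbitPullback_vadd (α : DForm (𝓡∂ 2) (OrbitSpace M) k) (s : ℝ) (p : M)
    (w : Fin k → EuclideanSpace ℝ (Fin 3)) :
    (orbitPullback α).modelValue (s +ᵥ p) (fun i => flowDeriv (𝓡∂ 3) s p (w i)) =
      (orbitPullback α).modelValue p w := by
  have h := pullbackForm_comp (f := (orbitMk : M → OrbitSpace M)) (g := fun q : M => s +ᵥ q) (z := p)
    (mdifferentiableAt_orbitMk _) (mdifferentiableAt_translation (𝓡∂ 3) s p) α
  have e : (orbitMk ∘ fun q : M => s +ᵥ q) = (orbitMk : M → OrbitSpace M) :=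
    funext fun q => orbitMk_vadd s q
  rw [e] at h
  exact (congrArg (fun g => g w) h).symm

/-- The product of the fibre form `d c` and the pullback of a form `α`. -/
def fiberLift (c : M → ℝ) (α : DForm (𝓡∂ 2) (OrbitSpace M) k) : DForm (𝓡∂ 3) M (k + 1) :=
  (mulForm c (orbitPullback α)).extD - mulForm c (orbitPullback α).extD

/-- The homotopy between the identity and the lift of the fibre integral. -/
def fiberHomotopy (c : M → ℝ) (φ : DForm (𝓡∂ 3) M (k + 1)) : DForm (𝓡∂ 3) M k :=
  halfOrbitIntegral φ - mulForm c (orbitIntegral φ)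

variable {V : Set (OrbitSpace M)} {t : M → ℝ} {ρ C : ℝ → ℝ} {R : ℝ}

theorem contMDiffOn_cutoff (ht : IsTrivialization V t) (hC : IsCutoff ρ C R) :
    ContMDiffOn (𝓡∂ 3) 𝓘(ℝ, ℝ) ∞ (C ∘ t) (orbitMk ⁻¹' V) :=
  hC.contDiff.contMDiff.comp_contMDiffOn ht.contMDiffOn

theorem isOpen_orbitMk_preimage (hV : IsOpen V) : IsOpen (orbitMk ⁻¹' V : Set M) :=
  hV.preimage contMDiff_orbitMk.continuous

theorem supp_orbitPullback_subset {α : DForm (𝓡∂ 2) (OrbitSpace M) k} (hα : α.supp ⊆ V) :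
    (orbitPullback α).supp ⊆ orbitMk ⁻¹' V :=
  (supp_orbitPullback α).trans (preimage_mono hα)

theorem smooth_mulForm_orbitPullback (hV : IsOpen V) (ht : IsTrivialization V t) (hC : IsCutoff ρ C R)
    {α : DForm (𝓡∂ 2) (OrbitSpace M) k} (hα : α.Smooth) (hs : α.supp ⊆ V) :
    (mulForm (C ∘ t) (orbitPullback α)).Smooth :=
  smooth_mulForm (isOpen_orbitMk_preimage hV) (contMDiffOn_cutoff ht hC) (smooth_orbitPullback hα)
    (supp_orbitPullback_subset hs)

/-- By the Leibniz rule `d(C(t) π*α) - C(t) d(π*α)` is `d(C(t)) ∧ π*α`, and `C' = ρ`. Defining the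
lift this way makes its smoothness and differential immediate. Away from the preimage of `V` both
sides vanish. -/
theorem fiberLift_apply (hV : IsOpen V) (ht : IsTrivialization V t) (hC : IsCutoff ρ C R)
    {α : DForm (𝓡∂ 2) (OrbitSpace M) k} (hα : α.Smooth) (hs : α.supp ⊆ V) (p : M)
    (v : Fin (k + 1) → EuclideanSpace ℝ (Fin 3)) :
    (fiberLift (C ∘ t) α).modelValue p v = ∑ j : Fin (k + 1), (-1) ^ (j : ℕ) *
      (ρ (t p) * modelDeriv (𝓡∂ 3) 𝓘(ℝ, ℝ) t p (v j)) *
        (orbitPullback α).modelValue p (fun i => v (j.succAbove i)) := by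
  by_cases hp : orbitMk p ∈ V
  · have hW := (isOpen_orbitMk_preimage hV).mem_nhds (show p ∈ (orbitMk ⁻¹' V : Set M) from hp)
    have htp := (ht.contMDiffOn.contMDiffAt hW).mdifferentiableAt (by simp)
    have hdc : mfderiv (𝓡∂ 3) 𝓘(ℝ, ℝ) (C ∘ t) p = ρ (t p) • mfderiv (𝓡∂ 3) 𝓘(ℝ, ℝ) t p := by
      have h1 := ((hC.hasDerivAt (t p)).hasFDerivAt.hasMFDerivAt.comp p htp.hasMFDerivAt).mfderiv
      refine h1.trans ?_
      ext w
      change modelDeriv (𝓡∂ 3) 𝓘(ℝ, ℝ) t p w • ρ (t p) = ρ (t p) • modelDeriv (𝓡∂ 3) 𝓘(ℝ, ℝ) t p w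
      rw [smul_eq_mul, smul_eq_mul, mul_comm]
    have h2 := DForm.SmoothAt.extD_smul ((contMDiffOn_cutoff ht hC).contMDiffAt hW)
      ((smooth_orbitPullback hα).smoothAt p) hdc v
    refine (congrArg (fun r => r - C (t p) * (orbitPullback α).extD p v) h2).trans ?_
    exact add_sub_cancel_right _ _
  · have h0 : p ∉ (orbitPullback α).supp := fun h => hp (supp_orbitPullback_subset hs h)
    have h1 : orbitPullback α p = 0 := DForm.eq_zero_of_notMem_supp h0
    have h2 : (fiberLift (C ∘ t) α).modelValue p = 0 := by
      change (mulForm (C ∘ t) (orbitPullback α)).extD p - (C ∘ t) p • (orbitPullback α).extD p = 0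
      rw [DForm.extD_eq_zero_of_notMem_supp h0,
        DForm.extD_eq_zero_of_notMem_supp fun h => h0 (supp_mulForm_subset _ _ h), smul_zero, sub_zero]
    have h3 : (orbitPullback α).modelValue p = 0 := h1
    rw [h2, h3]
    simp

theorem isPoincareLift_fiberLift (hV : IsOpen V) (ht : IsTrivialization V t) (hC : IsCutoff ρ C R)
    {α : DForm (𝓡∂ 2) (OrbitSpace M) k} (hα : α.Smooth) (hs : α.supp ⊆ V) :
    IsPoincareLift rfl ρ t α (fiberLift (C ∘ t) α) := fun p v => fiberLift_apply hV ht hC hα hs p v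

theorem smooth_fiberLift (hV : IsOpen V) (ht : IsTrivialization V t) (hC : IsCutoff ρ C R)
    {α : DForm (𝓡∂ 2) (OrbitSpace M) k} (hα : α.Smooth) (hs : α.supp ⊆ V) :
    (fiberLift (C ∘ t) α).Smooth := by
  refine (smooth_mulForm_orbitPullback hV ht hC hα hs).extD.sub ?_
  exact smooth_mulForm (isOpen_orbitMk_preimage hV) (contMDiffOn_cutoff ht hC)
    (smooth_orbitPullback hα).extD ((DForm.supp_extD _).trans (supp_orbitPullback_subset hs))

theorem fiberLift_mem (hV : IsOpen V) (ht : IsTrivialization V t) (hC : IsCutoff ρ C R)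
    {α : DForm (𝓡∂ 2) (OrbitSpace M) k} (hα : α ∈ compactForms (𝓡∂ 2) V k) :
    fiberLift (C ∘ t) α ∈ compactForms (𝓡∂ 3) (orbitMk ⁻¹' V) (k + 1) := by
  have hK := isCompact_tube hV ht hα.2.1 hα.2.2 R
  have hs : (fiberLift (C ∘ t) α).supp ⊆ {p : M | orbitMk p ∈ α.supp ∧ |t p| ≤ R} := by
    refine DForm.supp_subset_of_isClosed hK.isClosed fun p hp => ?_
    ext v
    refine (fiberLift_apply hV ht hC hα.1 hα.2.2 p v).trans (Finset.sum_eq_zero fun j _ => ?_)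
    by_cases h1 : orbitMk p ∈ α.supp
    · have h2 : R < |t p| := not_le.1 fun h => hp ⟨h1, h⟩
      rw [hC.density_eq_zero _ h2]
      simp
    · have h2 : (orbitPullback α).modelValue p = 0 :=
        orbitPullback_eq_zero (DForm.eq_zero_of_notMem_supp h1)
      rw [h2]
      exact mul_zero _
  exact ⟨smooth_fiberLift hV ht hC hα.1 hα.2.2, hK.of_isClosed_subset isClosed_closure hs,
    hs.trans fun p hp => hα.2.2 hp.1⟩

/-- By `d² = 0` both sides reduce to `-d(C(t) π*dα)`. -/
theorem extD_fiberLift (hV : IsOpen V) (ht : IsTrivialization V t) (hC : IsCutoff ρ C R)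
    {α : DForm (𝓡∂ 2) (OrbitSpace M) k} (hα : α.Smooth) (hs : α.supp ⊆ V) :
    (fiberLift (C ∘ t) α).extD = -fiberLift (C ∘ t) α.extD := by
  have hmf : IsManifold (𝓡∂ 2) ∞ (OrbitSpace M) := IsSmoothQuotient.toIsManifold
  have h1 := smooth_mulForm_orbitPullback hV ht hC hα hs
  have h2 := smooth_mulForm_orbitPullback hV ht hC hα.extD ((DForm.supp_extD α).trans hs)
  have h3 : mulForm (C ∘ t) (orbitPullback α.extD).extD = 0 := by
    rw [extD_orbitPullback hα.extD, hα.extD_extD]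
    funext p
    rw [mulForm_apply, orbitPullback_eq_zero rfl, smul_zero]
    rfl
  rw [fiberLift, fiberLift, h3, sub_zero, extD_orbitPullback hα, h1.extD.extD_sub h2, h1.extD_extD,
    zero_sub]

theorem fiberLift_add (hV : IsOpen V) (ht : IsTrivialization V t) (hC : IsCutoff ρ C R)
    {α β : DForm (𝓡∂ 2) (OrbitSpace M) k} (hα : α.Smooth) (hs : α.supp ⊆ V) (hβ : β.Smooth)
    (hs' : β.supp ⊆ V) :
    fiberLift (C ∘ t) (α + β) = fiberLift (C ∘ t) α + fiberLift (C ∘ t) β := by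
  have e : orbitPullback (α + β) = orbitPullback α + orbitPullback β := map_add _ α β
  rw [fiberLift, e, mulForm_add, (smooth_mulForm_orbitPullback hV ht hC hα hs).extD_add
    (smooth_mulForm_orbitPullback hV ht hC hβ hs'), (smooth_orbitPullback hα).extD_add
    (smooth_orbitPullback hβ), mulForm_add, fiberLift, fiberLift, add_sub_add_comm]

theorem fiberLift_smul (c : M → ℝ) (r : ℝ) (α : DForm (𝓡∂ 2) (OrbitSpace M) k) :
    fiberLift c (r • α) = r • fiberLift c α := by
  have e : orbitPullback (r • α) = r • orbitPullback α := map_smul _ r α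
  rw [fiberLift, e, mulForm_smul, DForm.extD_smul, DForm.extD_smul, mulForm_smul, fiberLift, smul_sub]

/-- Only the zeroth term of the wedge product survives: all others insert the velocity into a
pulled-back form, and `dt` of the velocity is `1`. -/
theorem fiberLift_velocity (hV : IsOpen V) (ht : IsTrivialization V t) (hC : IsCutoff ρ C R)
    {α : DForm (𝓡∂ 2) (OrbitSpace M) k} (hα : α.Smooth) (hs : α.supp ⊆ V) {p : M} (hp : orbitMk p ∈ V)
    (w : Fin k → EuclideanSpace ℝ (Fin 3)) :
    (fiberLift (C ∘ t) α).modelValue p (Fin.cons (velocity (𝓡∂ 3) p) w : Fin (k + 1) → _) =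
      ρ (t p) * (orbitPullback α).modelValue p w := by
  rw [fiberLift_apply hV ht hC hα hs, Fin.sum_univ_succ, Finset.sum_eq_zero, add_zero]
  · simp [ht.modelDeriv_velocity hV hp]
  · intro j _
    obtain ⟨i, hi⟩ := Fin.exists_succAbove_eq (Fin.succ_ne_zero j).symm
    rw [orbitPullback_velocity α p (i := i) (by rw [hi]; rfl), mul_zero]

theorem orbitIntegral_fiberLift (hV : IsOpen V) (ht : IsTrivialization V t) (hC : IsCutoff ρ C R)
    {α : DForm (𝓡∂ 2) (OrbitSpace M) k} (hα : α ∈ compactForms (𝓡∂ 2) V k) :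
    orbitIntegral (fiberLift (C ∘ t) α) = orbitPullback α := by
  have hm := fiberLift_mem hV ht hC hα
  funext p
  by_cases hp : orbitMk p ∈ V
  · ext w
    refine (orbitIntegral_apply hm.1 hm.2.1 p w).trans ?_
    have h1 : ∀ r : ℝ, (fiberLift (C ∘ t) α).modelValue (r +ᵥ p)
        (Fin.cons (velocity (𝓡∂ 3) (r +ᵥ p)) (fun i => flowDeriv (𝓡∂ 3) r p (w i)) : Fin (k + 1) → _) =
        ρ (t p + r) * (orbitPullback α).modelValue p w := fun r => by
      rw [fiberLift_velocity hV ht hC hα.1 hα.2.2 (by rwa [orbitMk_vadd]), ht.equivariant p hp]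
      exact congrArg (ρ (t p + r) * ·) (orbitPullback_vadd α r p w)
    simp only [h1]
    rw [MeasureTheory.integral_mul_const, MeasureTheory.integral_add_left_eq_self (fun r => ρ r),
      hC.integral_eq_one, one_mul]
    rfl
  · rw [orbitPullback_eq_zero (DForm.eq_zero_of_notMem_supp fun h => hp (hα.2.2 h))]
    refine orbitIntegral_eq_zero fun r hr => hp ?_
    have := hm.2.2 hr
    rwa [mem_preimage, orbitMk_vadd] at this

theorem fiberPush_fiberLift {t₀ : M → ℝ} (ht₀ : IsTrivialization univ t₀) (hV : IsOpen V)
    (ht : IsTrivialization V t) (hC : IsCutoff ρ C R) {α : DForm (𝓡∂ 2) (OrbitSpace M) k}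
    (hα : α ∈ compactForms (𝓡∂ 2) V k) : fiberPush t₀ (fiberLift (C ∘ t) α) = α := by
  funext b
  have h := pullbackForm_comp (f := (orbitMk : M → OrbitSpace M)) (g := orbitSection t₀) (z := b)
    (mdifferentiableAt_orbitMk _) ((contMDiff_orbitSection ht₀).mdifferentiable (by simp) b) α
  have e : orbitMk ∘ orbitSection t₀ = (id : OrbitSpace M → _) := funext fun b => orbitMk_orbitSection b
  rw [e, pullbackForm_id] at h
  rw [fiberPush, orbitIntegral_fiberLift hV ht hC hα]
  exact h.symm

theorem fiberHomotopy_add {c : M → ℝ} {φ ψ : DForm (𝓡∂ 3) M (k + 1)} (hφ : φ.Smooth)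
    (hc : IsCompact φ.supp) (hψ : ψ.Smooth) (hc' : IsCompact ψ.supp) :
    fiberHomotopy c (φ + ψ) = fiberHomotopy c φ + fiberHomotopy c ψ := by
  rw [fiberHomotopy, halfOrbitIntegral_add hφ hc hψ hc', orbitIntegral_add hφ hc hψ hc', mulForm_add,
    add_sub_add_comm]
  rfl

theorem fiberHomotopy_smul (c : M → ℝ) (r : ℝ) (φ : DForm (𝓡∂ 3) M (k + 1)) :
    fiberHomotopy c (r • φ) = r • fiberHomotopy c φ := by
  rw [fiberHomotopy, halfOrbitIntegral_smul, orbitIntegral_smul, mulForm_smul]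
  exact (smul_sub r (halfOrbitIntegral φ) _).symm

theorem fiberHomotopy_velocity (c : M → ℝ) {φ : DForm (𝓡∂ 3) M (k + 1)} (hφ : φ.Smooth)
    (hc : IsCompact φ.supp) (p : M) {w : Fin k → EuclideanSpace ℝ (Fin 3)} {i : Fin k}
    (h : w i = velocity (𝓡∂ 3) p) : (fiberHomotopy c φ).modelValue p w = 0 := by
  change (halfOrbitIntegral φ).modelValue p w - c p * (orbitIntegral φ).modelValue p w = 0
  rw [halfOrbitIntegral_velocity hφ hc p h, orbitIntegral_velocity hφ hc p h, mul_zero, sub_zero]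

variable [LocallyCompactSpace M]

/-- The cutoff repairs the support of the half orbit integral: with `R₀` a bound for `|t|` on the
support of `φ`, the result lives in the tube of radius `max R R₀` over the projected support. -/
theorem fiberHomotopy_mem {t₀ : M → ℝ} (ht₀ : IsTrivialization univ t₀) (hV : IsOpen V)
    (ht : IsTrivialization V t) (hC : IsCutoff ρ C R) {φ : DForm (𝓡∂ 3) M (k + 1)}
    (hφ : φ ∈ compactForms (𝓡∂ 3) (orbitMk ⁻¹' V) (k + 1)) :
    fiberHomotopy (C ∘ t) φ ∈ compactForms (𝓡∂ 3) (orbitMk ⁻¹' V) k := by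
  have hpush := fiberPush_mem ht₀ hφ
  have hA : orbitIntegral φ = orbitPullback (fiberPush t₀ φ) :=
    (pullbackForm_orbitMk_fiberPush ht₀ hφ.1 hφ.2.1).symm
  have hsm : (fiberHomotopy (C ∘ t) φ).Smooth := by
    refine (smooth_halfOrbitIntegral hφ.1 hφ.2.1).sub ?_
    rw [hA]
    exact smooth_mulForm_orbitPullback hV ht hC hpush.1 hpush.2.2
  obtain ⟨R₀, hR₀⟩ : ∃ R₀, ∀ p ∈ φ.supp, |t p| ≤ R₀ := by
    obtain ⟨R₀, h⟩ := hφ.2.1.exists_bound_of_continuousOn (ht.contMDiffOn.continuousOn.mono hφ.2.2)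
    exact ⟨R₀, h⟩
  have hKV : (orbitMk '' φ.supp : Set (OrbitSpace M)) ⊆ V := by
    rintro _ ⟨p, hp, rfl⟩
    exact hφ.2.2 hp
  have hK := isCompact_tube hV ht (hφ.2.1.image contMDiff_orbitMk.continuous) hKV (max R R₀)
  have hs : (fiberHomotopy (C ∘ t) φ).supp ⊆
      {p : M | orbitMk p ∈ (orbitMk '' φ.supp : Set (OrbitSpace M)) ∧ |t p| ≤ max R R₀} := by
    refine DForm.supp_subset_of_isClosed hK.isClosed fun p hp => ?_
    change halfOrbitIntegral φ p - C (t p) • orbitIntegral φ p = 0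
    by_cases h1 : orbitMk p ∈ (orbitMk '' φ.supp : Set (OrbitSpace M))
    · have h2 : max R R₀ < |t p| := not_le.1 fun h => hp ⟨h1, h⟩
      rcases lt_abs.1 h2 with h3 | h3
      -- Ahead of the support the backward half orbit already sees all of it, and `C = 1`.
      · rw [hC.eq_one _ ((le_max_left _ _).trans h3.le), one_smul,
          halfOrbitIntegral_eq_orbitIntegral, sub_self]
        intro r hr hm
        have := hR₀ _ hm
        rw [ht.equivariant p (hKV h1)] at this
        linarith [le_abs_self (t p + r), le_max_right R R₀]
      -- Behind the support the backward half orbit misses it, and `C = 0`.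
      · rw [hC.eq_zero _ (by linarith [le_max_left R R₀]), zero_smul, sub_zero]
        refine halfOrbitIntegral_eq_zero fun r hr hm => ?_
        have := hR₀ _ hm
        rw [ht.equivariant p (hKV h1)] at this
        linarith [neg_abs_le (t p + r), le_max_right R R₀]
    · have h2 : ∀ r : ℝ, r +ᵥ p ∉ φ.supp := fun r hr => h1 ⟨_, hr, orbitMk_vadd r p⟩
      rw [orbitIntegral_eq_zero h2, halfOrbitIntegral_eq_zero fun r _ => h2 r, smul_zero, sub_zero]
  exact ⟨hsm, hK.of_isClosed_subset isClosed_closure hs, hs.trans fun p hp => hKV hp.1⟩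

/-- The half orbit integrals contribute `φ`. The correction contributes `-d(C(t) Aφ) + C(t) d(Aφ)`,
where `Aφ` is the orbit integral, and this is minus the lift of the fibre integral. -/
theorem extD_fiberHomotopy {t₀ : M → ℝ} (ht₀ : IsTrivialization univ t₀) (hV : IsOpen V)
    (ht : IsTrivialization V t) (hC : IsCutoff ρ C R) {φ : DForm (𝓡∂ 3) M (k + 1)}
    (hφ : φ ∈ compactForms (𝓡∂ 3) (orbitMk ⁻¹' V) (k + 1)) :
    (fiberHomotopy (C ∘ t) φ).extD + fiberHomotopy (C ∘ t) φ.extD =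
      φ - fiberLift (C ∘ t) (fiberPush t₀ φ) := by
  have hpush := fiberPush_mem ht₀ hφ
  have hA : orbitIntegral φ = orbitPullback (fiberPush t₀ φ) :=
    (pullbackForm_orbitMk_fiberPush ht₀ hφ.1 hφ.2.1).symm
  have hdA : orbitIntegral φ.extD = -(orbitIntegral φ).extD :=
    eq_neg_of_add_eq_zero_right (extD_orbitIntegral hφ.1 hφ.2.1)
  have hI := extD_halfOrbitIntegral hφ.1 hφ.2.1
  rw [fiberHomotopy, fiberHomotopy, hdA, mulForm_neg, (smooth_halfOrbitIntegral hφ.1 hφ.2.1).extD_sub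
    (by rw [hA]; exact smooth_mulForm_orbitPullback hV ht hC hpush.1 hpush.2.2), fiberLift, ← hA]
  refine Eq.trans ?_ (congrArg (· - _) hI)
  abel

theorem fiberHomotopy_extD_zero (c : M → ℝ) {φ : DForm (𝓡∂ 3) M 0} (hφ : φ.Smooth)
    (hc : IsCompact φ.supp) : fiberHomotopy c φ.extD = φ := by
  rw [fiberHomotopy, orbitIntegral_extD_zero hφ hc, halfOrbitIntegral_extD_zero hφ hc]
  funext p
  change φ p - c p • (0 : DForm (𝓡∂ 3) M 0) p = φ p
  rw [Pi.zero_apply, smul_zero, sub_zero]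

end Lift


/-! ### Null vectors and oriented frames in Lorentzian planes. -/

noncomputable section NullFrame

theorem ContinuousAlternatingMap.apply_cons_combination {E : Type} [NormedAddCommGroup E]
    [NormedSpace ℝ E] (g : E [⋀^Fin 3]→L[ℝ] ℝ) (x e₀ e₁ : E) (a b c d : ℝ) :
    g ![x, c • e₀ + d • e₁, a • e₀ + b • e₁] = (c * b - d * a) * g ![x, e₀, e₁] := by
  have hadd1 : ∀ u u' w, g ![x, u + u', w] = g ![x, u, w] + g ![x, u', w] := fun u u' w => by
    have h : ∀ v, (![x, v, w] : Fin 3 → E) = Function.update ![x, 0, w] 1 v := fun v => by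
      ext i; fin_cases i <;> rfl
    rw [h, h u, h u', g.map_update_add]
  have hsmul1 : ∀ (r : ℝ) u w, g ![x, r • u, w] = r * g ![x, u, w] := fun r u w => by
    have h : ∀ v, (![x, v, w] : Fin 3 → E) = Function.update ![x, 0, w] 1 v := fun v => by
      ext i; fin_cases i <;> rfl
    rw [h, h u, g.map_update_smul, smul_eq_mul]
  have hadd2 : ∀ u w w', g ![x, u, w + w'] = g ![x, u, w] + g ![x, u, w'] := fun u w w' => by
    have h : ∀ v, (![x, u, v] : Fin 3 → E) = Function.update ![x, u, 0] 2 v := fun v => by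
      ext i; fin_cases i <;> rfl
    rw [h, h w, h w', g.map_update_add]
  have hsmul2 : ∀ (r : ℝ) u w, g ![x, u, r • w] = r * g ![x, u, w] := fun r u w => by
    have h : ∀ v, (![x, u, v] : Fin 3 → E) = Function.update ![x, u, 0] 2 v := fun v => by
      ext i; fin_cases i <;> rfl
    rw [h, h w, g.map_update_smul, smul_eq_mul]
  have h0 : ∀ u, g ![x, u, u] = 0 := fun u =>
    g.map_eq_zero_of_eq _ (i := 1) (j := 2) rfl (by decide)
  have hsw : g ![x, e₁, e₀] = -g ![x, e₀, e₁] := by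
    have h := h0 (e₀ + e₁)
    rw [hadd1, hadd2, hadd2, h0, h0] at h
    linarith
  rw [hadd1, hsmul1, hsmul1, hadd2, hadd2, hsmul2, hsmul2, hsmul2, hsmul2, h0, h0, hsw]
  ring

variable {b : EuclideanSpace ℝ (Fin 2) →L[ℝ] EuclideanSpace ℝ (Fin 2) →L[ℝ] ℝ}

theorem exists_eq_combination (hs : ∀ v w, b v w = b w v) {e₀ e₁ : EuclideanSpace ℝ (Fin 2)}
    (h0 : b e₀ e₀ = -1) (h1 : b e₁ e₁ = 1) (h01 : b e₀ e₁ = 0) (v : EuclideanSpace ℝ (Fin 2)) :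
    ∃ x y : ℝ, v = x • e₀ + y • e₁ := by
  have h10 : b e₁ e₀ = 0 := (hs _ _).trans h01
  have hli : LinearIndependent ℝ ![e₀, e₁] := by
    rw [LinearIndependent.pair_iff]
    intro x y hxy
    have h2 := congrArg (fun u => b u e₀) hxy
    have h3 := congrArg (fun u => b u e₁) hxy
    simp [h0, h1, h01, h10] at h2 h3
    exact ⟨h2, h3⟩
  have hspan := hli.span_eq_top_of_card_eq_finrank (by simp)
  have hv : v ∈ Submodule.span ℝ (range ![e₀, e₁]) := hspan ▸ Submodule.mem_top
  rw [Matrix.range_cons_cons_empty, Submodule.mem_span_pair] at hv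
  obtain ⟨x, y, h⟩ := hv
  exact ⟨x, y, h.symm⟩

variable {o : EuclideanSpace ℝ (Fin 2) → EuclideanSpace ℝ (Fin 2) → ℝ}
  {τ n : EuclideanSpace ℝ (Fin 2)} {ε : ℝ}

/-- A null vector has coordinates `y = ±x` in the frame. For `y = x` the orientation of the pair
`(τ, n)` has the sign of `-b τ n`, for `y = -x` that of `b τ n`; hence `b τ n < 0` ties the line to
`ε`. -/
theorem exists_null_eq_smul (hs : ∀ v w, b v w = b w v)
    (ho : ∀ e₀ e₁ (x y z w : ℝ), o (z • e₀ + w • e₁) (x • e₀ + y • e₁) = (z * y - w * x) * o e₀ e₁)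
    (hε : ε = 1 ∨ ε = -1) (hnn : b n n = 0) (hτn : b τ n < 0) (hoτ : 0 < ε * o τ n)
    {e₀ e₁ : EuclideanSpace ℝ (Fin 2)}
    (h0 : b e₀ e₀ = -1) (h1 : b e₁ e₁ = 1) (h01 : b e₀ e₁ = 0) (hoe : 0 < o e₀ e₁) :
    ∃ a : ℝ, a ≠ 0 ∧ n = a • (e₀ + ε • e₁) := by
  obtain ⟨x, y, rfl⟩ := exists_eq_combination hs h0 h1 h01 n
  obtain ⟨z, w, rfl⟩ := exists_eq_combination hs h0 h1 h01 τ
  have h10 : b e₁ e₀ = 0 := (hs _ _).trans h01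
  simp [h0, h1, h01, h10] at hnn hτn
  rw [ho, ← mul_assoc] at hoτ
  have hpos := (mul_pos_iff_of_pos_right hoe).1 hoτ
  have hsq : (y - x) * (y + x) = 0 := by linarith
  rcases mul_eq_zero.1 hsq with h | h
  · have hy : y = x := by linarith
    subst hy
    have hε1 : ε = 1 := by
      rcases hε with h | h
      · exact h
      · rw [h] at hpos
        nlinarith
    subst hε1
    refine ⟨y, ?_, by simp⟩
    rintro rfl
    simp at hτn
  · have hy : y = -x := by linarith
    subst hy
    have hε1 : ε = -1 := by
      rcases hε with h | h
      · rw [h] at hpos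
        nlinarith
      · exact h
    subst hε1
    refine ⟨x, ?_, by simp⟩
    rintro rfl
    simp at hτn

/-- The orientation of a frame cannot be zero, as that of `(τ, n)` is a multiple of it; if it is
negative, `e₁` is reversed. -/
theorem exists_oriented_frame (hs : ∀ v w, b v w = b w v)
    (ho : ∀ e₀ e₁ (x y z w : ℝ), o (z • e₀ + w • e₁) (x • e₀ + y • e₁) = (z * y - w * x) * o e₀ e₁)
    (hoτ : 0 < ε * o τ n)
    (hb : ∃ e₀ e₁, b e₀ e₀ = -1 ∧ b e₁ e₁ = 1 ∧ b e₀ e₁ = 0) :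
    ∃ e₀ e₁, b e₀ e₀ = -1 ∧ b e₁ e₁ = 1 ∧ b e₀ e₁ = 0 ∧ 0 < o e₀ e₁ := by
  obtain ⟨e₀, e₁, h0, h1, h01⟩ := hb
  have hne : o e₀ e₁ ≠ 0 := by
    intro h
    obtain ⟨x, y, rfl⟩ := exists_eq_combination hs h0 h1 h01 n
    obtain ⟨z, w, rfl⟩ := exists_eq_combination hs h0 h1 h01 τ
    rw [ho, h] at hoτ
    simp at hoτ
  rcases lt_or_gt_of_ne hne with h | h
  · refine ⟨e₀, -e₁, h0, by simpa using h1, by simpa using h01, ?_⟩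
    have := ho e₀ e₁ 0 (-1) 1 0
    simp at this
    rw [this]
    linarith
  · exact ⟨e₀, e₁, h0, h1, h01, h⟩

end NullFrame

/-! ### Self-duality as vanishing on the chiral null direction. -/

noncomputable section BoundaryCondition
variable {M N : Type*} [TopologicalSpace M] [ChartedSpace (EuclideanHalfSpace 3) M]
  [TopologicalSpace N] [ChartedSpace (EuclideanSpace ℝ (Fin 2)) N] [IsManifold (𝓡 2) ∞ N]

theorem boundaryOrientation_combination (ι : N → M) (vol : DForm (𝓡∂ 3) M 3) (p : N)
    (e₀ e₁ : EuclideanSpace ℝ (Fin 2)) (x y z w : ℝ) :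
    boundaryOrientation ι vol p (z • e₀ + w • e₁ : EuclideanSpace ℝ (Fin 2))
      (x • e₀ + y • e₁ : EuclideanSpace ℝ (Fin 2)) = (z * y - w * x) * boundaryOrientation ι vol p e₀ e₁ := by
  have h := ContinuousAlternatingMap.apply_cons_combination (vol.modelValue (ι p))
    (-(EuclideanSpace.single (0 : Fin 3) (1 : ℝ))) (modelDeriv (𝓡 2) (𝓡∂ 3) ι p e₀)
    (modelDeriv (𝓡 2) (𝓡∂ 3) ι p e₁) x y z w
  rw [← map_smul, ← map_smul, ← map_smul, ← map_smul, ← map_add, ← map_add] at h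
  exact h

/-- A one-form is (anti-)self-dual if and only if it vanishes on the chiral null vectors. -/
theorem mem_selfDualForms_iff {ι : N → M} {vol : DForm (𝓡∂ 3) M 3} {g : LorentzMetric N}
    {τ n : ∀ p : N, TangentSpace (𝓡 2) p} {ε : ℤˣ}
    (hn : ∀ p, g.val p (n p) (n p) = 0 ∧ g.val p (τ p) (n p) < 0 ∧
      0 < ((ε : ℤ) : ℝ) * boundaryOrientation ι vol p (τ p) (n p)) (α : DForm (𝓡 2) N 1) :
    α ∈ selfDualForms g (boundaryOrientation ι vol) ε ↔ ∀ p, α p (fun _ => n p) = 0 := by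
  have hε : ((ε : ℤ) : ℝ) = 1 ∨ ((ε : ℤ) : ℝ) = -1 := by
    rcases Int.units_eq_one_or ε with rfl | rfl
    · left; norm_num
    · right; norm_num
  set r : ℝ := ((ε : ℤ) : ℝ) with hr
  have hrr : r * r = 1 := by rcases hε with h | h <;> rw [h] <;> norm_num
  have hval : ∀ (p : N) (a : ℝ) (e₀ e₁ : EuclideanSpace ℝ (Fin 2)),
      α.modelValue p (fun _ => a • (e₀ + r • e₁)) =
        a * (α.modelValue p ![e₀] + r * α.modelValue p ![e₁]) := by
    intro p a e₀ e₁
    have h1 : ∀ v : EuclideanSpace ℝ (Fin 2), (fun _ : Fin 1 => v) = Function.update (0 : Fin 1 → _) 0 v :=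
      fun v => by ext i; fin_cases i; rfl
    have h2 : ∀ v : EuclideanSpace ℝ (Fin 2), (![v] : Fin 1 → _) = Function.update (0 : Fin 1 → _) 0 v :=
      fun v => by ext i; fin_cases i; rfl
    rw [h1, h2, h2, (α.modelValue p).map_update_smul, (α.modelValue p).map_update_add,
      (α.modelValue p).map_update_smul, smul_eq_mul, smul_eq_mul]
  have hframe : ∀ (p : N) (e₀ e₁ : EuclideanSpace ℝ (Fin 2)),
      IsOrientedFrame g (boundaryOrientation ι vol) p e₀ e₁ →
        ∃ a : ℝ, a ≠ 0 ∧ n p = a • (e₀ + r • e₁) := fun p e₀ e₁ hf =>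
    exists_null_eq_smul (b := g.val p) (o := boundaryOrientation ι vol p) (τ := τ p) (n := n p)
      (g.symm p) (boundaryOrientation_combination ι vol p)
      hε (hn p).1 (hn p).2.1 (hn p).2.2 hf.1 hf.2.1 hf.2.2.1 hf.2.2.2
  have hnv : ∀ (p : N) (a : ℝ) (e₀ e₁ : EuclideanSpace ℝ (Fin 2)), n p = a • (e₀ + r • e₁) →
      α p (fun _ => n p) = a * (α.modelValue p ![e₀] + r * α.modelValue p ![e₁]) :=
    fun p a e₀ e₁ h => by
      rw [← hval, ← h]
      rfl
  constructor
  · intro h p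
    obtain ⟨e₀, e₁, hf⟩ := exists_oriented_frame (b := g.val p) (o := boundaryOrientation ι vol p)
      (τ := τ p) (n := n p) (g.symm p) (boundaryOrientation_combination ι vol p) (hn p).2.2
      (g.signature p)
    obtain ⟨a, -, ha⟩ := hframe p e₀ e₁ hf
    rw [hnv p a e₀ e₁ ha]
    -- The test covector `-g(e₀, ·)` is dual to `e₀`; it turns the Hodge identity into the vanishing
    -- of `α` on `e₀ + r • e₁`, of which `n p` is a multiple.
    have hb := h p e₀ e₁ hf (ContinuousAlternatingMap.ofSubsingleton ℝ (EuclideanSpace ℝ (Fin 2)) ℝ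
      (0 : Fin 1) (-(g.val p e₀)))
    have hb0 : ContinuousAlternatingMap.ofSubsingleton ℝ (EuclideanSpace ℝ (Fin 2)) ℝ
      (0 : Fin 1) (-(g.val p e₀)) ![e₀] = 1 := by
      exact (congrArg Neg.neg hf.1).trans (neg_neg 1)
    have hb1 : ContinuousAlternatingMap.ofSubsingleton ℝ (EuclideanSpace ℝ (Fin 2)) ℝ
      (0 : Fin 1) (-(g.val p e₀)) ![e₁] = 0 := by
      exact (congrArg Neg.neg hf.2.2.1).trans neg_zero
    have hb' : 1 * (r * α.modelValue p ![e₁]) - 0 * (r * α.modelValue p ![e₀]) =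
        -(1 * α.modelValue p ![e₀]) + 0 * α.modelValue p ![e₁] := by
      rw [← hb0, ← hb1]
      exact hb
    have : α.modelValue p ![e₀] + r * α.modelValue p ![e₁] = 0 := by linarith
    rw [this, mul_zero]
  · intro h p e₀ e₁ hf β
    obtain ⟨a, ha0, ha⟩ := hframe p e₀ e₁ hf
    have h1 := hnv p a e₀ e₁ ha
    rw [h p] at h1
    have h2 := (mul_eq_zero.1 h1.symm).resolve_left ha0
    change β ![e₀] * (r * α.modelValue p ![e₁]) - β ![e₁] * (r * α.modelValue p ![e₀]) =
      -(β ![e₀] * α.modelValue p ![e₀]) + β ![e₁] * α.modelValue p ![e₁]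
    have h3 : α.modelValue p ![e₀] = -(r * α.modelValue p ![e₁]) := by linarith
    rw [h3]
    linear_combination (β ![e₁] * α.modelValue p ![e₁]) * hrr

variable [AddAction ℝ M] [ContMDiffVAdd 𝓘(ℝ, ℝ) (𝓡∂ 3) ∞ ℝ M]

theorem modelDeriv_eq_velocity {ι : N → M} (hι : MDifferentiable (𝓡 2) (𝓡∂ 3) ι) {Θ : ℝ → N → N}
    (hΘM : ∀ (s : ℝ) (p : N), s +ᵥ ι p = ι (Θ s p)) {n : ∀ p : N, TangentSpace (𝓡 2) p} (p : N)
    (h0 : Θ 0 p = p) (hn : IsMIntegralCurve (I := 𝓡 2) (fun s => Θ s p) n) :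
    modelDeriv (𝓡 2) (𝓡∂ 3) ι p (n p) = velocity (𝓡∂ 3) (ι p) := by
  have h1 := hn 0
  have e : (fun r : ℝ => r +ᵥ ι p) = ι ∘ fun s => Θ s p := funext fun s => hΘM s p
  have h2 : modelDeriv 𝓘(ℝ, ℝ) (𝓡 2) (fun s => Θ s p) 0 1 = n p := by
    have h3 : modelDeriv 𝓘(ℝ, ℝ) (𝓡 2) (fun s => Θ s p) 0 1 =
        (1 : ℝ) • (n (Θ 0 p) : EuclideanSpace ℝ (Fin 2)) :=
      congrArg (fun L : ℝ →L[ℝ] EuclideanSpace ℝ (Fin 2) => L 1) h1.mfderiv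
    have h4 : ∀ q, q = p → (n q : EuclideanSpace ℝ (Fin 2)) = n p := by
      rintro q rfl
      rfl
    rw [h3, one_smul, h4 _ h0]
  rw [velocity, e, modelDeriv_comp (hι p) h1.mdifferentiableAt h0, ContinuousLinearMap.comp_apply, h2]

end BoundaryCondition


/-! ### Compatibility of the operators with the boundary condition. -/

noncomputable section ChiralFields
variable {M : Type*} [TopologicalSpace M] [ChartedSpace (EuclideanHalfSpace 3) M] [AddAction ℝ M]

/-- A complex of compactly supported forms on `U` whose `0`-forms vanish on the boundary and whose
`1`-forms vanish on the velocity of the action at the boundary. -/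
structure IsChiralFields (K : SubDeRham (𝓡∂ 3) M) (U : Set M) : Prop where
  zero : ∀ φ, φ ∈ K.carrier 0 ↔ φ ∈ compactForms (𝓡∂ 3) U 0 ∧ ∀ q ∈ (𝓡∂ 3).boundary M, φ q = 0
  one : ∀ φ, φ ∈ K.carrier 1 ↔ φ ∈ compactForms (𝓡∂ 3) U 1 ∧
    ∀ q ∈ (𝓡∂ 3).boundary M, φ.modelValue q (fun _ => velocity (𝓡∂ 3) q) = 0
  add_two : ∀ k φ, φ ∈ K.carrier (k + 2) ↔ φ ∈ compactForms (𝓡∂ 3) U (k + 2)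

theorem IsChiralFields.mem_compactForms {K : SubDeRham (𝓡∂ 3) M} {U : Set M}
    (hK : IsChiralFields K U) {k : ℕ} {φ : DForm (𝓡∂ 3) M k} (hφ : φ ∈ K.carrier k) :
    φ ∈ compactForms (𝓡∂ 3) U k := by
  match k, φ, hφ with
  | 0, φ, hφ => exact ((hK.zero φ).1 hφ).1
  | 1, φ, hφ => exact ((hK.one φ).1 hφ).1
  | k + 2, φ, hφ => exact (hK.add_two k φ).1 hφ

/-- Self-duality means vanishing on the chiral null field, and the inclusion of the boundary carries
this field to the velocity of the extended action. -/
theorem isChiralFields_conditionedFields [IsManifold (𝓡∂ 3) ∞ M] [ContMDiffVAdd 𝓘(ℝ, ℝ) (𝓡∂ 3) ∞ ℝ M]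
    {N : Type*} [TopologicalSpace N] [ChartedSpace (EuclideanSpace ℝ (Fin 2)) N] [IsManifold (𝓡 2) ∞ N]
    {ι : N → M} (hι : MDifferentiable (𝓡 2) (𝓡∂ 3) ι) (hιM : range ι = (𝓡∂ 3).boundary M)
    {vol : DForm (𝓡∂ 3) M 3} {g : LorentzMetric N} {τ : ∀ p : N, TangentSpace (𝓡 2) p} {ε : ℤˣ}
    {Θ : ℝ → N → N} (hΘ : IsChiralFlow g (boundaryOrientation ι vol) τ ε Θ)
    (hΘM : ∀ (s : ℝ) (p : N), s +ᵥ ι p = ι (Θ s p)) (U : Set M) :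
    IsChiralFields (conditionedFields ι g (boundaryOrientation ι vol) ε U) U := by
  obtain ⟨n, -, hn, hint⟩ := hΘ
  refine ⟨fun φ => and_congr_right fun _ => ?_, fun φ => and_congr_right fun _ => ?_,
    fun k φ => and_iff_left trivial⟩
  · rw [← hιM]
    constructor
    · rintro h _ ⟨p, rfl⟩
      have h0 : pullbackForm (𝓡∂ 3) (𝓡 2) ι 0 φ = 0 := h
      ext w
      have h1 : pullbackForm (𝓡∂ 3) (𝓡 2) ι 0 φ p (fun i => i.elim0) = 0 := by rw [h0]; rfl
      rw [pullbackForm_apply] at h1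
      exact (congrArg (φ (ι p)) (Subsingleton.elim _ _)).trans h1
    · intro h
      change pullbackForm (𝓡∂ 3) (𝓡 2) ι 0 φ = 0
      funext p
      ext w
      rw [pullbackForm_apply, h (ι p) (mem_range_self p)]
      rfl
  · rw [← hιM]
    have h1 : pullbackForm (𝓡∂ 3) (𝓡 2) ι 1 φ ∈ selfDualForms g (boundaryOrientation ι vol) ε ↔
        ∀ p, pullbackForm (𝓡∂ 3) (𝓡 2) ι 1 φ p (fun _ => n p) = 0 :=
      mem_selfDualForms_iff (fun p => (hn p).2) _
    have h2 : ∀ p, pullbackForm (𝓡∂ 3) (𝓡 2) ι 1 φ p (fun _ => n p) =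
        φ.modelValue (ι p) (fun _ => velocity (𝓡∂ 3) (ι p)) := fun p => by
      rw [← modelDeriv_eq_velocity hι hΘM p (hint p).1 (hint p).2]
      rfl
    refine h1.trans ?_
    simp only [h2]
    exact (forall_mem_range (p := fun q => φ.modelValue q (fun _ => velocity (𝓡∂ 3) q) = 0)).symm

variable [T2Space M] [IsManifold (𝓡∂ 3) ∞ M] [ContMDiffVAdd 𝓘(ℝ, ℝ) (𝓡∂ 3) ∞ ℝ M] [ProperVAdd ℝ M]
  [ChartedSpace (EuclideanHalfSpace 2) (OrbitSpace M)] [IsSmoothQuotient M] {k : ℕ}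
  {V : Set (OrbitSpace M)} {K : SubDeRham (𝓡∂ 3) M}

theorem mem_relativeForms_zero {α : DForm (𝓡∂ 2) (OrbitSpace M) 0} :
    α ∈ (relativeForms (OrbitSpace M) V).carrier 0 ↔
      α ∈ compactForms (𝓡∂ 2) V 0 ∧ ∀ b ∈ (𝓡∂ 2).boundary (OrbitSpace M), α b = 0 := by
  refine and_congr_right fun _ => ?_
  simp only [Submodule.mem_iInf, SetLike.mem_coe, LinearMap.mem_ker, LinearMap.proj_apply]

theorem mem_compactForms_of_mem_relativeForms {α : DForm (𝓡∂ 2) (OrbitSpace M) k}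
    (hα : α ∈ (relativeForms (OrbitSpace M) V).carrier k) : α ∈ compactForms (𝓡∂ 2) V k := hα.1

theorem vadd_mem_boundary_iff (s : ℝ) (p : M) :
    s +ᵥ p ∈ (𝓡∂ 3).boundary M ↔ p ∈ (𝓡∂ 3).boundary M := by
  rw [← orbitMk_mem_boundary_iff, orbitMk_vadd, orbitMk_mem_boundary_iff]

/-- Orbits of boundary points stay in the boundary, and for a 1-form the integrand is its value on
the velocity. Hence fibre integrals and homotopies of conditioned 1-forms vanish on the boundary. -/
theorem IsChiralFields.orbitIntegrand_eq_zero {U : Set M} (hK : IsChiralFields K U)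
    {φ : DForm (𝓡∂ 3) M 1} (hφ : φ ∈ K.carrier 1) {p : M} (hp : p ∈ (𝓡∂ 3).boundary M) (r : ℝ) :
    orbitIntegrand φ r p = 0 := by
  ext w
  rw [orbitIntegrand_apply]
  refine Eq.trans (congrArg _ ?_) (((hK.one φ).1 hφ).2 (r +ᵥ p) ((vadd_mem_boundary_iff r p).2 hp))
  funext i
  fin_cases i
  rfl

/-- Only 0-forms need attention: they vanish on the boundary of the quotient, so their lifts vanish
on the boundary of `M`. -/
theorem fiberLift_mem_carrier (hK : IsChiralFields K (orbitMk ⁻¹' V)) {t : M → ℝ} {ρ C : ℝ → ℝ} {R : ℝ}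
    (hV : IsOpen V) (ht : IsTrivialization V t) (hC : IsCutoff ρ C R)
    {α : DForm (𝓡∂ 2) (OrbitSpace M) k} (hα : α ∈ (relativeForms (OrbitSpace M) V).carrier k) :
    fiberLift (C ∘ t) α ∈ K.carrier (k + 1) := by
  have hm := fiberLift_mem hV ht hC hα.1
  match k, α, hα, hm with
  | 0, α, hα, hm =>
    refine (hK.one _).2 ⟨hm, fun q hq => ?_⟩
    have h0 : (orbitPullback α).modelValue q = 0 :=
      orbitPullback_eq_zero ((mem_relativeForms_zero.1 hα).2 _ (orbitMk_mem_boundary_iff.2 hq))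
    refine (fiberLift_apply hV ht hC hα.1.1 hα.1.2.2 q _).trans (Finset.sum_eq_zero fun j _ => ?_)
    rw [h0]
    exact mul_zero _
  | k + 1, α, hα, hm => exact (hK.add_two k _).2 hm

variable [LocallyCompactSpace M] {t₀ : M → ℝ}

theorem fiberPush_mem_carrier (hK : IsChiralFields K (orbitMk ⁻¹' V)) (ht₀ : IsTrivialization univ t₀)
    {φ : DForm (𝓡∂ 3) M (k + 1)} (hφ : φ ∈ K.carrier (k + 1)) :
    fiberPush t₀ φ ∈ (relativeForms (OrbitSpace M) V).carrier k := by
  have hm := fiberPush_mem ht₀ (hK.mem_compactForms hφ)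
  match k, φ, hφ, hm with
  | 0, φ, hφ, hm =>
    refine mem_relativeForms_zero.2 ⟨hm, fun b hb => ?_⟩
    have hs : orbitSection t₀ b ∈ (𝓡∂ 3).boundary M := by
      rw [← orbitMk_mem_boundary_iff, orbitMk_orbitSection]
      exact hb
    have h0 : orbitIntegral φ (orbitSection t₀ b) = 0 := by
      change (∫ r, orbitIntegrand φ r (orbitSection t₀ b)) = 0
      simp only [hK.orbitIntegrand_eq_zero hφ hs, MeasureTheory.integral_zero]
    ext w
    change orbitIntegral φ (orbitSection t₀ b) _ = 0
    rw [h0]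
    rfl
  | k + 1, φ, hφ, hm => exact ⟨hm, trivial⟩

/-- A resulting 0-form vanishes on the boundary because the integrand does; a resulting 1-form
satisfies the condition because it is horizontal everywhere. -/
theorem fiberHomotopy_mem_carrier (hK : IsChiralFields K (orbitMk ⁻¹' V)) (ht₀ : IsTrivialization univ t₀)
    {t : M → ℝ} {ρ C : ℝ → ℝ} {R : ℝ} (hV : IsOpen V) (ht : IsTrivialization V t) (hC : IsCutoff ρ C R)
    {φ : DForm (𝓡∂ 3) M (k + 1)} (hφ : φ ∈ K.carrier (k + 1)) :
    fiberHomotopy (C ∘ t) φ ∈ K.carrier k := by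
  have hc := hK.mem_compactForms hφ
  have hm := fiberHomotopy_mem ht₀ hV ht hC hc
  match k, φ, hφ, hc, hm with
  | 0, φ, hφ, hc, hm =>
    refine (hK.zero _).2 ⟨hm, fun q hq => ?_⟩
    change (∫ r in Iic 0, orbitIntegrand φ r q) - (C ∘ t) q • (∫ r, orbitIntegrand φ r q) = 0
    simp only [hK.orbitIntegrand_eq_zero hφ hq, MeasureTheory.integral_zero, smul_zero, sub_zero]
  | 1, φ, hφ, hc, hm =>
    exact (hK.one _).2 ⟨hm, fun q _ => fiberHomotopy_velocity _ hc.1 hc.2.1 q (i := 0) rfl⟩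
  | k + 2, φ, hφ, hc, hm => exact (hK.add_two k _).2 hm

end ChiralFields


/-! ### From operators on forms to cochain maps and homotopies in integer degrees. -/

noncomputable section Operators
universe u
variable {E : Type} [NormedAddCommGroup E] [NormedSpace ℝ E] {H : Type} [TopologicalSpace H]
  {I : ModelWithCorners ℝ E H} {X : Type u} [TopologicalSpace X] [ChartedSpace H X]
  {E' : Type} [NormedAddCommGroup E'] [NormedSpace ℝ E'] {H' : Type} [TopologicalSpace H']
  {J : ModelWithCorners ℝ E' H'} {Y : Type u} [TopologicalSpace Y] [ChartedSpace H' Y]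

namespace SubDeRham
variable (S : SubDeRham I X)

theorem obj_natCast (k : ℕ) : S.obj (k : ℤ) = S.carrier k := if_pos (Int.natCast_nonneg k)

theorem mem_carrier_of_mem_obj {m : ℤ} (hm : 0 ≤ m) {φ : DForm I X m.toNat} (hφ : φ ∈ S.obj m) :
    φ ∈ S.carrier m.toNat := by
  rwa [obj, if_pos hm] at hφ

theorem obj_eq_zero {m : ℤ} (hm : m < 0) (φ : S.obj m) : φ = 0 := by
  obtain ⟨φ, hφ⟩ := φ
  have h : S.obj m = ⊥ := if_neg (not_le.2 hm)
  rw [h, Submodule.mem_bot] at hφ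
  exact Subtype.ext hφ

/-- An element of the complex in a natural degree. -/
def ofCarrier {k : ℕ} {φ : DForm I X k} (hφ : φ ∈ S.carrier k) : S.obj (k : ℤ) :=
  ⟨φ, by rw [S.obj_natCast]; exact hφ⟩

theorem exists_ofCarrier {k : ℕ} (φ : S.obj (k : ℤ)) :
    ∃ (ψ : DForm I X k) (hψ : ψ ∈ S.carrier k), φ = S.ofCarrier hψ := by
  obtain ⟨φ, hφ⟩ := φ
  have h : φ ∈ S.carrier k := by
    rw [S.obj_natCast] at hφ
    exact hφ
  exact ⟨φ, h, rfl⟩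

theorem differential_ofCarrier {k : ℕ} {φ : DForm I X k} (hφ : φ ∈ S.carrier k)
    (h : (k : ℤ) + 1 = ((k + 1 : ℕ) : ℤ)) :
    S.differential k ((k + 1 : ℕ) : ℤ) h (S.ofCarrier hφ) = S.ofCarrier (S.extD_mem k φ hφ) :=
  Subtype.ext (dif_pos (c := k + 1 = k + 1) rfl)

theorem complex_d [IsManifold I ∞ X] {m n : ℤ} (h : m + 1 = n) :
    S.complex.d m n = ModuleCat.ofHom (S.differential m n h) := dif_pos h

theorem shift_two_d [IsManifold I ∞ X] {i j : ℤ} (h : i + 1 = j) :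
    (S.complex⟦(2 : ℤ)⟧).d i j = ModuleCat.ofHom (S.differential (i + 2) (j + 2) (by omega)) := by
  have h1 : (S.complex⟦(2 : ℤ)⟧).d i j = (2 : ℤ).negOnePow • S.complex.d (i + 2) (j + 2) := rfl
  rw [h1, Int.negOnePow_even 2 (by decide), one_smul]
  exact S.complex_d (by omega)

/-- The odd shift reverses the sign of the differential, the even shift by two does not; an operator
anticommuting with `d` thereby becomes a cochain map. -/
theorem shift_one_d [IsManifold I ∞ X] {i j : ℤ} (h : i + 1 = j) :
    (S.complex⟦(1 : ℤ)⟧).d i j = -ModuleCat.ofHom (S.differential (i + 1) (j + 1) (by omega)) := by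
  have h1 : (S.complex⟦(1 : ℤ)⟧).d i j = (1 : ℤ).negOnePow • S.complex.d (i + 1) (j + 1) := rfl
  rw [h1, Int.negOnePow_one, Units.neg_smul, one_smul]
  exact congrArg Neg.neg (S.complex_d (by omega))

end SubDeRham

/-- A linear operator between subcomplexes of de Rham complexes that lowers the degree by one. -/
structure LoweringOperator (S : SubDeRham I X) (T : SubDeRham J Y) where
  toFun : ∀ k, DForm I X (k + 1) → DForm J Y k
  mem : ∀ k φ, φ ∈ S.carrier (k + 1) → toFun k φ ∈ T.carrier k
  map_add : ∀ k φ ψ, φ ∈ S.carrier (k + 1) → ψ ∈ S.carrier (k + 1) →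
    toFun k (φ + ψ) = toFun k φ + toFun k ψ
  map_smul : ∀ k (c : ℝ) φ, toFun k (c • φ) = c • toFun k φ

/-- A linear operator between subcomplexes of de Rham complexes that raises the degree by one. -/
structure RaisingOperator (S : SubDeRham I X) (T : SubDeRham J Y) where
  toFun : ∀ k, DForm I X k → DForm J Y (k + 1)
  mem : ∀ k φ, φ ∈ S.carrier k → toFun k φ ∈ T.carrier (k + 1)
  map_add : ∀ k φ ψ, φ ∈ S.carrier k → ψ ∈ S.carrier k → toFun k (φ + ψ) = toFun k φ + toFun k ψ
  map_smul : ∀ k (c : ℝ) φ, toFun k (c • φ) = c • toFun k φ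

variable {S : SubDeRham I X} {T : SubDeRham J Y}

namespace LoweringOperator
variable (F : LoweringOperator S T)

/-- The operator in degrees given by two natural numbers, zero unless they are consecutive. -/
def degreewise (l k : ℕ) (φ : DForm I X l) : DForm J Y k :=
  if h : l = k + 1 then F.toFun k (h ▸ φ) else 0

theorem degreewise_mem {m n : ℤ} (h : m = n + 1) {φ : DForm I X m.toNat} (hφ : φ ∈ S.obj m) :
    F.degreewise m.toNat n.toNat φ ∈ T.obj n := by
  by_cases h' : m.toNat = n.toNat + 1
  · have hn : 0 ≤ n := by omega
    unfold SubDeRham.obj at hφ ⊢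
    rw [if_pos (by omega)] at hφ
    rw [if_pos hn]
    generalize m.toNat = l at h' φ hφ
    subst h'
    rw [degreewise, dif_pos rfl]
    exact F.mem _ _ hφ
  · rw [degreewise, dif_neg h']
    exact zero_mem _

/-- The operator on the components of the complexes in integer degrees. -/
def map (m n : ℤ) (h : m = n + 1) : S.obj m →ₗ[ℝ] T.obj n where
  toFun φ := ⟨F.degreewise m.toNat n.toNat φ.1, F.degreewise_mem h φ.2⟩
  map_add' := by
    rintro ⟨φ, hφ⟩ ⟨ψ, hψ⟩
    apply Subtype.ext
    change F.degreewise _ _ (φ + ψ) = F.degreewise _ _ φ + F.degreewise _ _ ψ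
    by_cases h' : m.toNat = n.toNat + 1
    · unfold SubDeRham.obj at hφ hψ
      rw [if_pos (by omega)] at hφ hψ
      generalize m.toNat = l at h' φ hφ ψ hψ
      subst h'
      simp only [degreewise, dif_pos]
      exact F.map_add _ _ _ hφ hψ
    · simp [degreewise, h']
  map_smul' := by
    rintro c ⟨φ, hφ⟩
    apply Subtype.ext
    change F.degreewise _ _ (c • φ) = c • F.degreewise _ _ φ
    clear hφ
    by_cases h' : m.toNat = n.toNat + 1
    · generalize m.toNat = l at h' φ
      subst h'
      simp only [degreewise, dif_pos]
      exact F.map_smul _ _ _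
    · simp [degreewise, h']

theorem map_ofCarrier {k : ℕ} {φ : DForm I X (k + 1)} (hφ : φ ∈ S.carrier (k + 1))
    (h : ((k + 1 : ℕ) : ℤ) = (k : ℤ) + 1) :
    F.map ((k + 1 : ℕ) : ℤ) k h (S.ofCarrier hφ) = T.ofCarrier (F.mem k φ hφ) :=
  Subtype.ext (dif_pos (c := k + 1 = k + 1) rfl)

theorem differential_map
    (hF : ∀ k φ, φ ∈ S.carrier (k + 1) → (F.toFun k φ).extD = -F.toFun (k + 1) φ.extD)
    (hF0 : ∀ φ, φ ∈ S.carrier 0 → F.toFun 0 φ.extD = 0) {m n m' n' : ℤ} (hm : m = n + 1)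
    (hm' : m' = n' + 1) (hS : m + 1 = m') (hT : n + 1 = n') (φ : S.obj m) :
    T.differential n n' hT (F.map m n hm φ) + F.map m' n' hm' (S.differential m m' hS φ) = 0 := by
  rcases lt_trichotomy n (-1) with hn | hn | hn
  · rw [S.obj_eq_zero (by omega) φ]
    simp
  -- The edge of the target: 0-forms map to the zero component in degree `-1`, and `hF0` supplies
  -- the vanishing on their differentials.
  · obtain rfl : m = ((0 : ℕ) : ℤ) := by omega
    obtain rfl : m' = ((0 + 1 : ℕ) : ℤ) := by omega
    obtain rfl : n' = ((0 : ℕ) : ℤ) := by omega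
    obtain ⟨ψ, hψ, rfl⟩ := S.exists_ofCarrier φ
    rw [T.obj_eq_zero (by omega) (F.map _ n hm _), map_zero, S.differential_ofCarrier, F.map_ofCarrier,
      zero_add]
    exact Subtype.ext (hF0 ψ hψ)
  · obtain ⟨k, rfl⟩ := Int.eq_ofNat_of_zero_le (show 0 ≤ n by omega)
    obtain rfl : m = ((k + 1 : ℕ) : ℤ) := by omega
    obtain rfl : n' = ((k + 1 : ℕ) : ℤ) := by omega
    obtain rfl : m' = ((k + 1 + 1 : ℕ) : ℤ) := by omega
    obtain ⟨ψ, hψ, rfl⟩ := S.exists_ofCarrier φ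
    rw [S.differential_ofCarrier, F.map_ofCarrier, F.map_ofCarrier, T.differential_ofCarrier]
    exact Subtype.ext (add_eq_zero_iff_eq_neg.2 (hF k ψ hψ))

variable [IsManifold I ∞ X] [IsManifold J ∞ Y]

/-- A lowering operator that anticommutes with the differential is a cochain map. -/
def cochainMap (hF : ∀ k φ, φ ∈ S.carrier (k + 1) → (F.toFun k φ).extD = -F.toFun (k + 1) φ.extD)
    (hF0 : ∀ φ, φ ∈ S.carrier 0 → F.toFun 0 φ.extD = 0) :
    S.complex⟦(2 : ℤ)⟧ ⟶ T.complex⟦(1 : ℤ)⟧ where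
  f i := ModuleCat.ofHom (F.map (i + 2) (i + 1) (by omega))
  comm' i j hij := by
    have hij' : i + 1 = j := hij
    rw [S.shift_two_d hij', T.shift_one_d hij']
    refine (Preadditive.comp_neg _ _).trans (neg_eq_of_add_eq_zero_right ?_)
    apply ModuleCat.hom_ext
    apply LinearMap.ext
    intro φ
    exact F.differential_map hF hF0 (m := i + 2) (m' := j + 2) (n := i + 1) (n' := j + 1) (by omega)
      (by omega) (by omega) (by omega) φ

end LoweringOperator

namespace RaisingOperator
variable (W : RaisingOperator S T)

/-- The operator in degrees given by two natural numbers, zero unless they are consecutive. -/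
def degreewise (k l : ℕ) (φ : DForm I X k) : DForm J Y l :=
  if h : k + 1 = l then h ▸ W.toFun k φ else 0

theorem degreewise_mem {m n : ℤ} (h : n = m + 1) {φ : DForm I X m.toNat} (hφ : φ ∈ S.obj m) :
    W.degreewise m.toNat n.toNat φ ∈ T.obj n := by
  unfold degreewise
  split_ifs with h'
  · have hm : 0 ≤ m := by omega
    unfold SubDeRham.obj at hφ ⊢
    rw [if_pos hm] at hφ
    rw [if_pos (by omega)]
    generalize n.toNat = l at h'
    subst h'
    exact W.mem _ _ hφ
  · exact zero_mem _

/-- The operator on the components of the complexes in integer degrees. -/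
def map (m n : ℤ) (h : n = m + 1) : S.obj m →ₗ[ℝ] T.obj n where
  toFun φ := ⟨W.degreewise m.toNat n.toNat φ.1, W.degreewise_mem h φ.2⟩
  map_add' := by
    rintro ⟨φ, hφ⟩ ⟨ψ, hψ⟩
    apply Subtype.ext
    change W.degreewise _ _ (φ + ψ) = W.degreewise _ _ φ + W.degreewise _ _ ψ
    unfold degreewise
    split_ifs with h'
    · unfold SubDeRham.obj at hφ hψ
      rw [if_pos (by omega)] at hφ hψ
      generalize n.toNat = l at h'
      subst h'
      exact W.map_add _ _ _ hφ hψ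
    · simp
  map_smul' := by
    rintro c ⟨φ, hφ⟩
    apply Subtype.ext
    change W.degreewise _ _ (c • φ) = c • W.degreewise _ _ φ
    unfold degreewise
    split_ifs with h'
    · generalize n.toNat = l at h'
      subst h'
      exact W.map_smul _ _ _
    · simp

theorem map_ofCarrier {k : ℕ} {φ : DForm I X k} (hφ : φ ∈ S.carrier k)
    (h : ((k + 1 : ℕ) : ℤ) = (k : ℤ) + 1) :
    W.map k ((k + 1 : ℕ) : ℤ) h (S.ofCarrier hφ) = T.ofCarrier (W.mem k φ hφ) :=
  Subtype.ext (dif_pos (c := k + 1 = k + 1) rfl)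

theorem differential_map
    (hW : ∀ k φ, φ ∈ S.carrier k → (W.toFun k φ).extD = -W.toFun (k + 1) φ.extD)
    {m n m' n' : ℤ} (hn : n = m + 1)
    (hn' : n' = m' + 1) (hS : m + 1 = m') (hT : n + 1 = n') (φ : S.obj m) :
    T.differential n n' hT (W.map m n hn φ) + W.map m' n' hn' (S.differential m m' hS φ) = 0 := by
  rcases lt_or_ge m 0 with hm | hm
  · rw [S.obj_eq_zero hm φ]
    simp
  · obtain ⟨k, rfl⟩ := Int.eq_ofNat_of_zero_le hm
    obtain rfl : n = ((k + 1 : ℕ) : ℤ) := by omega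
    obtain rfl : m' = ((k + 1 : ℕ) : ℤ) := by omega
    obtain rfl : n' = ((k + 1 + 1 : ℕ) : ℤ) := by omega
    obtain ⟨ψ, hψ, rfl⟩ := S.exists_ofCarrier φ
    rw [S.differential_ofCarrier, W.map_ofCarrier, W.map_ofCarrier, T.differential_ofCarrier]
    exact Subtype.ext (add_eq_zero_iff_eq_neg.2 (hW k ψ hψ))

variable [IsManifold I ∞ X] [IsManifold J ∞ Y]

/-- A raising operator that anticommutes with the differential is a cochain map. -/
def cochainMap (hW : ∀ k φ, φ ∈ S.carrier k → (W.toFun k φ).extD = -W.toFun (k + 1) φ.extD) :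
    S.complex⟦(1 : ℤ)⟧ ⟶ T.complex⟦(2 : ℤ)⟧ where
  f i := ModuleCat.ofHom (W.map (i + 1) (i + 2) (by omega))
  comm' i j hij := by
    have hij' : i + 1 = j := hij
    rw [S.shift_one_d hij', T.shift_two_d hij']
    refine Eq.trans (eq_neg_of_add_eq_zero_left ?_) (Preadditive.neg_comp _ _).symm
    apply ModuleCat.hom_ext
    apply LinearMap.ext
    intro φ
    exact W.differential_map hW (m := i + 1) (m' := j + 1) (n := i + 2) (n' := j + 2) (by omega)
      (by omega) (by omega) (by omega) φ

end RaisingOperator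

section Inverse
variable (F : LoweringOperator S T) (W : RaisingOperator T S)

theorem LoweringOperator.map_map_eq (h : ∀ k α, α ∈ T.carrier k → F.toFun k (W.toFun k α) = α)
    {m n : ℤ} (hm : m = n + 1) (α : T.obj n) : F.map m n hm (W.map n m hm α) = α := by
  rcases lt_or_ge n 0 with hn | hn
  · rw [T.obj_eq_zero hn α, map_zero, map_zero]
  · obtain ⟨k, rfl⟩ := Int.eq_ofNat_of_zero_le hn
    obtain rfl : m = ((k + 1 : ℕ) : ℤ) := by omega
    obtain ⟨ψ, hψ, rfl⟩ := T.exists_ofCarrier α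
    rw [W.map_ofCarrier, F.map_ofCarrier]
    exact Subtype.ext (h k ψ hψ)

theorem LoweringOperator.homotopy_map (P : LoweringOperator S S)
    (h : ∀ k φ, φ ∈ S.carrier (k + 1) →
      (P.toFun k φ).extD + P.toFun (k + 1) φ.extD = φ - W.toFun k (F.toFun k φ))
    (h0 : ∀ φ, φ ∈ S.carrier 0 → P.toFun 0 φ.extD = φ)
    {l m n : ℤ} (hl : m = l + 1) (hn : n = m + 1) (φ : S.obj m) :
    S.differential l m hl.symm (P.map m l hl φ) + P.map n m hn (S.differential m n hn.symm φ) +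
      W.map l m hl (F.map m l hl φ) = φ := by
  rcases lt_trichotomy l (-1) with hl' | hl' | hl'
  · rw [S.obj_eq_zero (by omega) φ]
    simp
  · obtain rfl : m = ((0 : ℕ) : ℤ) := by omega
    obtain rfl : n = ((0 + 1 : ℕ) : ℤ) := by omega
    obtain ⟨ψ, hψ, rfl⟩ := S.exists_ofCarrier φ
    rw [T.obj_eq_zero (by omega) (F.map _ l hl _), S.obj_eq_zero (by omega) (P.map _ l hl _), map_zero,
      map_zero, S.differential_ofCarrier, P.map_ofCarrier, zero_add, add_zero]
    exact Subtype.ext (h0 ψ hψ)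
  · obtain ⟨k, rfl⟩ := Int.eq_ofNat_of_zero_le (show 0 ≤ l by omega)
    obtain rfl : m = ((k + 1 : ℕ) : ℤ) := by omega
    obtain rfl : n = ((k + 1 + 1 : ℕ) : ℤ) := by omega
    obtain ⟨ψ, hψ, rfl⟩ := S.exists_ofCarrier φ
    rw [S.differential_ofCarrier, F.map_ofCarrier, P.map_ofCarrier, P.map_ofCarrier,
      S.differential_ofCarrier, W.map_ofCarrier]
    exact Subtype.ext (eq_sub_iff_add_eq.1 (h k ψ hψ))

variable [IsManifold I ∞ X] [IsManifold J ∞ Y]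
  (hF : ∀ k φ, φ ∈ S.carrier (k + 1) → (F.toFun k φ).extD = -F.toFun (k + 1) φ.extD)
  (hF0 : ∀ φ, φ ∈ S.carrier 0 → F.toFun 0 φ.extD = 0)
  (hW : ∀ k φ, φ ∈ T.carrier k → (W.toFun k φ).extD = -W.toFun (k + 1) φ.extD)

theorem cochainMap_comp_eq_id (h : ∀ k α, α ∈ T.carrier k → F.toFun k (W.toFun k α) = α) :
    W.cochainMap hW ≫ F.cochainMap hF hF0 = 𝟙 _ := by
  apply HomologicalComplex.hom_ext
  intro i
  apply ModuleCat.hom_ext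
  apply LinearMap.ext
  intro α
  exact F.map_map_eq W h (m := i + 2) (n := i + 1) (by omega) α

/-- The negative of a lowering operator as a map of degree `-1` of the shifted complex. -/
def shiftedNeg (P : LoweringOperator S S) (i j : ℤ) :
    (S.complex⟦(2 : ℤ)⟧).X i ⟶ (S.complex⟦(2 : ℤ)⟧).X j :=
  if h : j + 1 = i then -ModuleCat.ofHom (P.map (i + 2) (j + 2) (by omega)) else 0

theorem shiftedNeg_of_eq (P : LoweringOperator S S) {i j : ℤ} (h : j + 1 = i) :
    shiftedNeg P i j = -ModuleCat.ofHom (P.map (i + 2) (j + 2) (by omega)) := dif_pos h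

/-- The homotopy between the composition and the identity given by a lowering operator. -/
def cochainHomotopy (P : LoweringOperator S S)
    (h : ∀ k φ, φ ∈ S.carrier (k + 1) →
      (P.toFun k φ).extD + P.toFun (k + 1) φ.extD = φ - W.toFun k (F.toFun k φ))
    (h0 : ∀ φ, φ ∈ S.carrier 0 → P.toFun 0 φ.extD = φ) :
    Homotopy (F.cochainMap hF hF0 ≫ W.cochainMap hW) (𝟙 _) where
  hom := shiftedNeg P
  zero i j hij := dif_neg hij
  comm i := by
    rw [dNext_eq _ (show (ComplexShape.up ℤ).Rel i (i + 1) from rfl),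
      prevD_eq _ (show (ComplexShape.up ℤ).Rel (i - 1) i from sub_add_cancel i 1),
      shiftedNeg_of_eq P rfl, shiftedNeg_of_eq P (sub_add_cancel i 1), S.shift_two_d rfl,
      S.shift_two_d (sub_add_cancel i 1)]
    refine Eq.trans ?_ (congrArg₂ (fun a b => a + b + _) (Preadditive.comp_neg _ _).symm
      (Preadditive.neg_comp _ _).symm)
    -- A `Homotopy` from the composition to the identity expresses the composition as `dh + hd` plus
    -- the identity, whereas `dP + Pd` is the identity minus the composition; hence `h = -P`.
    rw [← neg_add, eq_neg_add_iff_add_eq]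
    apply ModuleCat.hom_ext
    apply LinearMap.ext
    intro φ
    have h2 := F.homotopy_map W P h h0 (l := i - 1 + 2) (m := i + 2) (n := i + 1 + 2) (by omega)
      (by omega) φ
    -- The degrees `i - 1 + 2` and `i + 1` are equal only propositionally.
    have h3 : ∀ (l : ℤ) (hl : i + 2 = l + 1), l = i + 1 →
        W.map l (i + 2) hl (F.map (i + 2) l hl φ) =
        W.map (i + 1) (i + 2) (by omega) (F.map (i + 2) (i + 1) (by omega) φ) := by
      rintro l hl rfl
      rfl
    rw [h3 _ _ (by omega), add_comm (S.differential _ _ _ _)] at h2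
    exact h2

end Inverse

end Operators


/-! ### Assembly of the cochain maps and the main theorem. -/

noncomputable section Assembly
variable {M : Type*} [TopologicalSpace M] [T2Space M] [ChartedSpace (EuclideanHalfSpace 3) M]
  [IsManifold (𝓡∂ 3) ∞ M] [AddAction ℝ M] [ContMDiffVAdd 𝓘(ℝ, ℝ) (𝓡∂ 3) ∞ ℝ M] [ProperVAdd ℝ M]
  [ChartedSpace (EuclideanHalfSpace 2) (OrbitSpace M)] [IsSmoothQuotient M] [LocallyCompactSpace M]
  {K : SubDeRham (𝓡∂ 3) M} {V : Set (OrbitSpace M)} {t₀ t : M → ℝ} {ρ C : ℝ → ℝ} {R : ℝ}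

theorem IsTrivialization.mono {W : Set (OrbitSpace M)} (ht : IsTrivialization W t) (h : V ⊆ W) :
    IsTrivialization V t :=
  ⟨ht.contMDiffOn.mono (preimage_mono h), fun p hp => ht.equivariant p (h hp)⟩

/-- Fiber integration, as an operator between complexes of forms. -/
def fiberPushOperator (hK : IsChiralFields K (orbitMk ⁻¹' V)) (ht₀ : IsTrivialization univ t₀) :
    LoweringOperator K (relativeForms (OrbitSpace M) V) where
  toFun _ φ := fiberPush t₀ φ
  mem _ _ hφ := fiberPush_mem_carrier hK ht₀ hφ
  map_add _ _ _ hφ hψ := fiberPush_add (hK.mem_compactForms hφ).1 (hK.mem_compactForms hφ).2.1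
    (hK.mem_compactForms hψ).1 (hK.mem_compactForms hψ).2.1
  map_smul _ c φ := fiberPush_smul c φ

/-- The product with a bump form along the fibers, as an operator between complexes of forms. -/
def fiberLiftOperator (hK : IsChiralFields K (orbitMk ⁻¹' V)) (hV : IsOpen V)
    (ht : IsTrivialization V t) (hC : IsCutoff ρ C R) :
    RaisingOperator (relativeForms (OrbitSpace M) V) K where
  toFun _ α := fiberLift (C ∘ t) α
  mem _ _ hα := fiberLift_mem_carrier hK hV ht hC hα
  map_add _ _ _ hα hβ :=
    have h := mem_compactForms_of_mem_relativeForms hα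
    have h' := mem_compactForms_of_mem_relativeForms hβ
    fiberLift_add hV ht hC h.1 h.2.2 h'.1 h'.2.2
  map_smul _ r α := fiberLift_smul _ r α

/-- The homotopy operator of the Poincaré lemma, as an operator between complexes of forms. -/
def fiberHomotopyOperator (hK : IsChiralFields K (orbitMk ⁻¹' V)) (ht₀ : IsTrivialization univ t₀)
    (hV : IsOpen V) (ht : IsTrivialization V t) (hC : IsCutoff ρ C R) : LoweringOperator K K where
  toFun _ φ := fiberHomotopy (C ∘ t) φ
  mem _ _ hφ := fiberHomotopy_mem_carrier hK ht₀ hV ht hC hφ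
  map_add _ _ _ hφ hψ := fiberHomotopy_add (hK.mem_compactForms hφ).1 (hK.mem_compactForms hφ).2.1
    (hK.mem_compactForms hψ).1 (hK.mem_compactForms hψ).2.1
  map_smul _ r φ := fiberHomotopy_smul _ r φ

/-- Fiber integration as a cochain map. -/
def fiberPushMap (hK : IsChiralFields K (orbitMk ⁻¹' V)) (ht₀ : IsTrivialization univ t₀) :
    K.complex⟦(2 : ℤ)⟧ ⟶ (relativeForms (OrbitSpace M) V).complex⟦(1 : ℤ)⟧ :=
  (fiberPushOperator hK ht₀).cochainMap
    (fun _ _ hφ => extD_fiberPush ht₀ (hK.mem_compactForms hφ).1 (hK.mem_compactForms hφ).2.1)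
    (fun _ hφ => fiberPush_extD_zero (hK.mem_compactForms hφ).1 (hK.mem_compactForms hφ).2.1)

/-- The product with a bump form along the fibers as a cochain map. -/
def fiberLiftMap (hK : IsChiralFields K (orbitMk ⁻¹' V)) (hV : IsOpen V)
    (ht : IsTrivialization V t) (hC : IsCutoff ρ C R) :
    (relativeForms (OrbitSpace M) V).complex⟦(1 : ℤ)⟧ ⟶ K.complex⟦(2 : ℤ)⟧ :=
  (fiberLiftOperator hK hV ht hC).cochainMap fun _ _ hα =>
    have h := mem_compactForms_of_mem_relativeForms hα
    extD_fiberLift hV ht hC h.1 h.2.2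

theorem fiberLiftMap_comp_fiberPushMap (hK : IsChiralFields K (orbitMk ⁻¹' V))
    (ht₀ : IsTrivialization univ t₀) (hV : IsOpen V) (ht : IsTrivialization V t)
    (hC : IsCutoff ρ C R) : fiberLiftMap hK hV ht hC ≫ fiberPushMap hK ht₀ = 𝟙 _ :=
  cochainMap_comp_eq_id _ _ _ _ _ fun _ _ hα =>
    fiberPush_fiberLift ht₀ hV ht hC (mem_compactForms_of_mem_relativeForms hα)

/-- The cochain homotopy of the Poincaré lemma along the fibers. -/
def fiberCochainHomotopy (hK : IsChiralFields K (orbitMk ⁻¹' V))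
    (ht₀ : IsTrivialization univ t₀) (hV : IsOpen V) (ht : IsTrivialization V t)
    (hC : IsCutoff ρ C R) : Homotopy (fiberPushMap hK ht₀ ≫ fiberLiftMap hK hV ht hC) (𝟙 _) :=
  cochainHomotopy _ _ _ _ _ (fiberHomotopyOperator hK ht₀ hV ht hC)
    (fun _ _ hφ => extD_fiberHomotopy ht₀ hV ht hC (hK.mem_compactForms hφ))
    (fun _ hφ => fiberHomotopy_extD_zero _ (hK.mem_compactForms hφ).1 (hK.mem_compactForms hφ).2.1)

theorem isFiberIntegral_degreewise (hK : IsChiralFields K (orbitMk ⁻¹' V))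
    (ht₀ : IsTrivialization univ t₀) {l k : ℕ} (h : l = k + 1) {φ : DForm (𝓡∂ 3) M l}
    (hφ : φ ∈ K.carrier l) : IsFiberIntegral h φ ((fiberPushOperator hK ht₀).degreewise l k φ) := by
  subst h
  rw [LoweringOperator.degreewise, dif_pos rfl]
  exact isFiberIntegral_fiberPush ht₀ (hK.mem_compactForms hφ).1 (hK.mem_compactForms hφ).2.1

theorem isPoincareLift_degreewise (hK : IsChiralFields K (orbitMk ⁻¹' V)) (hV : IsOpen V)
    (ht : IsTrivialization V t) (hC : IsCutoff ρ C R) {l k : ℕ} (h : l = k + 1)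
    {α : DForm (𝓡∂ 2) (OrbitSpace M) k} (hα : α ∈ (relativeForms (OrbitSpace M) V).carrier k) :
    IsPoincareLift h ρ t α ((fiberLiftOperator hK hV ht hC).degreewise k l α) := by
  subst h
  rw [RaisingOperator.degreewise, dif_pos rfl]
  have h := mem_compactForms_of_mem_relativeForms hα
  exact isPoincareLift_fiberLift hV ht hC h.1 h.2.2

/-- The bound `-1 ≤ i` is where the form degrees `i + 2` and `i + 1` are genuinely consecutive
naturals; in lower degrees the target component is zero. -/
theorem isFiberIntegral_fiberPushMap (hK : IsChiralFields K (orbitMk ⁻¹' V))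
    (ht₀ : IsTrivialization univ t₀) {i : ℤ} (hi : -1 ≤ i)
    (h : (i + 2).toNat = (i + 1).toNat + 1) (φ : (K.complex⟦(2 : ℤ)⟧).X i) :
    IsFiberIntegral h (K.form (m := i + 2) φ)
      ((relativeForms (OrbitSpace M) V).form (m := i + 1) ((fiberPushMap hK ht₀).f i φ)) :=
  isFiberIntegral_degreewise hK ht₀ h (K.mem_carrier_of_mem_obj (by omega) (Subtype.prop _))

theorem isPoincareLift_fiberLiftMap (hK : IsChiralFields K (orbitMk ⁻¹' V)) (hV : IsOpen V)
    (ht : IsTrivialization V t) (hC : IsCutoff ρ C R) {i : ℤ} (hi : -1 ≤ i)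
    (h : (i + 2).toNat = (i + 1).toNat + 1)
    (α : ((relativeForms (OrbitSpace M) V).complex⟦(1 : ℤ)⟧).X i) :
    IsPoincareLift h ρ t ((relativeForms (OrbitSpace M) V).form (m := i + 1) α)
      (K.form (m := i + 2) ((fiberLiftMap hK hV ht hC).f i α)) :=
  isPoincareLift_degreewise hK hV ht hC h
    (SubDeRham.mem_carrier_of_mem_obj _ (by omega) (Subtype.prop _))

theorem exists_contDiff_hasCompactSupport_integral_eq_one :
    ∃ ρ : ℝ → ℝ, ContDiff ℝ ∞ ρ ∧ HasCompactSupport ρ ∧ ∫ r, ρ r = 1 :=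
  have f : ContDiffBump (0 : ℝ) := default
  ⟨f.normed MeasureTheory.volume, f.contDiff_normed, f.hasCompactSupport_normed, f.integral_normed⟩

/-- Any bump function of integral one provides a homotopy inverse. -/
theorem quasiIso_fiberPushMap (hK : IsChiralFields K (orbitMk ⁻¹' V))
    (ht₀ : IsTrivialization univ t₀) (hV : IsOpen V) : QuasiIso (fiberPushMap hK ht₀) := by
  obtain ⟨ρ, hρ, hc, h1⟩ := exists_contDiff_hasCompactSupport_integral_eq_one
  obtain ⟨C, R, hC⟩ := exists_isCutoff hρ hc h1
  have ht : IsTrivialization V t₀ := ht₀.mono (subset_univ V)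
  let e : HomotopyEquiv (K.complex⟦(2 : ℤ)⟧) ((relativeForms (OrbitSpace M) V).complex⟦(1 : ℤ)⟧) :=
    ⟨fiberPushMap hK ht₀, fiberLiftMap hK hV ht hC, fiberCochainHomotopy hK ht₀ hV ht hC,
      Homotopy.ofEq (fiberLiftMap_comp_fiberPushMap hK ht₀ hV ht hC)⟩
  exact e.quasiIso_hom

end Assembly

theorem mainTheorem11 {M : Type*} [TopologicalSpace M] [T2Space M] [SecondCountableTopology M]
    [ChartedSpace (EuclideanHalfSpace 3) M] [IsManifold (𝓡∂ 3) ∞ M]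
    {N : Type*} [TopologicalSpace N] [ChartedSpace (EuclideanSpace ℝ (Fin 2)) N]
    [IsManifold (𝓡 2) ∞ N]
    (ι : N → M) (hι : IsSmoothEmbedding (𝓡 2) (𝓡∂ 3) ∞ ι) (hιM : range ι = (𝓡∂ 3).boundary M)
    (vol : DForm (𝓡∂ 3) M 3) (hvol : vol.Smooth) (hvol0 : ∀ x, vol x ≠ 0)
    (g : LorentzMetric N) (τ : ∀ p : N, TangentSpace (𝓡 2) p)
    (hτ : ContMDiff (𝓡 2) (𝓡 2).tangent ∞ (fun p => (⟨p, τ p⟩ : TangentBundle (𝓡 2) N)))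
    (hτ0 : ∀ p, g.val p (τ p) (τ p) < 0)
    (ε : ℤˣ) (Θ : ℝ → N → N) (hΘ : IsChiralFlow g (boundaryOrientation ι vol) τ ε Θ)
    [AddAction ℝ M] [ContMDiffVAdd 𝓘(ℝ, ℝ) (𝓡∂ 3) ∞ ℝ M] [ProperVAdd ℝ M]
    (hΘM : ∀ (s : ℝ) (p : N), s +ᵥ ι p = ι (Θ s p)) :
    (∃ _ : ChartedSpace (EuclideanHalfSpace 2) (OrbitSpace M), IsSmoothQuotient M) ∧
    ∀ [ChartedSpace (EuclideanHalfSpace 2) (OrbitSpace M)] [IsSmoothQuotient M]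
      (V : TopologicalSpace.Opens (OrbitSpace M)),
      let K := conditionedFields ι g (boundaryOrientation ι vol) ε (orbitMk ⁻¹' (V : Set (OrbitSpace M)))
      let L := relativeForms (OrbitSpace M) (V : Set (OrbitSpace M))
      ∃ f : K.complex⟦(2 : ℤ)⟧ ⟶ L.complex⟦(1 : ℤ)⟧,
        (∀ (i : ℤ) (hi : -1 ≤ i) (φ : (K.complex⟦(2 : ℤ)⟧).X i),
          IsFiberIntegral (by omega) (K.form (m := i + 2) φ) (L.form (m := i + 1) (f.f i φ))) ∧
        QuasiIso f ∧
        (∃ t : M → ℝ, IsTrivialization (V : Set (OrbitSpace M)) t) ∧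
        ∀ (t : M → ℝ) (ρ : ℝ → ℝ), IsTrivialization (V : Set (OrbitSpace M)) t →
          ContDiff ℝ ∞ ρ → HasCompactSupport ρ → (∫ r, ρ r) = 1 →
          ∃ w : L.complex⟦(1 : ℤ)⟧ ⟶ K.complex⟦(2 : ℤ)⟧,
            (∀ (i : ℤ) (hi : -1 ≤ i) (α : (L.complex⟦(1 : ℤ)⟧).X i),
              IsPoincareLift (by omega) ρ t (L.form (m := i + 1) α)
                (K.form (m := i + 2) (w.f i α))) ∧
            w ≫ f = 𝟙 _ ∧ Nonempty (Homotopy (f ≫ w) (𝟙 _)) := by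
  have : LocallyCompactSpace (EuclideanHalfSpace 3) := (𝓡∂ 3).locallyCompactSpace
  have : LocallyCompactSpace M := ChartedSpace.locallyCompactSpace (EuclideanHalfSpace 3) M
  refine ⟨exists_isSmoothQuotient, fun V => ?_⟩
  have hK := isChiralFields_conditionedFields (hι.contMDiff.mdifferentiable (by simp)) hιM hΘ hΘM
    (orbitMk ⁻¹' (V : Set (OrbitSpace M)))
  -- One global fibre coordinate defines fibre integration for every `V`. It is independent of the
  -- `t` used for a lift over `V`, because pulled back to `M` the fibre integral is the orbit
  -- integral, which involves no trivialization.
  obtain ⟨t₀, ht₀⟩ := exists_trivialization (M := M)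
  refine ⟨fiberPushMap hK ht₀, fun i hi => isFiberIntegral_fiberPushMap hK ht₀ hi _,
    quasiIso_fiberPushMap hK ht₀ V.isOpen, ⟨t₀, ht₀.mono (subset_univ _)⟩,
    fun t ρ ht hρ hc h1 => ?_⟩
  obtain ⟨C, R, hC⟩ := exists_isCutoff hρ hc h1
  exact ⟨fiberLiftMap hK V.isOpen ht hC,
    fun i hi => isPoincareLift_fiberLiftMap hK V.isOpen ht hC hi _,
    fiberLiftMap_comp_fiberPushMap hK ht₀ V.isOpen ht hC,
    ⟨fiberCochainHomotopy hK ht₀ V.isOpen ht hC⟩⟩
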